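/- **Setting.** Let $d\ge 1$, $\alpha\in(0,1)$, and let $r$ be a random return vector in $\mathbb R^d$ with law $\mu$. For a portfolio $w\in\mathbb R^d$ let $L(w)=-w^\top r$, $\mathrm{VaR}_\alpha(w)=\inf\{z:\Pr[L(w)\le z]\ge\alpha\}$, $\mathrm{CVaR}_\alpha(w)=\mathbb E[L(w)\mid L(w)\ge \mathrm{VaR}_\alpha(w)]$ and $g(w)=\mathbb E[-r\mid L(w)\ge \mathrm{VaR}_\alpha(w)]$. Let $\mathcal W\subseteq\mathbb R^d$ be nonempty, closed, convex and contained in the ball of radius $R$ around $0$; let $\Pi_{\mathcal W}$ be the Euclidean projection onto $\mathcal W$, and let $w^\star\in\mathcal W$ be any minimizer of $\mathrm{CVaR}_\alpha$ over $\mathcal W$. Assume $\|r\|_2\le G$ almost surely. Projected stochastic subgradient descent is $w_{t+1}=\Pi_{\mathcal W}(w_t-\eta_t\tilde g_t)$, $t\ge1$, started in $\mathcal W$, with step sizes $c_1/\sqrt t\le\eta_t\le c_2/\sqrt t$ where $0<c_1$, $0<c_2$. **(a) Convergence.** There is a constant $C$ depending only on $G,R,c_1,c_2$ such that the following holds. Suppose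 that $L(w)$ has no atoms for every $w\in\mathcal W$. Let $T\ge1$ and $\epsilon\ge0$, and suppose that the (random) oracle outputs $\tilde g_t$ have accuracy $\epsilon$, in the sense that either $\mathbb E\|\tilde g_t-g(w_t)\|_2\le\epsilon$ for all $t\le T$, or $\Pr[\|\tilde g_t-g(w_t)\|_2>\epsilon]\le 1/T$ for all $t\le T$. Then $$\min_{t\le T}\mathbb E\big[\mathrm{CVaR}_\alpha(w_t)-\mathrm{CVaR}_\alpha(w^\star)\big]\le C\Big(\frac1{\sqrt T}+\epsilon\Big).$$ **(b) Query complexity.** There are an absolute constant $k$ and a constant $C$ depending only on $\alpha,G,R,M,c_1,c_2$ such that the following holds for all $d$, all $\mathcal W$, all starting points in $\mathcal W$, all step sizes as above and all $\epsilon\in(0,1)$. Call a law $\mu$ *regular* if $\|r\|_2\le G$ almost surely and, for every $w\in\mathcal W$, $L(w)$ has a density bounded by $M$. *Quantum.* Let $\nu$ be a $\sigma$-finite reference measure on $\mathbb R^d$ and $e_0\in L^2(\nu)$ a unit vector. There are a number $T$ and, for each $w$, a quantum query program with output in $\mathbb R^d$ such that for every regular $\mu\ll\nu$, and every unitary $U$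 of $L^2(\nu)$ with $Ue_0=\sqrt{d\mu/d\nu}$ given as the oracle: the output $\tilde g$ of the program for $w$ satisfies $\mathbb E\|\tilde g-g(w)\|_2\le\epsilon$ for all $w\in\mathcal W$; projected stochastic subgradient descent with these programs as subgradient oracle satisfies $\min_{t\le T}\mathbb E[\mathrm{CVaR}_\alpha(w_t)-\mathrm{CVaR}_\alpha(w^\star)]\le\epsilon$; and the whole run of $T$ steps makes at most $$C\,\frac{d}{\epsilon^3}\Big(1+\log\frac d\epsilon\Big)^k=\tilde O\Big(\frac d{\epsilon^3}\Big)$$ queries. Here a query program is a finite sequence of quantum circuits, chosen adaptively from earlier measurement outcomes; a circuit acts on $L^2(\nu)$ tensored with a finite-dimensional workspace, starts from a fixed state, applies alternately a workspace-controlled query (one use of $U$, of $U^{-1}$ or of the identity, as selected by the workspace basis state) and a unitary independent of $U$, and ends with a measurement of the workspace. $T$ and the programs do not depend on $\mu$ or $U$. *Classical.* There are numbers $T,n$ and a measurable estimator, a function of $w$ and of $n$ independent samples of $r$, with $\mathbb E\|\tilde g-g(w)\|_2\le\epsilon$ for all $w\in\mathcal W$ and all regular $\mu$, such that for every regular $\mu$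 projected stochastic subgradient descent with a fresh batch of $n$ samples in each step satisfies $\min_{t\le T}\mathbb E[\mathrm{CVaR}_\alpha(w_t)-\mathrm{CVaR}_\alpha(w^\star)]\le\epsilon$, with $$Tn\le C\,\frac{d}{\epsilon^4}\Big(1+\log\frac d\epsilon\Big)^k=\tilde O\Big(\frac d{\epsilon^4}\Big).$$ -/

import Mathlib

open MeasureTheory ProbabilityTheory

universe u

/-! ### Loss, Value-at-Risk and Conditional Value-at-Risk -/

/-- The loss `-wᵀ r` of the portfolio `w` when the return vector is `r`. -/
noncomputable def loss {d : ℕ} (w r : EuclideanSpace ℝ (Fin d)) : ℝ :=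
  -(inner ℝ w r)

/-- The Value-at-Risk: the `α`-quantile of the loss when the returns have law `μ`. -/
noncomputable def VaR {d : ℕ} (α : ℝ) (μ : Measure (EuclideanSpace ℝ (Fin d)))
    (w : EuclideanSpace ℝ (Fin d)) : ℝ :=
  sInf {z : ℝ | α ≤ μ.real {r | loss w r ≤ z}}

/-- The law of the returns conditioned on the tail event `{L(w) ≥ VaR_α(w)}`. -/
noncomputable def tailLaw {d : ℕ} (α : ℝ) (μ : Measure (EuclideanSpace ℝ (Fin d)))
    (w : EuclideanSpace ℝ (Fin d)) : Measure (EuclideanSpace ℝ (Fin d)) :=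
  ProbabilityTheory.cond μ {r | VaR α μ w ≤ loss w r}

/-- `CVaR_α(w) = E[L(w) | L(w) ≥ VaR_α(w)]`. -/
noncomputable def CVaR {d : ℕ} (α : ℝ) (μ : Measure (EuclideanSpace ℝ (Fin d)))
    (w : EuclideanSpace ℝ (Fin d)) : ℝ :=
  ∫ r, loss w r ∂(tailLaw α μ w)

/-- The Rockafellar-Uryasev subgradient
`g(w) = E[∇_w L(w) | L(w) ≥ VaR_α(w)]`, where `∇_w L(w) = -r`. -/
noncomputable def cvarGrad {d : ℕ} (α : ℝ) (μ : Measure (EuclideanSpace ℝ (Fin d)))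
    (w : EuclideanSpace ℝ (Fin d)) : EuclideanSpace ℝ (Fin d) :=
  ∫ r, -r ∂(tailLaw α μ w)

/-- Regularity of the return law: the gradient norm `‖∇_w L(w)‖ = ‖r‖` is almost surely at most
`G`, and for every feasible `w` the loss has a density that is bounded by `M`. -/
structure RegularReturns {d : ℕ} (μ : Measure (EuclideanSpace ℝ (Fin d)))
    (W : Set (EuclideanSpace ℝ (Fin d))) (G M : ℝ) : Prop where
  norm_le : ∀ᵐ r ∂μ, ‖r‖ ≤ G
  hasPDF : ∀ w ∈ W, HasPDF (loss w) μ volume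
  pdf_le : ∀ w ∈ W, ∀ᵐ x ∂(volume : Measure ℝ), pdf (loss w) μ volume x ≤ ENNReal.ofReal M

/-! ### Projected subgradient descent -/

/-- A feasible set: nonempty, closed, convex, contained in the ball of radius `R`. -/
structure IsFeasibleSet {d : ℕ} (W : Set (EuclideanSpace ℝ (Fin d))) (R : ℝ) : Prop where
  nonempty : W.Nonempty
  isClosed : IsClosed W
  convex : Convex ℝ W
  norm_le : ∀ w ∈ W, ‖w‖ ≤ R

open Classical in
/-- Euclidean projection: the point of `W` nearest to `x` (it exists and is unique when `W` is
nonempty, closed and convex; the value `x` is used when there is no nearest point). -/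
noncomputable def proj {d : ℕ} (W : Set (EuclideanSpace ℝ (Fin d)))
    (x : EuclideanSpace ℝ (Fin d)) : EuclideanSpace ℝ (Fin d) :=
  if h : ∃ p ∈ W, ∀ v ∈ W, ‖x - p‖ ≤ ‖x - v‖ then h.choose else x

/-- One step of projected subgradient descent, from `w` along `g`, with step size `s`. -/
noncomputable def sgdStep {d : ℕ} (W : Set (EuclideanSpace ℝ (Fin d))) (s : ℝ)
    (w g : EuclideanSpace ℝ (Fin d)) : EuclideanSpace ℝ (Fin d) :=
  proj W (w - s • g)

/-- `η_t = Θ(1/√t)` with explicit constants; steps are numbered from `0`, so that the step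
number `t` is the `(t+1)`-st one. -/
def StepSize (c₁ c₂ : ℝ) (η : ℕ → ℝ) : Prop :=
  ∀ t : ℕ, c₁ / √((t : ℝ) + 1) ≤ η t ∧ η t ≤ c₂ / √((t : ℝ) + 1)

/-! ### Quantum query algorithms

The scenario register is the Hilbert space `K` and the workspace is spanned by a finite basis `S`,
so that the joint state space is `K ⊗ ℂ^S`, written as the `ℓ²` sum of `S` copies of `K`. -/

/-- The joint state space `K ⊗ ℂ^S`. -/
abbrev QState (K : Type) [NormedAddCommGroup K] [InnerProductSpace ℂ K] (S : Type) : Type :=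
  PiLp 2 (fun _ : S => K)

/-- What a controlled query does on a given basis state of the workspace: nothing, the oracle, or
the inverse of the oracle. -/
inductive QMode : Type
  | idle
  | forward
  | inverse

/-- The unitary on `K` selected by a control value. -/
def QMode.apply {K : Type} [NormedAddCommGroup K] [InnerProductSpace ℂ K] (U : K ≃ₗᵢ[ℂ] K) :
    QMode → (K ≃ₗᵢ[ℂ] K)
  | idle => LinearIsometryEquiv.refl ℂ K
  | forward => U
  | inverse => U.symm

/-- A single (controlled) query to the oracle `U`, as a unitary on `K ⊗ ℂ^S`. -/
noncomputable def queryGate {K : Type} [NormedAddCommGroup K] [InnerProductSpace ℂ K]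
    {S : Type} [Fintype S] (U : K ≃ₗᵢ[ℂ] K) (m : S → QMode) :
    QState K S ≃ₗᵢ[ℂ] QState K S :=
  LinearIsometryEquiv.piLpCongrRight 2 (fun s => (m s).apply U)

/-- A quantum query circuit: a fixed initial state and a list of steps; each step is one
controlled query followed by a unitary that does not depend on the oracle. At the end the
workspace is measured in its basis `S`. -/
structure QCircuit (K : Type) [NormedAddCommGroup K] [InnerProductSpace ℂ K]
    (S : Type) [Fintype S] : Type where
  init : QState K S
  norm_init : ‖init‖ = 1
  steps : List ((S → QMode) × (QState K S ≃ₗᵢ[ℂ] QState K S))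

/-- The final state of the circuit when the oracle is `U`. -/
noncomputable def QCircuit.final {K : Type} [NormedAddCommGroup K] [InnerProductSpace ℂ K]
    {S : Type} [Fintype S] (c : QCircuit K S) (U : K ≃ₗᵢ[ℂ] K) : QState K S :=
  c.steps.foldl (fun ψ st => st.2 (queryGate U st.1 ψ)) c.init

/-- The probability of the measurement outcome `s` (Born rule). -/
noncomputable def QCircuit.prob {K : Type} [NormedAddCommGroup K] [InnerProductSpace ℂ K]
    {S : Type} [Fintype S] (c : QCircuit K S) (U : K ≃ₗᵢ[ℂ] K) (s : S) : ℝ :=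
  ‖c.final U s‖ ^ 2

/-- A quantum query program with output in `γ`: it either stops with an output, or runs a circuit
with fresh registers, measures, and continues depending on the outcome. -/
inductive QProg (K : Type) [NormedAddCommGroup K] [InnerProductSpace ℂ K] (γ : Type) : Type 1
  | ret (a : γ) : QProg K γ
  | meas (S : Type) (inst : Fintype S) (c : QCircuit K S) (next : S → QProg K γ) : QProg K γ

/-- The expectation of `φ` (output) when the program runs with oracle `U`. -/
noncomputable def QProg.expect {K : Type} [NormedAddCommGroup K] [InnerProductSpace ℂ K]
    {γ : Type} (U : K ≃ₗᵢ[ℂ] K) (φ : γ → ℝ) : QProg K γ → ℝ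
  | ret a => φ a
  | meas S _ c next => ∑ s : S, c.prob U s * (next s).expect U φ

/-- The number of oracle queries on the worst branch of the program. -/
def QProg.queries {K : Type} [NormedAddCommGroup K] [InnerProductSpace ℂ K]
    {γ : Type} : QProg K γ → ℕ
  | ret _ => 0
  | meas S _ c next => c.steps.length + (Finset.univ : Finset S).sup (fun s => (next s).queries)

/-- Sequential composition of programs. -/
def QProg.bind {K : Type} [NormedAddCommGroup K] [InnerProductSpace ℂ K]
    {γ δ : Type} (p : QProg K γ) (k : γ → QProg K δ) : QProg K δ :=
  match p with
  | ret a => k a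
  | meas S i c next => meas S i c (fun s => (next s).bind k)

/-- The scenario register for returns in `ℝ^d`: square integrable wave functions with respect to a
reference measure `ν` (counting measure on a grid gives the span of the basis states `|r⟩` of the
grid, Lebesgue measure gives wave functions in the usual sense). -/
abbrev Register {d : ℕ} (ν : Measure (EuclideanSpace ℝ (Fin d))) : Type := Lp ℂ 2 ν

/-- `U` prepares the law `μ` from the reference state `e₀`: `U |e₀⟩` has the amplitudes `√p`, where
`p = dμ/dν`. -/
def Prepares {d : ℕ} {ν : Measure (EuclideanSpace ℝ (Fin d))}
    (U : Register ν ≃ₗᵢ[ℂ] Register ν) (e₀ : Register ν)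
    (μ : Measure (EuclideanSpace ℝ (Fin d))) : Prop :=
  μ ≪ ν ∧ ∀ᵐ r ∂ν, (U e₀ : EuclideanSpace ℝ (Fin d) → ℂ) r = (√((μ.rnDeriv ν r).toReal) : ℝ)

/-- Projected stochastic subgradient descent in which the subgradient at the current point `w` is
produced by the quantum program `oracle w`: the program that outputs the iterate number `t`. -/
noncomputable def quantumSGD {d : ℕ} {K : Type} [NormedAddCommGroup K] [InnerProductSpace ℂ K]
    (W : Set (EuclideanSpace ℝ (Fin d))) (η : ℕ → ℝ) (w₀ : EuclideanSpace ℝ (Fin d))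
    (oracle : EuclideanSpace ℝ (Fin d) → QProg K (EuclideanSpace ℝ (Fin d))) :
    ℕ → QProg K (EuclideanSpace ℝ (Fin d))
  | 0 => QProg.ret w₀
  | t + 1 => (quantumSGD W η w₀ oracle t).bind fun w =>
      (oracle w).bind fun g => QProg.ret (sgdStep W (η t) w g)

/-! ### Classical Monte Carlo -/

/-- Projected stochastic subgradient descent in which the subgradient at the current point `w` is
`est w` applied to a fresh batch of `n` sampled returns; `x t` is the batch of step `t`. -/
noncomputable def classicalSGD {d n : ℕ}
    (W : Set (EuclideanSpace ℝ (Fin d))) (η : ℕ → ℝ) (w₀ : EuclideanSpace ℝ (Fin d))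
    (est : EuclideanSpace ℝ (Fin d) → (Fin n → EuclideanSpace ℝ (Fin d)) →
      EuclideanSpace ℝ (Fin d))
    (x : ℕ → Fin n → EuclideanSpace ℝ (Fin d)) : ℕ → EuclideanSpace ℝ (Fin d)
  | 0 => w₀
  | t + 1 => sgdStep W (η t) (classicalSGD W η w₀ est x t)
      (est (classicalSGD W η w₀ est x t) (x t))

/-- The law of infinitely many independent batches of `n` independent returns with law `μ`. -/
noncomputable def sampleLaw {d : ℕ} (n : ℕ) (μ : Measure (EuclideanSpace ℝ (Fin d)))
    [IsProbabilityMeasure μ] : Measure (ℕ → Fin n → EuclideanSpace ℝ (Fin d)) :=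
  Measure.infinitePi fun _ : ℕ => Measure.pi fun _ : Fin n => μ

/-!
The convergence rate comes from the expected squared distance to the minimizer. Convexity of `CVaR`
is not assumed: `cvar_sub_le` gives the subgradient inequality directly, since among all events of
probability `1 - α` the tail event has the largest integral of the loss. The comparison of an
inexact step with the exact step from the same point (`norm_sgdStep_sub_sq_le`) has an error that is
linear in the oracle error and truncated at the diameter of the feasible set, so that both notions
of accuracy suffice and no second moment is needed. Summing over the second half of the run only
(`exists_gap_le`) gives the rate without a factor `log T`. For accuracy `ε` it is therefore enough
to run of the order of `ε⁻²` steps with an oracle of accuracy of the order of `ε`.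

Classically, the oracle averages the returns with the largest empirical losses. The index set of
these samples and that of the samples in the true tail event are nested, so they differ only by the
fluctuation of the size of the latter. Two variance bounds give the error `3 G / ((1 - α) √n)`,
whatever the dimension; `ε⁻²` samples per step suffice.

On a quantum computer, multiplication by a phase with real part `f`, conjugated by `U`, has an
overlap with `e₀` whose real part is the mean of `f`. A walk that alternates it, made an involution
on a larger workspace, with a reflection has outcome probabilities `cos (k θ) ^ 2`, where `cos θ` is
that mean (`prob_walkCircuit`). Testing signs of cosines at increasing multiples narrows an interval
for `θ` geometrically (`angleSearch`). With about `1 / δ` queries up to logarithmic factors this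
estimates a mean `p` of a function with values in `[0, 1]` with error `δ √p`
(`failure_meanEstimate_le`).

A quantile of the loss is found by bisection with estimated tail probabilities; a bounded density
makes logarithmically many rounds sufficient, and it is the tail probability, not the quantile,
that has to be accurate. The mean of `-r` over the tail event is estimated coordinate by coordinate,
at dyadic scales. As the error at every scale is proportional to the square root of the mean there,
the error of a coordinate is proportional to its root mean square
(`abs_dyadicSum_sub_integral_le`); these add up to at most `G` in the Euclidean norm, so that
accuracy `δ` of the order of `ε` in each of the `d` coordinates is enough. The oracle costs `d / ε`
queries and the whole run `d / ε ^ 3`, up to logarithms.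
-/

/-! ### Projected subgradient descent with an inexact oracle -/

section Projection

variable {d : ℕ} {W : Set (EuclideanSpace ℝ (Fin d))} {R : ℝ}

theorem proj_spec (hW : IsFeasibleSet W R) (x : EuclideanSpace ℝ (Fin d)) :
    proj W x ∈ W ∧ ∀ v ∈ W, ‖x - proj W x‖ ≤ ‖x - v‖ := by
  have h : ∃ p ∈ W, ∀ v ∈ W, ‖x - p‖ ≤ ‖x - v‖ := by
    obtain ⟨p, hp, hd⟩ := hW.isClosed.exists_infDist_eq_dist hW.nonempty x
    refine ⟨p, hp, fun v hv => ?_⟩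
    rw [← dist_eq_norm, ← dist_eq_norm, ← hd]
    exact Metric.infDist_le_dist_of_mem hv
  rw [proj, dif_pos h]
  exact h.choose_spec

theorem proj_mem (hW : IsFeasibleSet W R) (x : EuclideanSpace ℝ (Fin d)) : proj W x ∈ W :=
  (proj_spec hW x).1

theorem inner_sub_proj_le_zero (hW : IsFeasibleSet W R) (x : EuclideanSpace ℝ (Fin d))
    {v : EuclideanSpace ℝ (Fin d)} (hv : v ∈ W) :
    inner ℝ (x - proj W x) (v - proj W x) ≤ 0 := by
  obtain ⟨hp, hmin⟩ := proj_spec hW x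
  refine (norm_eq_iInf_iff_real_inner_le_zero hW.convex hp).1 ?_ v hv
  have : Nonempty W := ⟨⟨_, hp⟩⟩
  refine le_antisymm (le_ciInf fun w => hmin w w.2) ?_
  exact ciInf_le (f := fun w : W => ‖x - w‖) ⟨0, by rintro _ ⟨w, rfl⟩; exact norm_nonneg _⟩ ⟨_, hp⟩

theorem norm_proj_sub_proj_le (hW : IsFeasibleSet W R) (x y : EuclideanSpace ℝ (Fin d)) :
    ‖proj W x - proj W y‖ ≤ ‖x - y‖ := by
  have h1 := inner_sub_proj_le_zero hW x (proj_mem hW y)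
  have h2 := inner_sub_proj_le_zero hW y (proj_mem hW x)
  have h3 : ‖proj W x - proj W y‖ ^ 2 ≤ inner ℝ (x - y) (proj W x - proj W y) := by
    have e : inner ℝ (x - proj W x) (proj W y - proj W x)
        + inner ℝ (y - proj W y) (proj W x - proj W y)
        = ‖proj W x - proj W y‖ ^ 2 - inner ℝ (x - y) (proj W x - proj W y) := by
      rw [← real_inner_self_eq_norm_sq]
      simp only [inner_sub_left, inner_sub_right, real_inner_comm]
      ring
    linarith
  have h4 := real_inner_le_norm (x - y) (proj W x - proj W y)
  by_contra! h
  nlinarith [norm_nonneg (x - y)]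

theorem proj_of_mem (hW : IsFeasibleSet W R) {x : EuclideanSpace ℝ (Fin d)} (hx : x ∈ W) :
    proj W x = x := by
  have := (proj_spec hW x).2 x hx
  rw [sub_self, norm_zero, norm_le_zero_iff, sub_eq_zero] at this
  exact this.symm

theorem continuous_proj (hW : IsFeasibleSet W R) : Continuous (proj W) := by
  refine (LipschitzWith.of_dist_le_mul (K := 1) fun x y => ?_).continuous
  simpa [dist_eq_norm] using norm_proj_sub_proj_le hW x y

theorem sgdStep_mem (hW : IsFeasibleSet W R) (s : ℝ) (w g : EuclideanSpace ℝ (Fin d)) :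
    sgdStep W s w g ∈ W := proj_mem hW _

theorem norm_sub_le_of_mem (hW : IsFeasibleSet W R) {v w : EuclideanSpace ℝ (Fin d)}
    (hv : v ∈ W) (hw : w ∈ W) : ‖v - w‖ ≤ 2 * R := by
  have := norm_sub_le v w
  linarith [hW.norm_le v hv, hW.norm_le w hw]

/-- One step with an arbitrary direction `gt` in place of `g`. The error enters linearly and
truncated at the diameter: the new iterate is compared with the exact step from the same point,
and both lie in `W`. In particular no second moment of `gt` is needed. -/
theorem norm_sgdStep_sub_sq_le (hW : IsFeasibleSet W R) {w v g gt : EuclideanSpace ℝ (Fin d)}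
    (hw : w ∈ W) (hv : v ∈ W) {G s : ℝ} (hg : ‖g‖ ≤ G) (hs : 0 ≤ s) :
    ‖sgdStep W s w gt - v‖ ^ 2 ≤ ‖w - v‖ ^ 2 - 2 * s * inner ℝ g (w - v) + s ^ 2 * G ^ 2
      + 4 * R * min (s * ‖gt - g‖) (2 * R) := by
  set a := sgdStep W s w gt
  set b := sgdStep W s w g
  have ha : a ∈ W := sgdStep_mem hW _ _ _
  have hb : b ∈ W := sgdStep_mem hW _ _ _
  have hab : ‖a - b‖ ≤ min (s * ‖gt - g‖) (2 * R) := by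
    refine le_min ?_ (norm_sub_le_of_mem hW ha hb)
    have : (w - s • gt) - (w - s • g) = -(s • (gt - g)) := by module
    refine (norm_proj_sub_proj_le hW _ _).trans_eq ?_
    rw [this, norm_neg, norm_smul, Real.norm_of_nonneg hs]
  have hbv : ‖b - v‖ ^ 2 ≤ ‖w - v‖ ^ 2 - 2 * s * inner ℝ g (w - v) + s ^ 2 * G ^ 2 := by
    have h1 : ‖b - v‖ ≤ ‖(w - v) - s • g‖ := by
      have := norm_proj_sub_proj_le hW (w - s • g) v
      rw [proj_of_mem hW hv] at this
      rwa [show (w - v) - s • g = w - s • g - v by abel]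
    have h2 : ‖(w - v) - s • g‖ ^ 2
        = ‖w - v‖ ^ 2 - 2 * s * inner ℝ g (w - v) + s ^ 2 * ‖g‖ ^ 2 := by
      rw [norm_sub_sq_real, inner_smul_right, real_inner_comm, norm_smul, Real.norm_of_nonneg hs]
      ring
    have h3 : ‖g‖ ^ 2 ≤ G ^ 2 := by gcongr
    nlinarith [norm_nonneg (b - v), norm_nonneg (w - v - s • g), sq_nonneg s,
      pow_le_pow_left₀ (norm_nonneg (b - v)) h1 2, mul_le_mul_of_nonneg_left h3 (sq_nonneg s)]
  have hav : ‖a - v‖ ≤ ‖b - v‖ + ‖a - b‖ := by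
    have := norm_add_le (b - v) (a - b)
    rwa [show b - v + (a - b) = a - v by abel] at this
  have h1 := norm_sub_le_of_mem hW ha hv
  have h2 := norm_sub_le_of_mem hW hb hv
  have h3 : ‖a - v‖ ^ 2 ≤ ‖b - v‖ ^ 2 + ‖a - b‖ * (4 * R) := by
    nlinarith [norm_nonneg (a - b), norm_nonneg (b - v), norm_nonneg (a - v)]
  have hR : 0 ≤ R := (norm_nonneg _).trans (hW.norm_le w hw)
  nlinarith

end Projection

section Rate

variable {c₁ c₂ : ℝ} {η : ℕ → ℝ}

theorem StepSize.pos (hη : StepSize c₁ c₂ η) (hc : 0 < c₁) (t : ℕ) : 0 < η t :=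
  lt_of_lt_of_le (by positivity) (hη t).1

/-- The constant of the convergence rate. -/
noncomputable def sgdConst (G R c₁ c₂ : ℝ) : ℝ := (12 * R ^ 2 + G ^ 2 * c₂ ^ 2) / c₁ + 2 * R + 1

theorem one_le_sgdConst {G R c₁ c₂ : ℝ} (hR : 0 < R) (hc₁ : 0 < c₁) : 1 ≤ sgdConst G R c₁ c₂ := by
  have : 0 ≤ (12 * R ^ 2 + G ^ 2 * c₂ ^ 2) / c₁ := by positivity
  unfold sgdConst
  linarith

/-- The convergence rate, for a potential `D` and suboptimality gaps `Δ`. Only the steps of the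
second half of the run are summed: their step sizes are comparable, which avoids the factor
`log T` that the sum over all steps would give. -/
theorem exists_gap_le {G R : ℝ} (hR : 0 < R) (hc₁ : 0 < c₁)
    (hη : StepSize c₁ c₂ η) {T : ℕ} (hT : 0 < T) {ε : ℝ} (hε : 0 ≤ ε) {D Δ N : ℕ → ℝ}
    (hD0 : ∀ t, 0 ≤ D t) (hD : ∀ t, D t ≤ 4 * R ^ 2)
    (hstep : ∀ t < T, D (t + 1) ≤ D t - 2 * η t * Δ t + η t ^ 2 * G ^ 2 + 4 * R * N t)
    (hN : ∀ t < T, N t ≤ η t * ε + 2 * R / T) :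
    ∃ t < T, Δ t ≤ sgdConst G R c₁ c₂ * (1 / √(T : ℝ) + ε) := by
  by_contra! hcon
  set X := sgdConst G R c₁ c₂ * (1 / √(T : ℝ) + ε) with hX
  have hT' : (0 : ℝ) < T := by exact_mod_cast hT
  have hsT : 0 < √(T : ℝ) := Real.sqrt_pos.2 hT'
  set m := T / 2 with hm
  have hmT : m ≤ T := Nat.div_le_self _ _
  have htel : ∑ t ∈ Finset.Ico m T, (D (t + 1) - D t) = D T - D m :=
    Finset.sum_Ico_sub D hmT
  have hsum : ∑ t ∈ Finset.Ico m T, (D (t + 1) - D t) ≤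
      ∑ t ∈ Finset.Ico m T, (-2 * X * η t + G ^ 2 * η t ^ 2 + 4 * R * ε * η t
        + 8 * R ^ 2 / T) := by
    refine Finset.sum_le_sum fun t ht => ?_
    have htT := (Finset.mem_Ico.1 ht).2
    have h1 := hstep t htT
    have h2 := mul_le_mul_of_nonneg_left (hN t htT) (by positivity : 0 ≤ 4 * R)
    have h3 := mul_le_mul_of_nonneg_left (hcon t htT).le (hη.pos hc₁ t).le
    have h4 : 4 * R * (η t * ε + 2 * R / T) = 4 * R * ε * η t + 8 * R ^ 2 / T := by ring
    nlinarith
  set S := ∑ t ∈ Finset.Ico m T, η t with hS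
  rw [htel, Finset.sum_add_distrib, Finset.sum_add_distrib, Finset.sum_add_distrib,
    ← Finset.mul_sum, ← Finset.mul_sum, ← Finset.mul_sum, ← hS, Finset.sum_const, Nat.card_Ico,
    nsmul_eq_mul] at hsum
  have hcard : ((T - m : ℕ) : ℝ) ≤ T := by exact_mod_cast Nat.sub_le _ _
  have hcard2 : (T : ℝ) / 2 ≤ ((T - m : ℕ) : ℝ) := by
    have : T ≤ 2 * (T - m) := by omega
    have : (T : ℝ) ≤ 2 * ((T - m : ℕ) : ℝ) := by exact_mod_cast this
    linarith
  have hcard3 : ((T - m : ℕ) : ℝ) ≤ (m : ℝ) + 1 := by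
    have : T - m ≤ m + 1 := by omega
    exact_mod_cast this
  have hlast : ((T - m : ℕ) : ℝ) * (8 * R ^ 2 / T) ≤ 8 * R ^ 2 := by
    calc ((T - m : ℕ) : ℝ) * (8 * R ^ 2 / T) ≤ T * (8 * R ^ 2 / T) := by gcongr
      _ = 8 * R ^ 2 := by field_simp
  have hsq : ∑ t ∈ Finset.Ico m T, η t ^ 2 ≤ c₂ ^ 2 := by
    have hle : ∀ t ∈ Finset.Ico m T, η t ^ 2 ≤ c₂ ^ 2 / ((m : ℝ) + 1) := by
      intro t ht
      have hmt : (m : ℝ) ≤ t := by exact_mod_cast (Finset.mem_Ico.1 ht).1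
      have h1 : η t ^ 2 ≤ (c₂ / √((t : ℝ) + 1)) ^ 2 :=
        pow_le_pow_left₀ (hη.pos hc₁ t).le (hη t).2 2
      rw [div_pow, Real.sq_sqrt (by positivity)] at h1
      exact h1.trans (by gcongr)
    refine (Finset.sum_le_card_nsmul _ _ _ hle).trans ?_
    rw [Nat.card_Ico, nsmul_eq_mul]
    calc ((T - m : ℕ) : ℝ) * (c₂ ^ 2 / ((m : ℝ) + 1))
        ≤ ((m : ℝ) + 1) * (c₂ ^ 2 / ((m : ℝ) + 1)) := by gcongr
      _ = c₂ ^ 2 := by field_simp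
  have hSlow : c₁ * √(T : ℝ) / 2 ≤ S := by
    have hle : ∀ t ∈ Finset.Ico m T, c₁ / √(T : ℝ) ≤ η t := by
      intro t ht
      refine le_trans ?_ (hη t).1
      have : (t : ℝ) + 1 ≤ T := by exact_mod_cast (Finset.mem_Ico.1 ht).2
      gcongr
    have := Finset.card_nsmul_le_sum _ _ _ hle
    rw [Nat.card_Ico, nsmul_eq_mul] at this
    refine le_trans ?_ this
    calc c₁ * √(T : ℝ) / 2 = (T : ℝ) / 2 * (c₁ / √(T : ℝ)) := by
          field_simp
          rw [Real.sq_sqrt hT'.le]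
      _ ≤ _ := by gcongr
  have hfin : 2 * X * S ≤ 12 * R ^ 2 + G ^ 2 * c₂ ^ 2 + 4 * R * ε * S := by
    have := hD0 T
    have := hD m
    have := mul_le_mul_of_nonneg_left hsq (sq_nonneg G)
    nlinarith
  have hXlow : (12 * R ^ 2 + G ^ 2 * c₂ ^ 2) / (c₁ * √(T : ℝ)) + 2 * R * ε < X := by
    have e : X = (12 * R ^ 2 + G ^ 2 * c₂ ^ 2) / (c₁ * √(T : ℝ)) + 2 * R * ε
        + ((2 * R + 1) * (1 / √(T : ℝ)) + ((12 * R ^ 2 + G ^ 2 * c₂ ^ 2) / c₁ + 1) * ε) := by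
      rw [hX, sgdConst]
      field_simp
      ring
    rw [e]
    have : 0 < (2 * R + 1) * (1 / √(T : ℝ)) := by positivity
    have : 0 ≤ ((12 * R ^ 2 + G ^ 2 * c₂ ^ 2) / c₁ + 1) * ε := by positivity
    linarith
  have hSpos : 0 < S := lt_of_lt_of_le (by positivity) hSlow
  have h1 : (12 * R ^ 2 + G ^ 2 * c₂ ^ 2) ≤
      (12 * R ^ 2 + G ^ 2 * c₂ ^ 2) / (c₁ * √(T : ℝ)) * (2 * S) := by
    calc (12 * R ^ 2 + G ^ 2 * c₂ ^ 2)
        = (12 * R ^ 2 + G ^ 2 * c₂ ^ 2) / (c₁ * √(T : ℝ)) * (c₁ * √(T : ℝ)) := by field_simp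
      _ ≤ _ := mul_le_mul_of_nonneg_left (by linarith) (by positivity)
  nlinarith [mul_lt_mul_of_pos_right hXlow (by positivity : 0 < 2 * S)]

end Rate

/-! ### Value-at-Risk, Conditional Value-at-Risk and its subgradient -/

section CVaR

variable {d : ℕ}

theorem continuous_loss : Continuous fun p : EuclideanSpace ℝ (Fin d) × EuclideanSpace ℝ (Fin d) =>
    loss p.1 p.2 := by
  unfold loss
  fun_prop

theorem measurable_loss (w : EuclideanSpace ℝ (Fin d)) : Measurable (loss w) :=
  (continuous_loss.comp (by fun_prop : Continuous fun r => (w, r))).measurable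

theorem loss_eq_inner_neg (w r : EuclideanSpace ℝ (Fin d)) : loss w r = inner ℝ (-r) w := by
  rw [loss, inner_neg_left, real_inner_comm]

theorem abs_loss_le {w r : EuclideanSpace ℝ (Fin d)} {G : ℝ} (hr : ‖r‖ ≤ G) :
    |loss w r| ≤ ‖w‖ * G := by
  rw [loss, abs_neg]
  exact (abs_real_inner_le_norm _ _).trans (by gcongr)

/-- The tail event `{L(w) ≥ z}`. -/
def tailEvent (w : EuclideanSpace ℝ (Fin d)) (z : ℝ) : Set (EuclideanSpace ℝ (Fin d)) :=
  {r | z ≤ loss w r}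

theorem measurableSet_tailEvent (w : EuclideanSpace ℝ (Fin d)) (z : ℝ) :
    MeasurableSet (tailEvent w z) :=
  measurableSet_le measurable_const (measurable_loss w)

variable (μ : Measure (EuclideanSpace ℝ (Fin d))) [IsProbabilityMeasure μ] {α : ℝ}

theorem cdf_map_loss (w : EuclideanSpace ℝ (Fin d)) (z : ℝ) :
    cdf (μ.map (loss w)) z = μ.real {r | loss w r ≤ z} := by
  have := Measure.isProbabilityMeasure_map (μ := μ) (measurable_loss w).aemeasurable
  rw [cdf_eq_real, map_measureReal_apply (measurable_loss w) measurableSet_Iic]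
  rfl

theorem VaR_le_iff (hα : 0 < α) (hα1 : α < 1) (w : EuclideanSpace ℝ (Fin d)) (z : ℝ) :
    VaR α μ w ≤ z ↔ α ≤ μ.real {r | loss w r ≤ z} := by
  have hset : {z : ℝ | α ≤ μ.real {r | loss w r ≤ z}} = {z | α ≤ cdf (μ.map (loss w)) z} := by
    simp_rw [cdf_map_loss]
  rw [VaR, hset, ← cdf_map_loss]
  set F := cdf (μ.map (loss w))
  have hne : {z | α ≤ F z}.Nonempty :=
    (((tendsto_cdf_atTop (μ.map (loss w))).eventually_const_lt hα1).exists).imp fun _ h => h.le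
  have hbdd : BddBelow {z | α ≤ F z} := by
    obtain ⟨b, hb⟩ := ((tendsto_cdf_atBot (μ.map (loss w))).eventually_lt_const hα).exists
    refine ⟨b, fun z hz => ?_⟩
    by_contra! h
    exact absurd (hz.trans (F.mono h.le)) (not_le.2 hb)
  refine ⟨fun h => ?_, fun h => csInf_le hbdd h⟩
  have hgt : ∀ y, z < y → α ≤ F y := fun y hy => by
    obtain ⟨x, hx, hxy⟩ := exists_lt_of_csInf_lt hne (h.trans_lt hy)
    exact le_trans hx (F.mono hxy.le)
  have hlim : Filter.Tendsto F (nhdsWithin z (Set.Ioi z)) (nhds (F z)) :=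
    (F.right_continuous z).tendsto.mono_left (nhdsWithin_mono _ Set.Ioi_subset_Ici_self)
  exact ge_of_tendsto hlim (Filter.eventually_of_mem self_mem_nhdsWithin hgt)

/-- Without an atom at the quantile, the tail event has probability exactly `1 - α`. -/
theorem measureReal_tailEvent_VaR (hα : 0 < α) (hα1 : α < 1) {w : EuclideanSpace ℝ (Fin d)}
    (hatom : ∀ z : ℝ, μ {r | loss w r = z} = 0) :
    μ.real (tailEvent w (VaR α μ w)) = 1 - α := by
  have hcompl : tailEvent w (VaR α μ w) = {r | loss w r < VaR α μ w}ᶜ := by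
    ext r; simp [tailEvent]
  have hms : MeasurableSet {r | loss w r < VaR α μ w} :=
    measurableSet_lt (measurable_loss w) measurable_const
  rw [hcompl, probReal_compl_eq_one_sub hms]
  congr 1
  refine le_antisymm ?_ ?_
  · have hU : {r | loss w r < VaR α μ w} =
        ⋃ n : ℕ, {r | loss w r ≤ VaR α μ w - 1 / ((n : ℝ) + 1)} := by
      ext r
      simp only [Set.mem_ofPred_eq, Set.mem_iUnion]
      refine ⟨fun h => ?_, fun ⟨n, hn⟩ => ?_⟩
      · obtain ⟨n, hn⟩ := exists_nat_one_div_lt (sub_pos.2 h)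
        exact ⟨n, by linarith⟩
      · have : 0 < 1 / ((n : ℝ) + 1) := by positivity
        linarith
    have hmono : Monotone fun n : ℕ => {r | loss w r ≤ VaR α μ w - 1 / ((n : ℝ) + 1)} := by
      intro a b hab r hr
      simp only [Set.mem_ofPred_eq] at hr ⊢
      have : 1 / ((b : ℝ) + 1) ≤ 1 / ((a : ℝ) + 1) := Nat.one_div_le_one_div hab
      linarith
    rw [hU]
    have hlim := tendsto_measure_iUnion_atTop (μ := μ) hmono
    have hlim' := (ENNReal.tendsto_toReal (measure_ne_top μ _)).comp hlim
    refine le_of_tendsto hlim' (Filter.Eventually.of_forall fun n => ?_)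
    by_contra! h
    have := (VaR_le_iff μ hα hα1 w _).2 h.le
    have : 0 < 1 / ((n : ℝ) + 1) := by positivity
    linarith
  · have h1 := (VaR_le_iff μ hα hα1 w _).1 le_rfl
    refine h1.trans ?_
    have : {r | loss w r ≤ VaR α μ w} ⊆
        {r | loss w r < VaR α μ w} ∪ {r | loss w r = VaR α μ w} := by
      intro r hr
      exact lt_or_eq_of_le (show loss w r ≤ VaR α μ w from hr)
    calc μ.real {r | loss w r ≤ VaR α μ w} ≤ _ := measureReal_mono this
      _ ≤ _ := measureReal_union_le _ _
      _ = _ := by simp [measureReal_def, hatom]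

omit [IsProbabilityMeasure μ] in
theorem integral_tailLaw {F : Type*} [NormedAddCommGroup F] [NormedSpace ℝ F]
    (w : EuclideanSpace ℝ (Fin d)) (f : EuclideanSpace ℝ (Fin d) → F) :
    ∫ r, f r ∂(tailLaw α μ w) = (μ.real (tailEvent w (VaR α μ w)))⁻¹ •
      ∫ r in tailEvent w (VaR α μ w), f r ∂μ := by
  rw [tailLaw, ProbabilityTheory.cond, integral_smul_measure, ENNReal.toReal_inv]
  rfl

variable {G : ℝ}

theorem integrable_neg_of_bound (hG : ∀ᵐ r ∂μ, ‖r‖ ≤ G) :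
    Integrable (fun r : EuclideanSpace ℝ (Fin d) => -r) μ :=
  Integrable.of_bound (by fun_prop) G (by simpa using hG)

theorem integrable_loss (hG : ∀ᵐ r ∂μ, ‖r‖ ≤ G) (w : EuclideanSpace ℝ (Fin d)) :
    Integrable (loss w) μ :=
  Integrable.of_bound (measurable_loss w).aestronglyMeasurable (‖w‖ * G)
    (hG.mono fun _ hr => abs_loss_le hr)

theorem setIntegral_loss (hG : ∀ᵐ r ∂μ, ‖r‖ ≤ G) (w : EuclideanSpace ℝ (Fin d))
    (s : Set (EuclideanSpace ℝ (Fin d))) :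
    ∫ r in s, loss w r ∂μ = inner ℝ (∫ r in s, -r ∂μ) w := by
  simp_rw [loss_eq_inner_neg, real_inner_comm]
  exact integral_inner (integrable_neg_of_bound μ hG).integrableOn w

theorem CVaR_eq_inner (hG : ∀ᵐ r ∂μ, ‖r‖ ≤ G) (w : EuclideanSpace ℝ (Fin d)) :
    CVaR α μ w = inner ℝ (cvarGrad α μ w) w := by
  rw [CVaR, cvarGrad, integral_tailLaw, integral_tailLaw, setIntegral_loss μ hG, inner_smul_left]
  simp

theorem norm_cvarGrad_le (hG0 : 0 ≤ G) (hG : ∀ᵐ r ∂μ, ‖r‖ ≤ G)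
    (w : EuclideanSpace ℝ (Fin d)) : ‖cvarGrad α μ w‖ ≤ G := by
  rw [cvarGrad, integral_tailLaw, norm_smul, norm_inv, Real.norm_of_nonneg measureReal_nonneg]
  set s := tailEvent w (VaR α μ w)
  have h : ‖∫ r in s, -r ∂μ‖ ≤ G * μ.real s := by
    refine norm_setIntegral_le_of_norm_le_const_ae (measure_lt_top μ s) ?_
    filter_upwards [ae_restrict_of_ae (s := s) hG] with r hr
    simpa using hr
  rcases (measureReal_nonneg (μ := μ) (s := s)).eq_or_lt with h0 | h0
  · rw [← h0]; simpa using hG0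
  · rw [inv_mul_le_iff₀ h0]
    linarith

theorem abs_CVaR_le (hG0 : 0 ≤ G) (hG : ∀ᵐ r ∂μ, ‖r‖ ≤ G) (w : EuclideanSpace ℝ (Fin d)) :
    |CVaR α μ w| ≤ G * ‖w‖ := by
  rw [CVaR_eq_inner μ hG]
  exact (abs_real_inner_le_norm _ _).trans (by gcongr; exact norm_cvarGrad_le μ hG0 hG w)

/-- Among all events of the same probability, the tail event of the loss has the largest
integral of the loss. -/
theorem setIntegral_loss_le_tailEvent (hG : ∀ᵐ r ∂μ, ‖r‖ ≤ G) (v : EuclideanSpace ℝ (Fin d))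
    (z : ℝ) {s : Set (EuclideanSpace ℝ (Fin d))} (hs : MeasurableSet s)
    (hsz : μ.real s = μ.real (tailEvent v z)) :
    ∫ r in s, loss v r ∂μ ≤ ∫ r in tailEvent v z, loss v r ∂μ := by
  have hint : Integrable (fun r => loss v r - z) μ :=
    (integrable_loss μ hG v).sub (integrable_const z)
  have hms := measurableSet_tailEvent v z
  have key : ∫ r in s, (loss v r - z) ∂μ ≤ ∫ r in tailEvent v z, (loss v r - z) ∂μ := by
    rw [← integral_indicator hs, ← integral_indicator hms]
    refine integral_mono (hint.indicator hs) (hint.indicator hms) fun r => ?_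
    by_cases h1 : r ∈ s <;> by_cases h2 : r ∈ tailEvent v z <;>
      simp only [h1, h2, Set.indicator_of_mem, Set.indicator_of_notMem, not_false_eq_true, le_refl]
    · have : loss v r < z := not_le.1 (show ¬ z ≤ loss v r from h2)
      linarith
    · have : z ≤ loss v r := h2
      linarith
  rw [integral_sub (integrable_loss μ hG v).integrableOn (integrable_const z).integrableOn,
    integral_sub (integrable_loss μ hG v).integrableOn (integrable_const z).integrableOn] at key
  simp only [integral_const, measureReal_restrict_apply_univ, hsz] at key
  linarith

/-- `g(w)` is a subgradient of `CVaR` at `w`. -/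
theorem cvar_sub_le (hα : 0 < α) (hα1 : α < 1) (hG : ∀ᵐ r ∂μ, ‖r‖ ≤ G)
    {v w : EuclideanSpace ℝ (Fin d)} (hv : ∀ z : ℝ, μ {r | loss v r = z} = 0)
    (hw : ∀ z : ℝ, μ {r | loss w r = z} = 0) :
    CVaR α μ w - CVaR α μ v ≤ inner ℝ (cvarGrad α μ w) (w - v) := by
  have hpv := measureReal_tailEvent_VaR μ hα hα1 hv
  have hpw := measureReal_tailEvent_VaR μ hα hα1 hw
  have h := setIntegral_loss_le_tailEvent μ hG v (VaR α μ v)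
    (measurableSet_tailEvent w (VaR α μ w)) (hpw.trans hpv.symm)
  rw [inner_sub_right, ← CVaR_eq_inner μ hG, sub_le_sub_iff_left]
  rw [CVaR, cvarGrad, integral_tailLaw, integral_tailLaw, hpv, hpw, inner_smul_left,
    ← setIntegral_loss μ hG]
  exact mul_le_mul_of_nonneg_left h (inv_nonneg.2 (by linarith))

theorem measurable_VaR (hα : 0 < α) (hα1 : α < 1) : Measurable (VaR α μ) := by
  refine measurable_of_Iic fun z => ?_
  have : VaR α μ ⁻¹' Set.Iic z = {w | α ≤ μ.real {r | loss w r ≤ z}} := by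
    ext w; exact VaR_le_iff μ hα hα1 w z
  rw [this]
  refine measurableSet_le measurable_const ?_
  have hms : MeasurableSet {p : EuclideanSpace ℝ (Fin d) × EuclideanSpace ℝ (Fin d) |
      loss p.1 p.2 ≤ z} := measurableSet_le continuous_loss.measurable measurable_const
  exact (measurable_measure_prodMk_left hms).ennreal_toReal

theorem measurable_cvarGrad (hα : 0 < α) (hα1 : α < 1) : Measurable (cvarGrad α μ) := by
  have hms : MeasurableSet {p : EuclideanSpace ℝ (Fin d) × EuclideanSpace ℝ (Fin d) |
      VaR α μ p.1 ≤ loss p.1 p.2} :=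
    measurableSet_le ((measurable_VaR μ hα hα1).comp measurable_fst) continuous_loss.measurable
  have h1 : Measurable fun w => μ.real (tailEvent w (VaR α μ w)) :=
    (measurable_measure_prodMk_left hms).ennreal_toReal
  have h2 : StronglyMeasurable fun w : EuclideanSpace ℝ (Fin d) =>
      ∫ r, ({p : EuclideanSpace ℝ (Fin d) × EuclideanSpace ℝ (Fin d) |
        VaR α μ p.1 ≤ loss p.1 p.2}.indicator (fun p => -p.2) (w, r)) ∂μ := by
    refine StronglyMeasurable.integral_prod_right ?_
    exact (StronglyMeasurable.indicator (by fun_prop) hms)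
  have h3 : cvarGrad α μ = fun w => (μ.real (tailEvent w (VaR α μ w)))⁻¹ •
      ∫ r, ({p : EuclideanSpace ℝ (Fin d) × EuclideanSpace ℝ (Fin d) |
        VaR α μ p.1 ≤ loss p.1 p.2}.indicator (fun p => -p.2) (w, r)) ∂μ := by
    funext w
    rw [cvarGrad, integral_tailLaw, ← integral_indicator (measurableSet_tailEvent _ _)]
    rfl
  rw [h3]
  exact h1.inv.smul h2.measurable

theorem measurable_CVaR (hα : 0 < α) (hα1 : α < 1) (hG : ∀ᵐ r ∂μ, ‖r‖ ≤ G) :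
    Measurable (CVaR α μ) := by
  have : CVaR α μ = fun w => inner ℝ (cvarGrad α μ w) w := funext fun w => CVaR_eq_inner μ hG w
  rw [this]
  exact (measurable_cvarGrad μ hα hα1).inner measurable_id

end CVaR

section StochasticRate

variable {d : ℕ} (μ : Measure (EuclideanSpace ℝ (Fin d))) [IsProbabilityMeasure μ] {α G R : ℝ}
  {W : Set (EuclideanSpace ℝ (Fin d))}

/-- The expected error of a step, truncated at the diameter, under either notion of accuracy. -/
theorem integral_min_le {Ω : Type*} [MeasurableSpace Ω] (P : Measure Ω) [IsProbabilityMeasure P]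
    {X : Ω → ℝ} (hX : Measurable X) (hX0 : ∀ ω, 0 ≤ X ω) (hR : 0 ≤ R) {T : ℕ} {s ε : ℝ}
    (hs : 0 ≤ s) (hε : 0 ≤ ε)
    (h : (Integrable X P ∧ ∫ ω, X ω ∂P ≤ ε) ∨ P.real {ω | ε < X ω} ≤ 1 / (T : ℝ)) :
    ∫ ω, min (s * X ω) (2 * R) ∂P ≤ s * ε + 2 * R / T := by
  have hmeas : Measurable fun ω => min (s * X ω) (2 * R) := by fun_prop
  have hmin0 : ∀ ω, 0 ≤ min (s * X ω) (2 * R) := fun ω =>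
    le_min (mul_nonneg hs (hX0 ω)) (by positivity)
  have hint : Integrable (fun ω => min (s * X ω) (2 * R)) P :=
    Integrable.of_bound hmeas.aestronglyMeasurable (2 * R) (Filter.Eventually.of_forall fun ω => by
      rw [Real.norm_of_nonneg (hmin0 ω)]; exact min_le_right _ _)
  have hRT : 0 ≤ 2 * R / T := by positivity
  rcases h with ⟨h1, h2⟩ | h
  · calc ∫ ω, min (s * X ω) (2 * R) ∂P ≤ ∫ ω, s * X ω ∂P :=
          integral_mono hint (h1.const_mul s) fun ω => min_le_left _ _
      _ = s * ∫ ω, X ω ∂P := integral_const_mul _ _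
      _ ≤ s * ε + 2 * R / T := by nlinarith
  · have hms : MeasurableSet {ω | ε < X ω} := measurableSet_lt measurable_const hX
    have hind : Integrable ({ω | ε < X ω}.indicator fun _ => 2 * R) P :=
      (integrable_const _).indicator hms
    calc ∫ ω, min (s * X ω) (2 * R) ∂P
        ≤ ∫ ω, (s * ε + {ω | ε < X ω}.indicator (fun _ => 2 * R) ω) ∂P := by
          refine integral_mono hint ((integrable_const _).add hind) fun ω => ?_
          by_cases hω : ω ∈ {ω | ε < X ω}
          · simp only [Set.indicator_of_mem hω]
            have := min_le_right (s * X ω) (2 * R)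
            have : 0 ≤ s * ε := by positivity
            linarith
          · simp only [Set.indicator_of_notMem hω, add_zero]
            exact (min_le_left _ _).trans (mul_le_mul_of_nonneg_left
              (not_lt.1 (show ¬ ε < X ω from hω)) hs)
      _ = s * ε + P.real {ω | ε < X ω} * (2 * R) := by
          rw [integral_add (integrable_const _) hind, integral_indicator hms]
          simp
      _ ≤ s * ε + 2 * R / T := by
          have := mul_le_mul_of_nonneg_right h (by positivity : 0 ≤ 2 * R)
          have e : 1 / (T : ℝ) * (2 * R) = 2 * R / T := by ring
          linarith

/-- Convergence of projected stochastic subgradient descent with an inexact oracle. -/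
theorem stochastic_sgd_rate {c₁ c₂ : ℝ} (hG : 0 < G) (hR : 0 < R) (hc₁ : 0 < c₁) (hα : 0 < α)
    (hα1 : α < 1) (hW : IsFeasibleSet W R) (hμ : ∀ᵐ r ∂μ, ‖r‖ ≤ G)
    (hatom : ∀ w ∈ W, ∀ z : ℝ, μ {r | loss w r = z} = 0)
    {wstar : EuclideanSpace ℝ (Fin d)} (hstar : wstar ∈ W) {η : ℕ → ℝ} (hη : StepSize c₁ c₂ η)
    {Ω : Type*} [MeasurableSpace Ω] (P : Measure Ω) [IsProbabilityMeasure P]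
    {w gt : ℕ → Ω → EuclideanSpace ℝ (Fin d)} {T : ℕ} {ε : ℝ} (hT : 0 < T) (hε : 0 ≤ ε)
    (hw0 : Measurable (w 0)) (hw0W : ∀ ω, w 0 ω ∈ W) (hgt : ∀ t, Measurable (gt t))
    (hstep : ∀ t ω, w (t + 1) ω = sgdStep W (η t) (w t ω) (gt t ω))
    (hacc : ∀ t < T, (Integrable (fun ω => ‖gt t ω - cvarGrad α μ (w t ω)‖) P ∧
        ∫ ω, ‖gt t ω - cvarGrad α μ (w t ω)‖ ∂P ≤ ε) ∨
      P.real {ω | ε < ‖gt t ω - cvarGrad α μ (w t ω)‖} ≤ 1 / (T : ℝ)) :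
    ∃ t < T, Integrable (fun ω => CVaR α μ (w t ω) - CVaR α μ wstar) P ∧
      ∫ ω, (CVaR α μ (w t ω) - CVaR α μ wstar) ∂P
        ≤ sgdConst G R c₁ c₂ * (1 / √(T : ℝ) + ε) := by
  have hwW : ∀ t ω, w t ω ∈ W := by
    intro t ω
    cases t with
    | zero => exact hw0W ω
    | succ t => rw [hstep]; exact sgdStep_mem hW _ _ _
  have hwm : ∀ t, Measurable (w t) := by
    intro t
    induction t with
    | zero => exact hw0
    | succ t ih =>
      have : w (t + 1) = fun ω => proj W (w t ω - η t • gt t ω) := funext (hstep t)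
      rw [this]
      have := hgt t
      exact (continuous_proj hW).measurable.comp (by fun_prop)
  have hCm := measurable_CVaR μ hα hα1 hμ
  have hgm := measurable_cvarGrad μ hα hα1
  have hCint : ∀ t, Integrable (fun ω => CVaR α μ (w t ω) - CVaR α μ wstar) P := by
    intro t
    refine Integrable.sub ?_ (integrable_const _)
    refine Integrable.of_bound (hCm.comp (hwm t)).aestronglyMeasurable (G * R)
      (Filter.Eventually.of_forall fun ω => (abs_CVaR_le μ hG.le hμ _).trans ?_)
    exact mul_le_mul_of_nonneg_left (hW.norm_le _ (hwW t ω)) hG.le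
  have hDbound : ∀ t ω, ‖w t ω - wstar‖ ^ 2 ≤ 4 * R ^ 2 := by
    intro t ω
    have := norm_sub_le_of_mem hW (hwW t ω) hstar
    nlinarith [norm_nonneg (w t ω - wstar)]
  have hDint : ∀ t, Integrable (fun ω => ‖w t ω - wstar‖ ^ 2) P := by
    intro t
    have := hwm t
    refine Integrable.of_bound (Measurable.aestronglyMeasurable (by fun_prop)) (4 * R ^ 2)
      (Filter.Eventually.of_forall fun ω => ?_)
    rw [Real.norm_of_nonneg (by positivity)]
    exact hDbound t ω
  have hXm : ∀ t, Measurable fun ω => ‖gt t ω - cvarGrad α μ (w t ω)‖ := fun t =>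
    ((hgt t).sub (hgm.comp (hwm t))).norm
  have hone : ∀ t, ∫ ω, ‖w (t + 1) ω - wstar‖ ^ 2 ∂P ≤ ∫ ω, ‖w t ω - wstar‖ ^ 2 ∂P
      - 2 * η t * ∫ ω, (CVaR α μ (w t ω) - CVaR α μ wstar) ∂P + η t ^ 2 * G ^ 2
      + 4 * R * ∫ ω, min (η t * ‖gt t ω - cvarGrad α μ (w t ω)‖) (2 * R) ∂P := by
    intro t
    have hηt := (hη.pos hc₁ t).le
    have hNint : Integrable
        (fun ω => min (η t * ‖gt t ω - cvarGrad α μ (w t ω)‖) (2 * R)) P := by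
      have := hXm t
      refine Integrable.of_bound (Measurable.aestronglyMeasurable (by fun_prop)) (2 * R)
        (Filter.Eventually.of_forall fun ω => ?_)
      rw [Real.norm_of_nonneg (le_min (by positivity) (by positivity))]
      exact min_le_right _ _
    have hint1 := (hDint t).sub ((hCint t).const_mul (2 * η t))
    have hint2 := hint1.add (integrable_const (η t ^ 2 * G ^ 2))
    have hint3 := hint2.add (hNint.const_mul (4 * R))
    have hle := integral_mono (hDint (t + 1)) hint3 fun ω => by
      have h1 := norm_sgdStep_sub_sq_le hW (hwW t ω) hstar (gt := gt t ω)
        (norm_cvarGrad_le μ (α := α) hG.le hμ (w t ω)) hηt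
      rw [← hstep] at h1
      have h2 := cvar_sub_le μ hα hα1 hμ (hatom wstar hstar) (hatom _ (hwW t ω))
      have h3 := mul_le_mul_of_nonneg_left h2 (by positivity : 0 ≤ 2 * η t)
      simp only [Pi.add_apply, Pi.sub_apply]
      linarith
    rw [integral_add' hint2 (hNint.const_mul (4 * R)), integral_add' hint1 (integrable_const _),
      integral_sub' (hDint t) ((hCint t).const_mul (2 * η t)), integral_const,
      integral_const_mul, integral_const_mul] at hle
    simpa using hle
  obtain ⟨t, htT, ht⟩ := exists_gap_le (G := G) hR hc₁ hη hT hε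
    (D := fun t => ∫ ω, ‖w t ω - wstar‖ ^ 2 ∂P)
    (Δ := fun t => ∫ ω, (CVaR α μ (w t ω) - CVaR α μ wstar) ∂P)
    (N := fun t => ∫ ω, min (η t * ‖gt t ω - cvarGrad α μ (w t ω)‖) (2 * R) ∂P)
    (fun t => integral_nonneg fun ω => by positivity)
    (fun t => by
      refine (integral_mono (hDint t) (integrable_const _) (hDbound t)).trans_eq ?_
      simp)
    (fun t _ => hone t)
    (fun t ht => integral_min_le P (hXm t) (fun ω => norm_nonneg _) hR.le
      (hη.pos hc₁ t).le hε (hacc t ht))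
  exact ⟨t, htT, hCint t, ht⟩

end StochasticRate

/-! ### The classical estimator: average over the largest empirical losses -/

section Rank

variable {n : ℕ}

/-- The number of indices whose value is larger than that of `i`, ties being broken by the
index. -/
noncomputable def rank (L : Fin n → ℝ) (i : Fin n) : ℕ :=
  (Finset.univ.filter fun j => L i < L j ∨ (L i = L j ∧ i < j)).card

/-- The indices of the `m` largest values. -/
noncomputable def topIndices (m : ℕ) (L : Fin n → ℝ) : Finset (Fin n) :=
  Finset.univ.filter fun i => rank L i < m

theorem rank_lt_rank {L : Fin n → ℝ} {i j : Fin n} (h : L i < L j ∨ (L i = L j ∧ i < j)) :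
    rank L j < rank L i := by
  refine Finset.card_lt_card (Finset.ssubset_iff_of_subset ?_ |>.2 ⟨j, ?_, ?_⟩)
  · intro k hk
    simp only [Finset.mem_filter, Finset.mem_univ, true_and] at hk ⊢
    rcases h with h | ⟨h, h'⟩ <;> rcases hk with hk | ⟨hk, hk'⟩
    · exact Or.inl (h.trans hk)
    · exact Or.inl (hk ▸ h)
    · exact Or.inl (h ▸ hk)
    · exact Or.inr ⟨h.trans hk, h'.trans hk'⟩
  · simpa using h
  · simp

theorem rank_lt (L : Fin n → ℝ) (i : Fin n) : rank L i < n := by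
  have : rank L i < (Finset.univ : Finset (Fin n)).card := by
    refine Finset.card_lt_card (Finset.ssubset_iff_of_subset (Finset.subset_univ _) |>.2
      ⟨i, Finset.mem_univ _, by simp⟩)
  simpa using this

theorem rank_injective (L : Fin n → ℝ) : Function.Injective (rank L) := by
  intro i j h
  by_contra hij
  rcases lt_trichotomy (L i) (L j) with h1 | h1 | h1
  · exact (rank_lt_rank (Or.inl h1)).ne' h
  · rcases lt_or_gt_of_ne hij with h2 | h2
    · exact (rank_lt_rank (Or.inr ⟨h1, h2⟩)).ne' h
    · exact (rank_lt_rank (Or.inr ⟨h1.symm, h2⟩)).ne h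
  · exact (rank_lt_rank (Or.inl h1)).ne h

theorem card_topIndices {m : ℕ} (hm : m ≤ n) (L : Fin n → ℝ) : (topIndices m L).card = m := by
  have hinj : Function.Injective fun i : Fin n => (⟨rank L i, rank_lt L i⟩ : Fin n) :=
    fun i j h => rank_injective L (by simpa using h)
  have hsurj := Finite.surjective_of_injective hinj
  have himg : (topIndices m L).image (rank L) = Finset.range m := by
    ext k
    simp only [Finset.mem_image, topIndices, Finset.mem_filter, Finset.mem_univ, true_and,
      Finset.mem_range]
    refine ⟨fun ⟨i, hi, hk⟩ => hk ▸ hi, fun hk => ?_⟩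
    obtain ⟨i, hi⟩ := hsurj ⟨k, hk.trans_le hm⟩
    have : rank L i = k := by simpa using hi
    exact ⟨i, this ▸ hk, this⟩
  rw [← Finset.card_image_of_injective _ (rank_injective L), himg, Finset.card_range]

/-- Both sets are upper sets for the order of the values, hence nested, so that sums over them
differ by at most the difference of the cardinalities. -/
theorem norm_sum_topIndices_sub_le {F : Type*} [SeminormedAddCommGroup F] {m : ℕ} (hm : m ≤ n)
    (L : Fin n → ℝ) (v : ℝ) {y : Fin n → F} {G : ℝ} (hy : ∀ i, ‖y i‖ ≤ G) :
    ‖∑ i ∈ topIndices m L, y i - ∑ i with v ≤ L i, y i‖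
      ≤ G * |(m : ℝ) - ((Finset.univ.filter fun i => v ≤ L i).card : ℝ)| := by
  set A := Finset.univ.filter fun i => v ≤ L i with hA
  have hB := card_topIndices hm L
  set B := topIndices m L with hBdef
  have hsub : ∀ s t : Finset (Fin n), s ⊆ t →
      ‖∑ i ∈ t, y i - ∑ i ∈ s, y i‖ ≤ G * ((t.card : ℝ) - s.card) := by
    intro s t hst
    rw [← Finset.sum_sdiff hst, add_sub_cancel_right]
    refine (norm_sum_le_of_le _ fun i _ => hy i).trans_eq ?_
    rw [Finset.sum_const, Finset.card_sdiff_of_subset hst, nsmul_eq_mul,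
      Nat.cast_sub (Finset.card_le_card hst), mul_comm]
  have hnest : A ⊆ B ∨ B ⊆ A := by
    by_contra! h
    obtain ⟨i, hiA, hiB⟩ := Finset.not_subset.1 h.1
    obtain ⟨j, hjB, hjA⟩ := Finset.not_subset.1 h.2
    simp only [hA, hBdef, topIndices, Finset.mem_filter, Finset.mem_univ, true_and, not_lt,
      not_le] at hiA hiB hjB hjA
    exact absurd (rank_lt_rank (Or.inl (hjA.trans_le hiA))) (by omega)
  rcases hnest with h | h
  · have := hsub _ _ h
    rw [hB] at this
    rwa [abs_of_nonneg]
    rw [sub_nonneg, ← hB]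
    exact_mod_cast Finset.card_le_card h
  · have := hsub _ _ h
    rw [hB, norm_sub_rev] at this
    rwa [abs_sub_comm, abs_of_nonneg]
    rw [sub_nonneg, ← hB]
    exact_mod_cast Finset.card_le_card h

end Rank

section SampleMeans

variable {X : Type*} [MeasurableSpace X] (μ : Measure X) [IsProbabilityMeasure μ]

theorem integral_le_sqrt_of_sq {Ω : Type*} [MeasurableSpace Ω] {P : Measure Ω}
    [IsProbabilityMeasure P] {Y : Ω → ℝ} (hY : MemLp Y 2 P) {c : ℝ}
    (h : ∫ ω, Y ω ^ 2 ∂P ≤ c) : ∫ ω, Y ω ∂P ≤ √c := by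
  refine Real.le_sqrt_of_sq_le (le_trans ?_ h)
  have h1 := variance_nonneg Y P
  rw [variance_eq_sub hY] at h1
  simpa using h1

theorem integral_sum_sub_sq_le (n : ℕ) {f : X → ℝ} (hf : MemLp f 2 μ) :
    MemLp (fun x : Fin n → X => ∑ i, f (x i) - n * ∫ a, f a ∂μ) 2 (Measure.pi fun _ => μ) ∧
    ∫ x : Fin n → X, (∑ i, f (x i) - n * ∫ a, f a ∂μ) ^ 2 ∂(Measure.pi fun _ => μ)
      ≤ n * ∫ a, f a ^ 2 ∂μ := by
  have hi : ∀ i : Fin n, MemLp (fun x : Fin n → X => f (x i)) 2 (Measure.pi fun _ => μ) :=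
    fun i => hf.comp_measurePreserving (measurePreserving_eval _ i)
  have hS : MemLp (fun x : Fin n → X => ∑ i, f (x i)) 2 (Measure.pi fun _ => μ) :=
    memLp_finsetSum _ fun i _ => hi i
  refine ⟨hS.sub (memLp_const _), ?_⟩
  have hmean : ∫ x : Fin n → X, ∑ i, f (x i) ∂(Measure.pi fun _ => μ) = n * ∫ a, f a ∂μ := by
    rw [integral_finsetSum _ fun i _ => (hi i).integrable one_le_two]
    have : ∀ i : Fin n, ∫ x : Fin n → X, f (x i) ∂(Measure.pi fun _ => μ) = ∫ a, f a ∂μ :=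
      fun i => integral_comp_eval (μ := fun _ : Fin n => μ) hf.aestronglyMeasurable
    simp [this]
  have hvar := variance_sum_pi (μ := fun _ : Fin n => μ) (X := fun _ => f) fun _ => hf
  have e : (∑ i : Fin n, fun x : Fin n → X => f (x i)) = fun x => ∑ i, f (x i) := by
    ext x; simp
  rw [e, variance_eq_integral hS.aestronglyMeasurable.aemeasurable, hmean] at hvar
  rw [hvar, Finset.sum_const, Finset.card_univ, Fintype.card_fin, nsmul_eq_mul]
  gcongr
  rw [variance_eq_sub hf]
  have := sq_nonneg (∫ a, f a ∂μ)
  simp only [Pi.pow_apply]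
  linarith

/-- The sum of `n` independent vectors of norm at most `G` deviates from its mean by `G √n` on
average, whatever the dimension. -/
theorem integral_norm_sum_sub_le (n : ℕ) {k : ℕ} {f : X → EuclideanSpace ℝ (Fin k)}
    (hf : AEStronglyMeasurable f μ) {G : ℝ} (hG0 : 0 ≤ G) (hG : ∀ᵐ a ∂μ, ‖f a‖ ≤ G) :
    Integrable (fun x : Fin n → X => ‖∑ i, f (x i) - (n : ℝ) • ∫ a, f a ∂μ‖)
      (Measure.pi fun _ => μ) ∧
    ∫ x : Fin n → X, ‖∑ i, f (x i) - (n : ℝ) • ∫ a, f a ∂μ‖ ∂(Measure.pi fun _ => μ)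
      ≤ G * √n := by
  have hfL : MemLp f 2 μ := MemLp.of_bound hf G hG
  have hfi : Integrable f μ := hfL.integrable one_le_two
  have hc : ∀ c, MemLp (fun a => f a c) 2 μ := fun c => by
    refine hfL.of_le ((EuclideanSpace.proj c : _ →L[ℝ] ℝ).continuous.comp_aestronglyMeasurable hf)
      (Filter.Eventually.of_forall fun a => PiLp.norm_apply_le (f a) c)
  have hmean : ∀ c, (∫ a, f a ∂μ) c = ∫ a, f a c ∂μ := fun c =>
    ((EuclideanSpace.proj c : EuclideanSpace ℝ (Fin k) →L[ℝ] ℝ).integral_comp_comm hfi).symm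
  have hmem : MemLp (fun x : Fin n → X => ∑ i, f (x i) - (n : ℝ) • ∫ a, f a ∂μ) 2
      (Measure.pi fun _ => μ) := by
    refine MemLp.sub (memLp_finsetSum _ fun i _ => ?_) (memLp_const _)
    exact hfL.comp_measurePreserving (measurePreserving_eval (fun _ : Fin n => μ) i)
  refine ⟨(hmem.integrable one_le_two).norm, ?_⟩
  rw [show G * √n = √(n * G ^ 2) by
    rw [Real.sqrt_mul (by positivity), Real.sqrt_sq hG0, mul_comm]]
  refine integral_le_sqrt_of_sq hmem.norm ?_
  have hexp : ∀ x : Fin n → X, ‖∑ i, f (x i) - (n : ℝ) • ∫ a, f a ∂μ‖ ^ 2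
      = ∑ c, (∑ i, f (x i) c - n * ∫ a, f a c ∂μ) ^ 2 := by
    intro x
    rw [EuclideanSpace.real_norm_sq_eq]
    refine Finset.sum_congr rfl fun c _ => ?_
    rw [PiLp.sub_apply, PiLp.smul_apply, hmean, smul_eq_mul]
    congr 2
    simp
  simp_rw [hexp]
  rw [integral_finsetSum _ fun c _ => (integral_sum_sub_sq_le μ n (hc c)).1.integrable_sq]
  calc ∑ c, ∫ x : Fin n → X, (∑ i, f (x i) c - n * ∫ a, f a c ∂μ) ^ 2 ∂(Measure.pi fun _ => μ)
      ≤ ∑ c, n * ∫ a, f a c ^ 2 ∂μ :=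
        Finset.sum_le_sum fun c _ => (integral_sum_sub_sq_le μ n (hc c)).2
    _ = n * ∫ a, ‖f a‖ ^ 2 ∂μ := by
        rw [← Finset.mul_sum, ← integral_finsetSum _ fun c _ => (hc c).integrable_sq]
        simp_rw [EuclideanSpace.real_norm_sq_eq]
    _ ≤ n * G ^ 2 := by
        gcongr
        refine (integral_mono_ae hfL.norm.integrable_sq (integrable_const (G ^ 2)) ?_).trans_eq
          (by simp)
        filter_upwards [hG] with a ha
        exact pow_le_pow_left₀ (norm_nonneg _) ha 2

end SampleMeans

section Estimator

variable {d : ℕ}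

/-- The empirical subgradient: minus the sum of the returns over the `⌈n (1 - α)⌉` samples with
the largest losses, divided by `n (1 - α)`. -/
noncomputable def empiricalGrad (α : ℝ) (n : ℕ) (w : EuclideanSpace ℝ (Fin d))
    (x : Fin n → EuclideanSpace ℝ (Fin d)) : EuclideanSpace ℝ (Fin d) :=
  (n * (1 - α))⁻¹ • ∑ i ∈ topIndices ⌈n * (1 - α)⌉₊ (fun i => loss w (x i)), -x i

theorem measurable_empiricalGrad (α : ℝ) (n : ℕ) :
    Measurable (Function.uncurry (empiricalGrad (d := d) α n)) := by
  have hl : ∀ i, Measurable fun p : EuclideanSpace ℝ (Fin d) × (Fin n → EuclideanSpace ℝ (Fin d)) =>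
      loss p.1 (p.2 i) := fun i =>
    continuous_loss.measurable.comp
      (measurable_fst.prodMk ((measurable_pi_apply i).comp measurable_snd))
  have hrank : ∀ i, Measurable
      fun p : EuclideanSpace ℝ (Fin d) × (Fin n → EuclideanSpace ℝ (Fin d)) =>
        rank (fun i => loss p.1 (p.2 i)) i := by
    intro i
    unfold rank
    simp_rw [Finset.card_filter]
    refine Finset.measurable_sum _ fun j _ => Measurable.ite ?_ measurable_const measurable_const
    refine (measurableSet_lt (hl i) (hl j)).union ?_
    exact (measurableSet_eq_fun (hl i) (hl j)).inter (MeasurableSet.const _)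
  unfold Function.uncurry empiricalGrad topIndices
  simp_rw [Finset.sum_filter]
  have hterm : ∀ i, Measurable
      fun p : EuclideanSpace ℝ (Fin d) × (Fin n → EuclideanSpace ℝ (Fin d)) =>
        if rank (fun i => loss p.1 (p.2 i)) i < ⌈n * (1 - α)⌉₊ then -p.2 i else 0 := fun i =>
    Measurable.ite (measurableSet_lt (hrank i) measurable_const)
      ((measurable_pi_apply i).comp measurable_snd).neg measurable_const
  exact (Finset.measurable_sum Finset.univ fun i _ => hterm i).const_smul ((n * (1 - α) : ℝ)⁻¹)

variable (μ : Measure (EuclideanSpace ℝ (Fin d))) [IsProbabilityMeasure μ] {α G : ℝ}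

/-- The top samples differ from the samples in the true tail event only as far as the size of the
latter fluctuates, which, like the mean over the true tail event, is controlled by a variance. -/
theorem integral_norm_empiricalGrad_sub_le (hα : 0 < α) (hα1 : α < 1) (hG : 0 ≤ G)
    (hμ : ∀ᵐ r ∂μ, ‖r‖ ≤ G) {w : EuclideanSpace ℝ (Fin d)}
    (hatom : ∀ z : ℝ, μ {r | loss w r = z} = 0) {n : ℕ} (hn : 0 < n) :
    Integrable (fun x => ‖empiricalGrad α n w x - cvarGrad α μ w‖)
      (Measure.pi fun _ : Fin n => μ) ∧
    ∫ x, ‖empiricalGrad α n w x - cvarGrad α μ w‖ ∂(Measure.pi fun _ : Fin n => μ)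
      ≤ 3 * G / (1 - α) / √n := by
  set A := tailEvent w (VaR α μ w) with hA
  have hAm : MeasurableSet A := measurableSet_tailEvent _ _
  have hμA : μ.real A = 1 - α := measureReal_tailEvent_VaR μ hα hα1 hatom
  have hα' : 0 < 1 - α := by linarith
  have hn' : (0 : ℝ) < n := by exact_mod_cast hn
  set m := ⌈n * (1 - α)⌉₊ with hm
  have hmn : m ≤ n := by
    rw [hm, Nat.ceil_le]
    nlinarith
  -- the two sums of independent terms
  obtain ⟨hi1, hb1⟩ := integral_norm_sum_sub_le μ n (f := A.indicator fun r => -r) (G := G)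
    ((measurable_neg.indicator hAm).aestronglyMeasurable) hG
    (hμ.mono fun r hr => (Set.indicator_le_self' (fun _ _ => norm_nonneg _) r |> fun h => by
      rw [norm_indicator_eq_indicator_norm]
      exact h.trans (by simpa using hr)))
  have hmem1 : MemLp (A.indicator fun _ => (1 : ℝ)) 2 μ := (memLp_const 1).indicator hAm
  obtain ⟨hi2, hb2⟩ := integral_sum_sub_sq_le μ n hmem1
  have hb2' : ∫ x : Fin n → EuclideanSpace ℝ (Fin d), |∑ i, A.indicator (fun _ => (1 : ℝ)) (x i)
      - n * ∫ a, A.indicator (fun _ => (1 : ℝ)) a ∂μ| ∂(Measure.pi fun _ => μ) ≤ √n := by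
    refine integral_le_sqrt_of_sq hi2.norm ?_
    simp only [Real.norm_eq_abs, sq_abs]
    refine hb2.trans ?_
    have : ∫ a, A.indicator (fun _ => (1 : ℝ)) a ^ 2 ∂μ ≤ 1 := by
      have e : ∀ a, A.indicator (fun _ => (1 : ℝ)) a ^ 2 = A.indicator (fun _ => (1 : ℝ)) a := by
        intro a
        by_cases h : a ∈ A <;> simp [h]
      simp_rw [e]
      exact (integral_indicator_one hAm).trans_le measureReal_le_one
    nlinarith
  have hint1 : ∫ a, A.indicator (fun _ => (1 : ℝ)) a ∂μ = 1 - α := by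
    rw [← hμA]; exact integral_indicator_one hAm
  have hint2 : ∫ a, A.indicator (fun r => -r) a ∂μ = (1 - α) • cvarGrad α μ w := by
    rw [integral_indicator hAm, cvarGrad, integral_tailLaw, ← hA, hμA, smul_smul,
      mul_inv_cancel₀ hα'.ne', one_smul]
  rw [hint2] at hi1 hb1
  rw [hint1] at hi2 hb2'
  set S1 : (Fin n → EuclideanSpace ℝ (Fin d)) → ℝ := fun x =>
    ‖∑ i, A.indicator (fun r => -r) (x i) - (n : ℝ) • (1 - α) • cvarGrad α μ w‖ with hS1
  set S2 : (Fin n → EuclideanSpace ℝ (Fin d)) → ℝ := fun x =>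
    |∑ i, A.indicator (fun _ => (1 : ℝ)) (x i) - n * (1 - α)| with hS2
  have hi2' : Integrable S2 (Measure.pi fun _ => μ) := (hi2.integrable one_le_two).abs
  have hae : ∀ᵐ x : Fin n → EuclideanSpace ℝ (Fin d) ∂(Measure.pi fun _ => μ),
      ‖empiricalGrad α n w x - cvarGrad α μ w‖ ≤
        (n * (1 - α))⁻¹ * (G * (1 + S2 x) + S1 x) := by
    have hall : ∀ᵐ x : Fin n → EuclideanSpace ℝ (Fin d) ∂(Measure.pi fun _ => μ),
        ∀ i, ‖x i‖ ≤ G := ae_all_iff.2 fun i =>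
      (measurePreserving_eval (fun _ : Fin n => μ) i).quasiMeasurePreserving.ae hμ
    filter_upwards [hall] with x hx
    have h1 := norm_sum_topIndices_sub_le hmn (fun i => loss w (x i)) (VaR α μ w)
      (y := fun i => -x i) (G := G) (by simpa using hx)
    have e1 : ∑ i with VaR α μ w ≤ loss w (x i), -x i
        = ∑ i, A.indicator (fun r => -r) (x i) := by
      rw [Finset.sum_filter]; rfl
    have e2 : ((Finset.univ.filter fun i => VaR α μ w ≤ loss w (x i)).card : ℝ)
        = ∑ i, A.indicator (fun _ => (1 : ℝ)) (x i) := by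
      rw [Finset.card_filter]; push_cast; rfl
    rw [e1, e2] at h1
    have h2 : |(m : ℝ) - ∑ i, A.indicator (fun _ => (1 : ℝ)) (x i)| ≤ 1 + S2 x := by
      have h3 : (n : ℝ) * (1 - α) ≤ m := Nat.le_ceil _
      have h4 : (m : ℝ) < n * (1 - α) + 1 := Nat.ceil_lt_add_one (by positivity)
      have h5 := abs_sub_le (m : ℝ) (n * (1 - α)) (∑ i, A.indicator (fun _ => (1 : ℝ)) (x i))
      rw [abs_of_nonneg (sub_nonneg.2 h3), abs_sub_comm (n * (1 - α))] at h5
      simp only [hS2]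
      linarith
    have e3 : empiricalGrad α n w x - cvarGrad α μ w = (n * (1 - α))⁻¹ •
        ((∑ i ∈ topIndices m (fun i => loss w (x i)), -x i
          - ∑ i, A.indicator (fun r => -r) (x i))
        + (∑ i, A.indicator (fun r => -r) (x i) - (n : ℝ) • (1 - α) • cvarGrad α μ w)) := by
      rw [sub_add_sub_cancel, smul_sub, smul_smul (n : ℝ), smul_smul,
        inv_mul_cancel₀ (by positivity), one_smul]
      rfl
    rw [e3, norm_smul, Real.norm_of_nonneg (by positivity)]
    refine mul_le_mul_of_nonneg_left ((norm_add_le _ _).trans (add_le_add ?_ le_rfl))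
      (by positivity)
    exact h1.trans (mul_le_mul_of_nonneg_left h2 hG)
  have hi3 : Integrable (fun x => 1 + S2 x) (Measure.pi fun _ => μ) :=
    (integrable_const 1).add hi2'
  have hbint : Integrable (fun x => (n * (1 - α))⁻¹ * (G * (1 + S2 x) + S1 x))
      (Measure.pi fun _ : Fin n => μ) :=
    ((hi3.const_mul G).add hi1).const_mul _
  have hmeas : Measurable fun x => ‖empiricalGrad α n w x - cvarGrad α μ w‖ :=
    (((measurable_empiricalGrad α n).comp (measurable_const.prodMk measurable_id)).sub
      measurable_const).norm
  have hLint : Integrable (fun x => ‖empiricalGrad α n w x - cvarGrad α μ w‖)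
      (Measure.pi fun _ : Fin n => μ) :=
    hbint.mono' hmeas.aestronglyMeasurable (by simpa using hae)
  refine ⟨hLint, (integral_mono_ae hLint hbint hae).trans ?_⟩
  rw [integral_const_mul, integral_add (hi3.const_mul G) hi1,
    integral_const_mul, integral_add (integrable_const _) hi2']
  have hsq : (1 : ℝ) ≤ √n := by
    rw [Real.one_le_sqrt]
    exact_mod_cast hn
  have hbnd : G * (1 + √n) + G * √n ≤ 3 * G * √n := by nlinarith
  calc _ ≤ (n * (1 - α))⁻¹ * (3 * G * √n) := by
        refine mul_le_mul_of_nonneg_left (le_trans ?_ hbnd) (by positivity)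
        refine add_le_add (mul_le_mul_of_nonneg_left (add_le_add ?_ hb2') hG) hb1
        simp
    _ = 3 * G / (1 - α) / √n := by
        have hq : √(n : ℝ) ^ 2 = n := Real.sq_sqrt hn'.le
        have : √(n : ℝ) ≠ 0 := by positivity
        field_simp
        rw [hq]
        ring

end Estimator

section FreshBatches

/-- Averaging over a fresh argument: a bound that holds for every fixed first argument holds on
average for an independent first argument. -/
theorem integral_le_of_indepFun {Ω A B : Type*} [MeasurableSpace Ω] [MeasurableSpace A]
    [MeasurableSpace B] {P : Measure Ω} [IsProbabilityMeasure P] {X : Ω → A} {Y : Ω → B}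
    (hX : Measurable X) (hY : Measurable Y) (hXY : IndepFun X Y P) {f : A → B → ℝ}
    (hf : Measurable (Function.uncurry f)) (hf0 : ∀ a b, 0 ≤ f a b) {s : Set A}
    (hs : MeasurableSet s) (hXs : ∀ ω, X ω ∈ s) {ε : ℝ}
    (h : ∀ a ∈ s, Integrable (f a) (P.map Y) ∧ ∫ b, f a b ∂(P.map Y) ≤ ε) :
    Integrable (fun ω => f (X ω) (Y ω)) P ∧ ∫ ω, f (X ω) (Y ω) ∂P ≤ ε := by
  have := Measure.isProbabilityMeasure_map (μ := P) hX.aemeasurable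
  have := Measure.isProbabilityMeasure_map (μ := P) hY.aemeasurable
  have hmap := hXY.map_prod_eq_prod_map_map hX.aemeasurable hY.aemeasurable
  have hae : ∀ᵐ a ∂(P.map X), a ∈ s :=
    (ae_map_iff hX.aemeasurable hs).2 (Filter.Eventually.of_forall hXs)
  have hsm : AEStronglyMeasurable (Function.uncurry f) ((P.map X).prod (P.map Y)) :=
    hf.aestronglyMeasurable
  have hint1 : Integrable (fun a => ∫ b, f a b ∂(P.map Y)) (P.map X) := by
    refine Integrable.of_bound hf.stronglyMeasurable.integral_prod_right.aestronglyMeasurable ε ?_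
    filter_upwards [hae] with a ha
    rw [Real.norm_of_nonneg (integral_nonneg (hf0 a))]
    exact (h a ha).2
  have hint : Integrable (Function.uncurry f) ((P.map X).prod (P.map Y)) := by
    refine (integrable_prod_iff hsm).2 ⟨hae.mono fun a ha => (h a ha).1, ?_⟩
    refine hint1.congr (Filter.Eventually.of_forall fun a => ?_)
    refine integral_congr_ae (Filter.Eventually.of_forall fun b => ?_)
    exact (Real.norm_of_nonneg (hf0 a b)).symm
  have hint' := hint
  rw [← hmap] at hint'
  have hXYm : AEMeasurable (fun ω => (X ω, Y ω)) P := (hX.prodMk hY).aemeasurable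
  refine ⟨(integrable_map_measure hf.aestronglyMeasurable hXYm).1 hint', ?_⟩
  have e : ∫ ω, f (X ω) (Y ω) ∂P = ∫ p, Function.uncurry f p ∂((P.map X).prod (P.map Y)) := by
    rw [← hmap, integral_map hXYm hf.aestronglyMeasurable]
    rfl
  rw [e, integral_prod _ hint]
  refine (integral_mono_ae hint1 (integrable_const ε) ?_).trans_eq (by simp)
  filter_upwards [hae] with a ha
  exact (h a ha).2

variable {d n : ℕ} {W : Set (EuclideanSpace ℝ (Fin d))} {R : ℝ} {η : ℕ → ℝ}
  {w₀ : EuclideanSpace ℝ (Fin d)}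
  {est : EuclideanSpace ℝ (Fin d) → (Fin n → EuclideanSpace ℝ (Fin d)) → EuclideanSpace ℝ (Fin d)}

theorem classicalSGD_congr {x y : ℕ → Fin n → EuclideanSpace ℝ (Fin d)} {t : ℕ}
    (h : ∀ s < t, x s = y s) : classicalSGD W η w₀ est x t = classicalSGD W η w₀ est y t := by
  induction t with
  | zero => rfl
  | succ t ih =>
    simp only [classicalSGD]
    rw [ih fun s hs => h s (hs.trans (Nat.lt_succ_self t)), h t (Nat.lt_succ_self t)]

theorem classicalSGD_mem (hW : IsFeasibleSet W R) (hw₀ : w₀ ∈ W)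
    (x : ℕ → Fin n → EuclideanSpace ℝ (Fin d)) (t : ℕ) : classicalSGD W η w₀ est x t ∈ W := by
  cases t with
  | zero => exact hw₀
  | succ t => exact sgdStep_mem hW _ _ _

theorem measurable_classicalSGD (hW : IsFeasibleSet W R) (hest : Measurable (Function.uncurry est))
    (t : ℕ) : Measurable fun x => classicalSGD W η w₀ est x t := by
  induction t with
  | zero => exact measurable_const
  | succ t ih =>
    have h2 : Measurable fun x : ℕ → Fin n → EuclideanSpace ℝ (Fin d) =>
        est (classicalSGD W η w₀ est x t) (x t) :=
      hest.comp (ih.prodMk (measurable_pi_apply t))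
    exact (continuous_proj hW).measurable.comp (ih.sub (h2.const_smul (η t)))

theorem measurable_est_classicalSGD (hW : IsFeasibleSet W R)
    (hest : Measurable (Function.uncurry est)) (t : ℕ) :
    Measurable fun x => est (classicalSGD W η w₀ est x t) (x t) :=
  hest.comp ((measurable_classicalSGD hW hest t).prodMk (measurable_pi_apply t))

/-- The current iterate depends on the earlier batches only. -/
theorem indepFun_classicalSGD (μ : Measure (EuclideanSpace ℝ (Fin d))) [IsProbabilityMeasure μ]
    (hW : IsFeasibleSet W R) (hest : Measurable (Function.uncurry est)) (t : ℕ) :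
    IndepFun (fun x => classicalSGD W η w₀ est x t) (fun x => x t) (sampleLaw n μ) := by
  have hind : iIndepFun (fun (s : ℕ) (x : ℕ → Fin n → EuclideanSpace ℝ (Fin d)) => x s)
      (sampleLaw n μ) :=
    iIndepFun_infinitePi (P := fun _ : ℕ => Measure.pi fun _ : Fin n => μ)
      (X := fun _ y => y) fun _ => measurable_id
  have h := hind.indepFun_finset (Finset.range t) {t} (by simp) fun s => measurable_pi_apply s
  let ext : ((s : Finset.range t) → Fin n → EuclideanSpace ℝ (Fin d)) →
      ℕ → Fin n → EuclideanSpace ℝ (Fin d) :=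
    fun y s => if hs : s ∈ Finset.range t then y ⟨s, hs⟩ else 0
  have hext : Measurable ext := by
    refine measurable_pi_lambda _ fun s => ?_
    by_cases hs : s ∈ Finset.range t
    · simp only [ext, hs, dite_true]
      exact measurable_pi_apply _
    · simp only [ext, hs, dite_false]
      exact measurable_const
  have h' := h.comp ((measurable_classicalSGD (η := η) (w₀ := w₀) hW hest t).comp hext)
    (measurable_pi_apply (⟨t, Finset.mem_singleton_self t⟩ : ({t} : Finset ℕ)))
  convert! h' using 1
  funext x
  refine classicalSGD_congr fun s hs => ?_
  simp [ext, hs]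

instance (μ : Measure (EuclideanSpace ℝ (Fin d))) [IsProbabilityMeasure μ] :
    IsProbabilityMeasure (sampleLaw n μ) := by
  unfold sampleLaw
  infer_instance

end FreshBatches

section RegularReturns

variable {d : ℕ} {μ : Measure (EuclideanSpace ℝ (Fin d))} [IsProbabilityMeasure μ]
  {W : Set (EuclideanSpace ℝ (Fin d))} {G M : ℝ}

omit [IsProbabilityMeasure μ] in
theorem RegularReturns.measure_loss_eq (h : RegularReturns μ W G M)
    {w : EuclideanSpace ℝ (Fin d)} (hw : w ∈ W) (z : ℝ) : μ {r | loss w r = z} = 0 := by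
  have := h.hasPDF w hw
  have h1 : μ.map (loss w) ≪ volume := HasPDF.absolutelyContinuous
  have h2 := h1 (Real.volume_singleton (a := z))
  rwa [Measure.map_apply (measurable_loss w) (measurableSet_singleton z)] at h2

/-- A density bound controls the probability that the loss lies in an interval. -/
theorem RegularReturns.measureReal_Ico_le (h : RegularReturns μ W G M) (hM : 0 ≤ M)
    {w : EuclideanSpace ℝ (Fin d)} (hw : w ∈ W) {a b : ℝ} (hab : a ≤ b) :
    μ.real (tailEvent w a) ≤ μ.real (tailEvent w b) + M * (b - a) := by
  have := h.hasPDF w hw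
  have hU : tailEvent w a ⊆ tailEvent w b ∪ loss w ⁻¹' Set.Ico a b := by
    intro r hr
    have hr : a ≤ loss w r := hr
    rcases le_or_gt b (loss w r) with h1 | h1
    · exact Or.inl h1
    · exact Or.inr ⟨hr, h1⟩
  refine (measureReal_mono hU).trans ((measureReal_union_le _ _).trans ?_)
  gcongr
  have h1 : μ (loss w ⁻¹' Set.Ico a b) ≤ ENNReal.ofReal (M * (b - a)) := by
    rw [← Measure.map_apply (measurable_loss w) measurableSet_Ico,
      map_eq_setLIntegral_pdf (loss w) μ volume measurableSet_Ico]
    calc ∫⁻ x in Set.Ico a b, pdf (loss w) μ volume x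
        ≤ ∫⁻ _ in Set.Ico a b, ENNReal.ofReal M :=
          lintegral_mono_ae (ae_restrict_of_ae (h.pdf_le w hw))
      _ = ENNReal.ofReal (M * (b - a)) := by
          rw [setLIntegral_const, Real.volume_Ico, ENNReal.ofReal_mul hM]
  exact ENNReal.toReal_le_of_le_ofReal (mul_nonneg hM (sub_nonneg.2 hab)) h1

end RegularReturns

section Classical

theorem exists_nat_div_sqrt_le {A ε : ℝ} (hA : 0 < A) (hε : 0 < ε) (hε1 : ε < 1) :
    ∃ n : ℕ, 0 < n ∧ A / √(n : ℝ) ≤ ε ∧ (n : ℝ) ≤ (A ^ 2 + 1) / ε ^ 2 := by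
  refine ⟨⌈(A / ε) ^ 2⌉₊, Nat.ceil_pos.2 (by positivity), ?_, ?_⟩
  · have h1 : A / ε ≤ √(⌈(A / ε) ^ 2⌉₊ : ℝ) :=
      Real.le_sqrt_of_sq_le (Nat.le_ceil _)
    rw [div_le_iff₀ (lt_of_lt_of_le (by positivity) h1)]
    rw [div_le_iff₀ hε] at h1
    linarith
  · refine (Nat.ceil_lt_add_one (by positivity)).le.trans ?_
    rw [div_pow, add_div]
    gcongr
    rw [le_div_iff₀ (by positivity)]
    nlinarith

/-- A number of steps and an oracle accuracy for which the convergence rate gives `ε`. -/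
theorem exists_steps {G R c₁ c₂ : ℝ} (hR : 0 < R) (hc₁ : 0 < c₁) {ε : ℝ} (hε : 0 < ε)
    (hε1 : ε < 1) : ∃ T : ℕ, 0 < T ∧
      sgdConst G R c₁ c₂ * (1 / √(T : ℝ) + ε / (2 * sgdConst G R c₁ c₂)) ≤ ε ∧
      (T : ℝ) ≤ ((2 * sgdConst G R c₁ c₂) ^ 2 + 1) / ε ^ 2 := by
  set C := sgdConst G R c₁ c₂
  have hC : 1 ≤ C := one_le_sgdConst hR hc₁
  obtain ⟨T, hT, h1, h2⟩ := exists_nat_div_sqrt_le (by positivity : 0 < 2 * C) hε hε1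
  refine ⟨T, hT, ?_, h2⟩
  have e : C * (1 / √(T : ℝ) + ε / (2 * C)) = (2 * C / √(T : ℝ)) / 2 + ε / 2 := by
    field_simp
  rw [e]
  linarith

/-- Sample complexity of the classical algorithm; the dimension does not enter. -/
theorem classical_complexity {α G R c₁ c₂ : ℝ} (hα : 0 < α) (hα1 : α < 1) (hG : 0 < G)
    (hR : 0 < R) (hc₁ : 0 < c₁) : ∃ C : ℝ, 0 < C ∧
    ∀ (d : ℕ) (W : Set (EuclideanSpace ℝ (Fin d))) (w₀ : EuclideanSpace ℝ (Fin d))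
      (η : ℕ → ℝ) (ε M : ℝ), IsFeasibleSet W R → w₀ ∈ W → StepSize c₁ c₂ η → 0 < ε → ε < 1 →
      ∃ (T n : ℕ) (est : EuclideanSpace ℝ (Fin d) → (Fin n → EuclideanSpace ℝ (Fin d)) →
          EuclideanSpace ℝ (Fin d)),
        Measurable (Function.uncurry est) ∧ (T : ℝ) * n ≤ C / ε ^ 4 ∧
        ∀ (μ : Measure (EuclideanSpace ℝ (Fin d))) [IsProbabilityMeasure μ],
          RegularReturns μ W G M →
            (∀ w ∈ W, Integrable (fun x => ‖est w x - cvarGrad α μ w‖)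
                (Measure.pi fun _ : Fin n => μ) ∧
              ∫ x, ‖est w x - cvarGrad α μ w‖ ∂(Measure.pi fun _ : Fin n => μ) ≤ ε) ∧
            ∀ wstar ∈ W, ∃ t < T,
              Integrable (fun x => CVaR α μ (classicalSGD W η w₀ est x t) - CVaR α μ wstar)
                (sampleLaw n μ) ∧
              ∫ x, (CVaR α μ (classicalSGD W η w₀ est x t) - CVaR α μ wstar) ∂(sampleLaw n μ)
                ≤ ε := by
  set K := sgdConst G R c₁ c₂ with hK
  have hK1 : 1 ≤ K := one_le_sgdConst hR hc₁
  have hα' : 0 < 1 - α := by linarith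
  refine ⟨((2 * K) ^ 2 + 1) * ((6 * G * K / (1 - α)) ^ 2 + 1), by positivity,
    fun d W w₀ η ε M hW hw₀ hη hε hε1 => ?_⟩
  obtain ⟨T, hT, hTε, hTle⟩ := exists_steps (G := G) (R := R) (c₁ := c₁) (c₂ := c₂) hR hc₁ hε hε1
  rw [← hK] at hTε hTle
  obtain ⟨n, hn, hnε, hnle⟩ := exists_nat_div_sqrt_le
    (by positivity : 0 < 6 * G * K / (1 - α)) hε hε1
  have hacc : 3 * G / (1 - α) / √(n : ℝ) ≤ ε / (2 * K) := by
    rw [le_div_iff₀ (by positivity)]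
    refine le_trans (le_of_eq ?_) hnε
    ring
  have hsmall : ε / (2 * K) ≤ ε := div_le_self hε.le (by linarith)
  refine ⟨T, n, empiricalGrad α n, measurable_empiricalGrad α n, ?_, ?_⟩
  · calc (T : ℝ) * n ≤ (((2 * K) ^ 2 + 1) / ε ^ 2) *
          (((6 * G * K / (1 - α)) ^ 2 + 1) / ε ^ 2) := by gcongr
      _ = _ := by field_simp
  intro μ _ hμ
  have hest := fun w (hw : w ∈ W) => integral_norm_empiricalGrad_sub_le μ hα hα1 hG.le hμ.norm_le
    (fun z => hμ.measure_loss_eq hw z) hn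
  refine ⟨fun w hw => ⟨(hest w hw).1, (hest w hw).2.trans (hacc.trans hsmall)⟩,
    fun wstar hstar => ?_⟩
  have hwm := fun t => measurable_classicalSGD (η := η) (w₀ := w₀) (W := W) hW
    (measurable_empiricalGrad (d := d) α n) t
  have hYmap : ∀ t, (sampleLaw n μ).map (fun x => x t) = Measure.pi fun _ : Fin n => μ := fun t =>
    Measure.infinitePi_map_eval (fun _ : ℕ => Measure.pi fun _ : Fin n => μ) t
  have herr : Measurable (Function.uncurry fun
      (w : EuclideanSpace ℝ (Fin d)) (x : Fin n → EuclideanSpace ℝ (Fin d)) =>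
        ‖empiricalGrad α n w x - cvarGrad α μ w‖) :=
    ((measurable_empiricalGrad α n).sub
      ((measurable_cvarGrad μ hα hα1).comp measurable_fst)).norm
  have hstep := fun t => integral_le_of_indepFun (hwm t) (measurable_pi_apply t)
    (indepFun_classicalSGD μ hW (measurable_empiricalGrad α n) t) herr
    (fun _ _ => norm_nonneg _) hW.isClosed.measurableSet
    (fun x => classicalSGD_mem hW hw₀ x t) (ε := ε / (2 * K))
    (fun w hw => by rw [hYmap]; exact ⟨(hest w hw).1, (hest w hw).2.trans hacc⟩)
  have hgm := measurable_est_classicalSGD (η := η) (w₀ := w₀) hW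
    (measurable_empiricalGrad (d := d) α n)
  obtain ⟨t, ht, h1, h2⟩ := stochastic_sgd_rate (c₂ := c₂) μ hG hR hc₁ hα hα1 hW hμ.norm_le
    (fun w hw z => hμ.measure_loss_eq hw z) hstar hη (sampleLaw n μ)
    (w := fun t x => classicalSGD W η w₀ (empiricalGrad α n) x t)
    (gt := fun t x => empiricalGrad α n (classicalSGD W η w₀ (empiricalGrad α n) x t) (x t))
    (ε := ε / (2 * K)) hT (by positivity) (hwm 0) (fun x => hw₀)
    hgm (fun t x => rfl) (fun t _ => Or.inl (hstep t))
  exact ⟨t, ht, h1, h2.trans hTε⟩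

end Classical

/-! ### Calculus of quantum query programs -/

section Programs

variable {K : Type} [NormedAddCommGroup K] [InnerProductSpace ℂ K]

theorem QCircuit.norm_final {S : Type} [Fintype S] (c : QCircuit K S) (U : K ≃ₗᵢ[ℂ] K) :
    ‖c.final U‖ = 1 := by
  have h : ∀ (l : List ((S → QMode) × (QState K S ≃ₗᵢ[ℂ] QState K S))) (ψ : QState K S),
      ‖l.foldl (fun ψ st => st.2 (queryGate U st.1 ψ)) ψ‖ = ‖ψ‖ := by
    intro l
    induction l with
    | nil => intro ψ; rfl
    | cons st l ih => intro ψ; rw [List.foldl_cons, ih]; simp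
  rw [QCircuit.final, h, c.norm_init]

theorem QCircuit.sum_prob {S : Type} [Fintype S] (c : QCircuit K S) (U : K ≃ₗᵢ[ℂ] K) :
    ∑ s, c.prob U s = 1 := by
  have h := PiLp.norm_sq_eq_of_L2 (fun _ : S => K) (c.final U)
  rw [c.norm_final, one_pow] at h
  exact h.symm

theorem QCircuit.prob_nonneg {S : Type} [Fintype S] (c : QCircuit K S) (U : K ≃ₗᵢ[ℂ] K) (s : S) :
    0 ≤ c.prob U s := sq_nonneg _

namespace QProg

variable {γ δ : Type} (U : K ≃ₗᵢ[ℂ] K)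

/-- Every possible output of the program satisfies `Q`. -/
def AllOutputs (Q : γ → Prop) : QProg K γ → Prop
  | ret a => Q a
  | meas _ _ _ next => ∀ s, (next s).AllOutputs Q

theorem AllOutputs.of_forall {Q : γ → Prop} (h : ∀ a, Q a) (p : QProg K γ) : p.AllOutputs Q := by
  induction p with
  | ret a => exact h a
  | meas S i c next ih => exact fun s => ih s

theorem AllOutputs.mono {Q Q' : γ → Prop} {p : QProg K γ} (hp : p.AllOutputs Q)
    (h : ∀ a, Q a → Q' a) : p.AllOutputs Q' := by
  induction p with
  | ret a => exact h a hp
  | meas S i c next ih => exact fun s => ih s (hp s)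

theorem AllOutputs.bind {Q : γ → Prop} {Q' : δ → Prop} {p : QProg K γ} {k : γ → QProg K δ}
    (hp : p.AllOutputs Q) (hk : ∀ a, Q a → (k a).AllOutputs Q') : (p.bind k).AllOutputs Q' := by
  induction p with
  | ret a => exact hk a hp
  | meas S i c next ih => exact fun s => ih s (hp s)

theorem expect_bind (φ : δ → ℝ) (p : QProg K γ) (k : γ → QProg K δ) :
    (p.bind k).expect U φ = p.expect U fun a => (k a).expect U φ := by
  induction p with
  | ret a => rfl
  | meas S i c next ih => simp only [QProg.bind, expect, ih]

theorem expect_mono_of_allOutputs {φ ψ : γ → ℝ} {p : QProg K γ}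
    (h : p.AllOutputs fun a => φ a ≤ ψ a) : p.expect U φ ≤ p.expect U ψ := by
  induction p with
  | ret a => exact h
  | meas S i c next ih =>
    exact Finset.sum_le_sum fun s _ => mul_le_mul_of_nonneg_left (ih s (h s)) (c.prob_nonneg U s)

theorem expect_mono {φ ψ : γ → ℝ} (h : ∀ a, φ a ≤ ψ a) (p : QProg K γ) :
    p.expect U φ ≤ p.expect U ψ :=
  expect_mono_of_allOutputs U (AllOutputs.of_forall h p)

@[simp]
theorem expect_const (c : ℝ) (p : QProg K γ) : (p.expect U fun _ => c) = c := by
  induction p with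
  | ret a => rfl
  | meas S i c next ih =>
    simp only [expect, ih, ← Finset.sum_mul, c.sum_prob, one_mul]

theorem expect_add (φ ψ : γ → ℝ) (p : QProg K γ) :
    (p.expect U fun a => φ a + ψ a) = p.expect U φ + p.expect U ψ := by
  induction p with
  | ret a => rfl
  | meas S i c next ih => simp only [expect, ih, mul_add, Finset.sum_add_distrib]

theorem expect_const_mul (c : ℝ) (φ : γ → ℝ) (p : QProg K γ) :
    (p.expect U fun a => c * φ a) = c * p.expect U φ := by
  induction p with
  | ret a => rfl
  | meas S i cc next ih =>
    simp only [expect, ih, Finset.mul_sum]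
    exact Finset.sum_congr rfl fun s _ => by ring

theorem expect_nonneg {φ : γ → ℝ} (h : ∀ a, 0 ≤ φ a) (p : QProg K γ) : 0 ≤ p.expect U φ := by
  simpa using expect_mono U h p

theorem queries_bind_le {q : ℕ} (p : QProg K γ) {k : γ → QProg K δ}
    (h : ∀ a, (k a).queries ≤ q) : (p.bind k).queries ≤ p.queries + q := by
  induction p with
  | ret a => simpa [QProg.bind, queries] using h a
  | meas S i c next ih =>
    simp only [QProg.bind, queries, add_assoc]
    refine Nat.add_le_add_left (Finset.sup_le fun s hs => (ih s).trans ?_) _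
    exact Nat.add_le_add_right (Finset.le_sup (f := fun s => (next s).queries) hs) _

theorem queries_bind_ret_le (p : QProg K γ) (f : γ → δ) :
    (p.bind fun a => ret (f a)).queries ≤ p.queries :=
  queries_bind_le (q := 0) p fun _ => le_rfl

open Classical in
/-- The probability that the output of the program violates `Q`. -/
noncomputable def failure (Q : γ → Prop) (p : QProg K γ) : ℝ :=
  p.expect U fun a => if Q a then 0 else 1

theorem failure_ret {Q : γ → Prop} {a : γ} (h : Q a) : (ret a : QProg K γ).failure U Q = 0 := by
  simp [failure, expect, h]

theorem failure_le_one (Q : γ → Prop) (p : QProg K γ) : p.failure U Q ≤ 1 := by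
  have := expect_mono U (ψ := fun _ => 1)
    (fun a => by split_ifs <;> norm_num : ∀ a, (open Classical in if Q a then (0 : ℝ) else 1) ≤ 1) p
  simpa [failure] using this

theorem failure_mono {Q Q' : γ → Prop} (h : ∀ a, Q a → Q' a) (p : QProg K γ) :
    p.failure U Q' ≤ p.failure U Q := by
  refine expect_mono U (fun a => ?_) p
  by_cases h1 : Q a
  · simp [h1, h a h1]
  · simp only [h1, if_false]; split_ifs <;> norm_num

theorem failure_le_expect {Q : γ → Prop} {φ : γ → ℝ} (h0 : ∀ a, 0 ≤ φ a)
    (h : ∀ a, ¬ Q a → 1 ≤ φ a) (p : QProg K γ) : p.failure U Q ≤ p.expect U φ := by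
  refine expect_mono U (fun a => ?_) p
  split_ifs with ha
  · exact h0 a
  · exact h a ha

theorem failure_bind_ret (Q : δ → Prop) (p : QProg K γ) (f : γ → δ) :
    (p.bind fun a => ret (f a)).failure U Q = p.failure U fun a => Q (f a) := by
  rw [failure, expect_bind]
  rfl

/-- Union bound for a sequential composition. -/
theorem failure_bind_le {Q : γ → Prop} {Q' : δ → Prop} {p : QProg K γ} {k : γ → QProg K δ}
    {x y : ℝ} (hp : p.failure U Q ≤ x) (hy : 0 ≤ y) (hk : ∀ a, Q a → (k a).failure U Q' ≤ y) :
    (p.bind k).failure U Q' ≤ x + y := by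
  rw [failure, expect_bind]
  have h : ∀ a, (k a).failure U Q' ≤ (open Classical in if Q a then (0 : ℝ) else 1) + y := by
    intro a
    by_cases ha : Q a
    · simpa [ha] using hk a ha
    · simp only [ha, if_false]
      linarith [failure_le_one U Q' (k a)]
  have := expect_mono U h p
  rw [expect_add, expect_const] at this
  exact this.trans (add_le_add_left hp y)

/-- A bound for an expectation from a bound that fails with small probability. -/
theorem expect_le_of_failure {φ : γ → ℝ} {Q : γ → Prop} {p : QProg K γ} {x B y : ℝ}
    (hx : 0 ≤ x) (hB : 0 ≤ B) (hQ : ∀ a, Q a → φ a ≤ x) (hall : p.AllOutputs fun a => φ a ≤ B)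
    (hp : p.failure U Q ≤ y) : p.expect U φ ≤ x + B * y := by
  have h : p.AllOutputs
      fun a => φ a ≤ x + B * (open Classical in if Q a then (0 : ℝ) else 1) := by
    refine hall.mono fun a hB => ?_
    by_cases ha : Q a
    · simpa [ha] using hQ a ha
    · simp only [ha, if_false]
      linarith
  have := expect_mono_of_allOutputs U h
  rw [expect_add, expect_const, expect_const_mul] at this
  exact this.trans (add_le_add_right (mul_le_mul_of_nonneg_left hp hB) x)

/-- Run the program `n` times; the output is the number of `true` minus the number of `false`
outcomes. -/
def score (p : QProg K Bool) : ℕ → QProg K ℤ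
  | 0 => ret 0
  | n + 1 => (score p n).bind fun z => p.bind fun b => ret (z + if b then 1 else -1)

/-- The majority vote of `n` runs. -/
def majority (p : QProg K Bool) (n : ℕ) : QProg K Bool :=
  (score p n).bind fun z => ret (decide (0 < z))

theorem queries_score_le (p : QProg K Bool) (n : ℕ) : (score p n).queries ≤ n * p.queries := by
  induction n with
  | zero => simp [score, queries]
  | succ n ih =>
    refine (queries_bind_le (q := p.queries) _ fun z => ?_).trans ?_
    · exact queries_bind_ret_le _ _
    · rw [add_mul, one_mul]; omega

theorem queries_majority_le (p : QProg K Bool) (n : ℕ) :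
    (majority p n).queries ≤ n * p.queries :=
  (queries_bind_ret_le _ _).trans (queries_score_le p n)

/-- The exponential moments of the score factor over the independent runs. -/
theorem expect_score_zpow (p : QProg K Bool) {l : ℝ} (hl : l ≠ 0) (n : ℕ) :
    (score p n).expect U (fun z => l ^ z) =
      (p.expect U fun b => if b then l else l⁻¹) ^ n := by
  induction n with
  | zero => simp [score, expect]
  | succ n ih =>
    rw [score, expect_bind]
    have h : ∀ z : ℤ, (p.bind fun b => ret (z + if b then 1 else -1)).expect U (fun z => l ^ z)
        = (p.expect U fun b => if b then l else l⁻¹) * l ^ z := by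
      intro z
      rw [expect_bind, mul_comm, ← expect_const_mul]
      congr 1
      funext b
      simp only [expect, zpow_add₀ hl]
      cases b <;> simp
    simp_rw [h]
    rw [expect_const_mul, ih, pow_succ, mul_comm]

/-- Chernoff bound: a majority vote between two options whose probabilities differ by `c` errs
with exponentially small probability. -/
theorem failure_majority_le (p : QProg K Bool) {c x : ℝ} (hc : 0 < c) (hc1 : c < 1)
    (hp : ∀ φ : Bool → ℝ, p.expect U φ = (1 + x) / 2 * φ true + (1 - x) / 2 * φ false) (n : ℕ) :
    (majority p n).failure U (fun b => (c ≤ x → b = true) ∧ (x ≤ -c → b = false))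
      ≤ (1 - c ^ 2 / 2) ^ n := by
  have hρ : 0 ≤ 1 - c ^ 2 / 2 := by nlinarith
  rw [majority, failure_bind_ret]
  by_cases h1 : c ≤ x
  · refine (failure_le_expect U (φ := fun z => ((1 + c)⁻¹) ^ z) (fun z => by positivity)
      (fun z hz => ?_) _).trans ?_
    · have hz : ¬ 0 < z := fun h => hz ⟨fun _ => by simpa using h, fun h => by linarith⟩
      rw [inv_zpow, ← zpow_neg]
      exact one_le_zpow₀ (by linarith) (by omega)
    rw [expect_score_zpow U p (by positivity), hp]
    refine pow_le_pow_left₀ ?_ ?_ n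
    · have : x ≤ 1 := by
        have := hp fun b => if b then 0 else 1
        have h0 := expect_nonneg U (φ := fun b => if b then (0 : ℝ) else 1)
          (fun b => by split_ifs <;> norm_num) p
        rw [this] at h0
        simp at h0
        linarith
      simp only [if_true, Bool.false_eq_true, if_false, inv_inv]
      have : 0 ≤ (1 + c)⁻¹ := by positivity
      nlinarith
    · simp only [if_true, Bool.false_eq_true, if_false, inv_inv]
      have h2 : (1 + c)⁻¹ ≤ 1 := inv_le_one_of_one_le₀ (by linarith)
      have h3 : (1 + c) * (1 + c)⁻¹ = 1 := mul_inv_cancel₀ (by positivity)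
      have h4 : (x - c) * ((1 + c) - (1 + c)⁻¹) ≥ 0 :=
        mul_nonneg (by linarith) (by linarith)
      nlinarith
  by_cases h2 : x ≤ -c
  · refine (failure_le_expect U (φ := fun z => (1 + c) ^ z) (fun z => by positivity)
      (fun z hz => ?_) _).trans ?_
    · have hz : 0 < z := by
        by_contra h
        exact hz ⟨fun h => by linarith, fun _ => by simpa using h⟩
      exact one_le_zpow₀ (by linarith) (by omega)
    rw [expect_score_zpow U p (by positivity), hp]
    refine pow_le_pow_left₀ ?_ ?_ n
    · have : -1 ≤ x := by
        have := hp fun b => if b then 1 else 0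
        have h0 := expect_nonneg U (φ := fun b => if b then (1 : ℝ) else 0)
          (fun b => by split_ifs <;> norm_num) p
        rw [this] at h0
        simp at h0
        linarith
      simp only [if_true, Bool.false_eq_true, if_false]
      have : 0 ≤ (1 + c)⁻¹ := by positivity
      nlinarith
    · simp only [if_true, Bool.false_eq_true, if_false]
      have h2 : (1 + c)⁻¹ ≤ 1 := inv_le_one_of_one_le₀ (by linarith)
      have h3 : (1 + c) * (1 + c)⁻¹ = 1 := mul_inv_cancel₀ (by positivity)
      have h4 : (-x - c) * ((1 + c) - (1 + c)⁻¹) ≥ 0 :=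
        mul_nonneg (by linarith) (by linarith)
      nlinarith
  · refine (failure_le_expect U (φ := fun _ => 0) (fun _ => le_rfl) (fun z hz => ?_) _).trans ?_
    · exact absurd ⟨fun h => absurd h h1, fun h => absurd h h2⟩ hz
    · rw [expect_const]
      positivity

/-- Run the programs `p i` for the indices `i` of a list and collect the outputs in a function. -/
def traverse {ι β : Type} [DecidableEq ι] [Zero β] (p : ι → QProg K β) :
    List ι → QProg K (ι → β)
  | [] => ret fun _ => 0
  | i :: l => (traverse p l).bind fun f => (p i).bind fun y => ret (Function.update f i y)

theorem queries_traverse_le {ι β : Type} [DecidableEq ι] [Zero β] {p : ι → QProg K β} {q : ℕ}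
    (hq : ∀ i, (p i).queries ≤ q) (l : List ι) : (traverse p l).queries ≤ l.length * q := by
  induction l with
  | nil => simp [traverse, queries]
  | cons i l ih =>
    refine (queries_bind_le (q := q) _ fun f => ?_).trans ?_
    · exact (queries_bind_ret_le _ _).trans (hq i)
    · rw [List.length_cons, add_mul, one_mul]; omega

theorem failure_traverse_le {ι β : Type} [DecidableEq ι] [Zero β] {p : ι → QProg K β}
    {Q : ι → β → Prop} {x : ℝ} (hx : 0 ≤ x) (hp : ∀ i, (p i).failure U (Q i) ≤ x) (l : List ι) :
    (traverse p l).failure U (fun f => ∀ i ∈ l, Q i (f i)) ≤ l.length * x := by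
  induction l with
  | nil =>
    rw [traverse, failure_ret U (by simp)]
    simp
  | cons i l ih =>
    have : ((i :: l).length : ℝ) * x = l.length * x + x := by
      rw [List.length_cons]; push_cast; ring
    rw [this]
    refine failure_bind_le U ih hx fun f hf => ?_
    rw [← add_zero x]
    refine failure_bind_le U (hp i) le_rfl fun y hy => (failure_ret U ?_).le
    intro j hj
    by_cases hji : j = i
    · subst hji; simpa using hy
    · rw [Function.update_of_ne hji]
      exact hf j ((List.mem_cons.1 hj).resolve_left hji)

end QProg

end Programs

/-! ### A circuit whose outcome probabilities are Chebyshev polynomials of a mean -/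

section Walk

variable {H : Type*} [NormedAddCommGroup H] [InnerProductSpace ℂ H]

theorem reflection_singleton_eq {e : H} (he : ‖e‖ = 1) (x : H) :
    (ℂ ∙ e).reflection x = (2 * inner ℂ e x : ℂ) • e - x := by
  rw [Submodule.reflection_apply, Submodule.starProjection_unit_singleton ℂ he, two_smul,
    two_mul, add_smul]

/-- The orbit of a unit vector `e` under an involution `A` followed by the reflection that fixes `e`
satisfies the recurrence of the Chebyshev polynomials at `a = ⟪e, A e⟫`. -/
theorem walk_recurrence {A : H →ₗ[ℂ] H} (hA : ∀ x, A (A x) = x) {e : H} (he : ‖e‖ = 1) {a : ℂ}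
    (ha : inner ℂ e (A e) = a) {x : ℕ → H} (hx0 : x 0 = e)
    (hx : ∀ k, x (k + 1) = (ℂ ∙ e).reflection (A (x k))) (k : ℕ) :
    x (k + 2) = (2 * a) • x (k + 1) - x k := by
  have hee : inner ℂ e e = (1 : ℂ) := by
    rw [inner_self_eq_norm_sq_to_K, he]; simp
  have h1 : x 1 = (2 * a) • e - A e := by
    rw [hx, hx0, reflection_singleton_eq he, ha]
  have h2 : (ℂ ∙ e).reflection (A e) = x 1 := by rw [hx, hx0]
  have h3 : (ℂ ∙ e).reflection e = e := by
    rw [reflection_singleton_eq he, hee]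
    module
  induction k with
  | zero =>
    have h4 : A (x 1) = (2 * a) • A e - e := by rw [h1, map_sub, map_smul, hA]
    rw [hx (0 + 1), zero_add, h4, map_sub, map_smul, h2, h3, hx0]
  | succ k ih =>
    rw [hx (k + 1 + 1), show k + 1 + 1 = k + 2 from rfl, ih, map_sub, map_smul, map_sub, map_smul,
      ← hx, ← hx, ← ih]

/-- By the recurrence, the overlap of the `k`-th vector of the orbit with `e` is the Chebyshev
polynomial `T_k (cos θ) = cos (k θ)`. -/
theorem inner_walk {A : H →ₗ[ℂ] H} (hA : ∀ x, A (A x) = x) {e : H} (he : ‖e‖ = 1) {θ : ℝ}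
    (ha : inner ℂ e (A e) = (Real.cos θ : ℂ)) {x : ℕ → H} (hx0 : x 0 = e)
    (hx : ∀ k, x (k + 1) = (ℂ ∙ e).reflection (A (x k))) (k : ℕ) :
    inner ℂ e (x k) = (Real.cos (k * θ) : ℂ) := by
  have hee : inner ℂ e e = (1 : ℂ) := by
    rw [inner_self_eq_norm_sq_to_K, he]; simp
  induction k using Nat.twoStepInduction with
  | zero => rw [hx0, hee]; simp
  | one =>
    rw [hx, hx0, reflection_singleton_eq he, inner_sub_right, inner_smul_right, hee, ha]
    push_cast
    ring_nf
  | more k ih1 ih2 =>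
    rw [walk_recurrence hA he ha hx0 hx, inner_sub_right, inner_smul_right, ih1, ih2]
    have h1 : ((k + 2 : ℕ) : ℝ) * θ = ((k + 1 : ℕ) : ℝ) * θ + θ := by push_cast; ring
    have h2 : (k : ℝ) * θ = ((k + 1 : ℕ) : ℝ) * θ - θ := by push_cast; ring
    have : Real.cos (((k + 2 : ℕ) : ℝ) * θ) = 2 * Real.cos θ * Real.cos (((k + 1 : ℕ) : ℝ) * θ)
        - Real.cos (k * θ) := by
      rw [h1, h2, Real.cos_add, Real.cos_sub]; ring
    rw [this]
    push_cast
    ring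

/-- The orbit stays in the span of `e` and `A e`; it is only needed that linear maps which vanish
there vanish along the orbit. -/
theorem walk_eq_zero {A : H →ₗ[ℂ] H} (hA : ∀ x, A (A x) = x) {e : H} (he : ‖e‖ = 1)
    {x : ℕ → H} (hx0 : x 0 = e)
    (hx : ∀ k, x (k + 1) = (ℂ ∙ e).reflection (A (x k)))
    {F : Type*} [AddCommGroup F] [Module ℂ F] (l : H →ₗ[ℂ] F) (h0 : l e = 0) (h1 : l (A e) = 0)
    (k : ℕ) : l (x k) = 0 := by
  induction k using Nat.twoStepInduction with
  | zero => rw [hx0, h0]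
  | one => rw [hx, hx0, reflection_singleton_eq he, map_sub, map_smul, h0, h1]; simp
  | more k ih1 ih2 => rw [walk_recurrence hA he rfl hx0 hx, map_sub, map_smul, ih1, ih2]; simp

end Walk

section Multiplication

variable {X : Type*} [MeasurableSpace X] {ν : Measure X}

theorem memLp_phase {u : X → ℂ} (hu : Measurable u) (hu1 : ∀ x, ‖u x‖ = 1) (f : Lp ℂ 2 ν) :
    MemLp (fun x => u x * f x) 2 ν :=
  (Lp.memLp f).of_le (hu.aestronglyMeasurable.mul (Lp.aestronglyMeasurable f))
    (Filter.Eventually.of_forall fun x => by rw [norm_mul, hu1, one_mul])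

/-- Multiplication of square integrable functions by a measurable function of modulus one. -/
noncomputable def phaseMul (u : X → ℂ) (hu : Measurable u) (hu1 : ∀ x, ‖u x‖ = 1) :
    Lp ℂ 2 ν ≃ₗᵢ[ℂ] Lp ℂ 2 ν where
  toFun f := (memLp_phase hu hu1 f).toLp
  invFun f := (memLp_phase (u := fun x => star (u x))
      (continuous_star.measurable.comp hu)
    (fun x => by rw [norm_star, hu1]) f).toLp
  map_add' f g := by
    ext1
    filter_upwards [(memLp_phase hu hu1 (f + g)).coeFn_toLp, (memLp_phase hu hu1 f).coeFn_toLp,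
      (memLp_phase hu hu1 g).coeFn_toLp, Lp.coeFn_add f g,
      Lp.coeFn_add (memLp_phase hu hu1 f).toLp (memLp_phase hu hu1 g).toLp] with x h1 h2 h3 h4 h5
    rw [h1, h5, Pi.add_apply, h2, h3, h4, Pi.add_apply, mul_add]
  map_smul' c f := by
    ext1
    filter_upwards [(memLp_phase hu hu1 (c • f)).coeFn_toLp, (memLp_phase hu hu1 f).coeFn_toLp,
      Lp.coeFn_smul c f, Lp.coeFn_smul c (memLp_phase hu hu1 f).toLp] with x h1 h2 h4 h5
    rw [h1, RingHom.id_apply, h5, Pi.smul_apply, h2, h4, Pi.smul_apply, smul_eq_mul, smul_eq_mul,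
      mul_left_comm]
  left_inv f := by
    ext1
    filter_upwards [(memLp_phase (u := fun x => star (u x))
      (continuous_star.measurable.comp hu)
      (fun x => by rw [norm_star, hu1]) (memLp_phase hu hu1 f).toLp).coeFn_toLp,
      (memLp_phase hu hu1 f).coeFn_toLp] with x h1 h2
    rw [h1, h2, ← mul_assoc, Complex.star_def, Complex.conj_mul', hu1]
    simp
  right_inv f := by
    ext1
    filter_upwards [(memLp_phase hu hu1 (memLp_phase (u := fun x => star (u x))
      (continuous_star.measurable.comp hu)
      (fun x => by rw [norm_star, hu1]) f).toLp).coeFn_toLp,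
      (memLp_phase (u := fun x => star (u x))
      (continuous_star.measurable.comp hu)
        (fun x => by rw [norm_star, hu1]) f).coeFn_toLp] with x h1 h2
    rw [h1, h2, ← mul_assoc, Complex.star_def, Complex.mul_conj', hu1]
    simp
  norm_map' f := by
    change ‖(memLp_phase hu hu1 f).toLp‖ = ‖f‖
    rw [Lp.norm_toLp, Lp.norm_def]
    congr 1
    refine eLpNorm_congr_norm_ae (Filter.Eventually.of_forall fun x => ?_)
    rw [norm_mul, hu1, one_mul]

theorem coeFn_phaseMul {u : X → ℂ} (hu : Measurable u) (hu1 : ∀ x, ‖u x‖ = 1) (f : Lp ℂ 2 ν) :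
    phaseMul u hu hu1 f =ᵐ[ν] fun x => u x * f x :=
  (memLp_phase hu hu1 f).coeFn_toLp

end Multiplication

section Circuit

variable {K : Type} [NormedAddCommGroup K] [InnerProductSpace ℂ K]

/-- The involution `(x₀, x₁, x₂) ↦ (V x₁, V⁻¹ x₀, x₂)`. -/
noncomputable def swapGate (V : K ≃ₗᵢ[ℂ] K) : QState K (Fin 3) ≃ₗᵢ[ℂ] QState K (Fin 3) :=
  (LinearIsometryEquiv.piLpCongrLeft 2 ℂ K (Equiv.swap (0 : Fin 3) 1)).trans
    (LinearIsometryEquiv.piLpCongrRight 2 ![V, V.symm, LinearIsometryEquiv.refl ℂ K])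

/-- The start vector `(e₀, e₀, 0) / √2` of the walk. -/
noncomputable def startVec (e₀ : K) : QState K (Fin 3) :=
  WithLp.toLp 2 ![((√2)⁻¹ : ℂ) • e₀, ((√2)⁻¹ : ℂ) • e₀, 0]

/-- The normalized difference of the start vector and the marked vector `(0, 0, e₀)`. -/
noncomputable def markVec (e₀ : K) : QState K (Fin 3) :=
  WithLp.toLp 2 ![(2⁻¹ : ℂ) • e₀, (2⁻¹ : ℂ) • e₀, (-((√2 : ℝ) : ℂ)⁻¹) • e₀]

theorem norm_startVec {e₀ : K} (he₀ : ‖e₀‖ = 1) : ‖startVec e₀‖ = 1 := by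
  rw [← sq_eq_sq₀ (norm_nonneg _) zero_le_one, PiLp.norm_sq_eq_of_L2, Fin.sum_univ_three]
  simp [startVec, norm_smul, he₀]
  norm_num

theorem norm_markVec {e₀ : K} (he₀ : ‖e₀‖ = 1) : ‖markVec e₀‖ = 1 := by
  rw [← sq_eq_sq₀ (norm_nonneg _) zero_le_one, PiLp.norm_sq_eq_of_L2, Fin.sum_univ_three]
  simp [markVec, norm_smul, he₀]
  norm_num

/-- One round of the walk: `U⁻¹ D U` for the involution `D` followed by the reflection that fixes
the start vector. -/
noncomputable def walkRound (e₀ : K) (V : K ≃ₗᵢ[ℂ] K) :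
    List ((Fin 3 → QMode) × (QState K (Fin 3) ≃ₗᵢ[ℂ] QState K (Fin 3))) :=
  [(fun _ => .forward, swapGate V), (fun _ => .inverse, (ℂ ∙ startVec e₀).reflection)]

/-- The circuit that runs `k` rounds of the walk and then exchanges the start vector with the
marked vector, so that a measurement of the workspace reveals the overlap with the start vector. -/
noncomputable def walkCircuit (e₀ : K) (he₀ : ‖e₀‖ = 1) (V : K ≃ₗᵢ[ℂ] K) (k : ℕ) :
    QCircuit K (Fin 3) where
  init := startVec e₀
  norm_init := norm_startVec he₀
  steps := (List.replicate k (walkRound e₀ V)).flatten ++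
    [(fun _ => .idle, (ℂ ∙ markVec e₀)ᗮ.reflection)]

theorem length_steps_walkCircuit (e₀ : K) (he₀ : ‖e₀‖ = 1) (V : K ≃ₗᵢ[ℂ] K) (k : ℕ) :
    (walkCircuit e₀ he₀ V k).steps.length = 2 * k + 1 := by
  simp [walkCircuit, walkRound, mul_comm]

/-- The third component of the orbit vanishes, because those of `e` and `A e` do, so that the final
reflection leaves there exactly the overlap `cos (k θ)` with the start vector. The involution `A`
swaps two components by way of `U⁻¹ V U` and its inverse; this makes its overlap with the start
vector the real part of `⟪U e₀, V U e₀⟫`. -/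
theorem prob_walkCircuit {e₀ : K} (he₀ : ‖e₀‖ = 1) (V : K ≃ₗᵢ[ℂ] K) (U : K ≃ₗᵢ[ℂ] K) {θ : ℝ}
    (hθ : (inner ℂ (U e₀) (V (U e₀))).re = Real.cos θ) (k : ℕ) :
    (walkCircuit e₀ he₀ V k).prob U 2 = Real.cos (k * θ) ^ 2 := by
  set e := startVec e₀ with he
  have hen : ‖e‖ = 1 := norm_startVec he₀
  set x : ℕ → QState K (Fin 3) := fun k => ((List.replicate k (walkRound e₀ V)).flatten).foldl
    (fun ψ st => st.2 (queryGate U st.1 ψ)) e with hxdef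
  let A : QState K (Fin 3) →ₗ[ℂ] QState K (Fin 3) :=
    (queryGate U fun _ : Fin 3 => .inverse).toLinearMap ∘ₗ (swapGate V).toLinearMap ∘ₗ
      (queryGate U fun _ : Fin 3 => .forward).toLinearMap
  have hA0 : ∀ y, A y 0 = U.symm (V (U (y 1))) := fun y => rfl
  have hA1 : ∀ y, A y 1 = U.symm (V.symm (U (y 0))) := fun y => rfl
  have hA2 : ∀ y, A y 2 = U.symm (U (y 2)) := fun y => rfl
  have hA : ∀ y, A (A y) = y := by
    intro y
    ext i
    fin_cases i
    · change A (A y) 0 = y 0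
      simp [hA0, hA1]
    · change A (A y) 1 = y 1
      simp [hA0, hA1]
    · change A (A y) 2 = y 2
      simp [hA2]
  have hx0 : x 0 = e := rfl
  have hx : ∀ k, x (k + 1) = (ℂ ∙ e).reflection (A (x k)) := by
    intro k
    simp only [hxdef]
    rw [List.replicate_succ', List.flatten_append, List.foldl_append]
    rfl
  have he0 : e 0 = ((√2)⁻¹ : ℂ) • e₀ := rfl
  have he1 : e 1 = ((√2)⁻¹ : ℂ) • e₀ := rfl
  have he2 : e 2 = 0 := rfl
  have hs2 : ((√2 : ℝ) : ℂ) * ((√2 : ℝ) : ℂ) = 2 := by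
    rw [← Complex.ofReal_mul, Real.mul_self_sqrt (by norm_num)]; norm_num
  have hs0 : ((√2 : ℝ) : ℂ) ≠ 0 := by
    rw [Complex.ofReal_ne_zero]; positivity
  have ha : inner ℂ e (A e) = (Real.cos θ : ℂ) := by
    have h1 : inner ℂ e₀ (U.symm (V (U e₀))) = inner ℂ (U e₀) (V (U e₀)) := by
      rw [← U.inner_map_map, U.apply_symm_apply]
    have h2 : inner ℂ e₀ (U.symm (V.symm (U e₀))) = star (inner ℂ (U e₀) (V (U e₀))) := by
      rw [← U.inner_map_map, U.apply_symm_apply, ← V.inner_map_map, V.apply_symm_apply]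
      exact (inner_conj_symm _ _).symm
    rw [PiLp.inner_apply, Fin.sum_univ_three, hA0, hA1, hA2, he0, he1, he2]
    simp only [map_smul, inner_smul_left, inner_smul_right, h1, h2, map_zero, inner_zero_right]
    rw [← hθ, ← RCLike.re_eq_complex_re]
    have h3 := RCLike.add_conj (inner ℂ (U e₀) (V (U e₀)))
    rw [Complex.star_def]
    simp only [map_inv₀, Complex.conj_ofReal, add_zero]
    rw [← mul_add, ← mul_add, h3]
    field_simp
    rw [sq, hs2]
    simp
  have hov := inner_walk hA hen ha hx0 hx k
  have hflag : x k 2 = 0 := by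
    refine walk_eq_zero hA hen hx0 hx (PiLp.projₗ 2 (fun _ : Fin 3 => K) 2) he2 ?_ k
    change A e 2 = 0
    rw [hA2, he2]; simp
  have hfinal : (walkCircuit e₀ he₀ V k).final U = (ℂ ∙ markVec e₀)ᗮ.reflection (x k) := by
    simp only [QCircuit.final, walkCircuit, List.foldl_append, List.foldl_cons, List.foldl_nil]
    rfl
  have hmark : inner ℂ (markVec e₀) (x k) = ((√2)⁻¹ : ℂ) * (Real.cos (k * θ) : ℂ) := by
    rw [← hov, PiLp.inner_apply, PiLp.inner_apply, Fin.sum_univ_three, Fin.sum_univ_three, hflag,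
      he0, he1, he2]
    have m0 : markVec e₀ 0 = (2⁻¹ : ℂ) • e₀ := rfl
    have m1 : markVec e₀ 1 = (2⁻¹ : ℂ) • e₀ := rfl
    rw [m0, m1]
    simp only [inner_smul_left, inner_zero_right, add_zero, map_inv₀, Complex.conj_ofReal]
    rw [← mul_add, ← mul_add, ← mul_assoc, ← mul_inv, hs2, map_ofNat]
  have hcomp : (walkCircuit e₀ he₀ V k).final U 2 = (Real.cos (k * θ) : ℂ) • e₀ := by
    rw [hfinal, Submodule.reflection_orthogonal_apply,
      reflection_singleton_eq (norm_markVec he₀), hmark, neg_sub, PiLp.sub_apply, hflag,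
      PiLp.smul_apply]
    have m2 : markVec e₀ 2 = (-((√2 : ℝ) : ℂ)⁻¹) • e₀ := rfl
    rw [m2, zero_sub, smul_smul, ← neg_smul]
    congr 1
    field_simp
    rw [sq, hs2]
  rw [QCircuit.prob, hcomp, norm_smul, he₀, mul_one, Complex.norm_real, Real.norm_eq_abs, sq_abs]

/-- The program that runs the walk and reports whether the marked outcome was seen; it has
probability `(1 + cos (2 k θ)) / 2`. -/
noncomputable def walkTest (e₀ : K) (he₀ : ‖e₀‖ = 1) (V : K ≃ₗᵢ[ℂ] K) (k : ℕ) : QProg K Bool :=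
  .meas (Fin 3) inferInstance (walkCircuit e₀ he₀ V k) fun s => .ret (decide (s = 2))

theorem queries_walkTest (e₀ : K) (he₀ : ‖e₀‖ = 1) (V : K ≃ₗᵢ[ℂ] K) (k : ℕ) :
    (walkTest e₀ he₀ V k).queries = 2 * k + 1 := by
  simp [walkTest, QProg.queries, length_steps_walkCircuit]

theorem expect_walkTest {e₀ : K} (he₀ : ‖e₀‖ = 1) (V : K ≃ₗᵢ[ℂ] K) (U : K ≃ₗᵢ[ℂ] K) {θ : ℝ}
    (hθ : (inner ℂ (U e₀) (V (U e₀))).re = Real.cos θ) (k : ℕ) (φ : Bool → ℝ) :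
    (walkTest e₀ he₀ V k).expect U φ =
      (1 + Real.cos (2 * (k * θ))) / 2 * φ true + (1 - Real.cos (2 * (k * θ))) / 2 * φ false := by
  have h1 := (walkCircuit e₀ he₀ V k).sum_prob U
  have h2 := prob_walkCircuit he₀ V U hθ k
  rw [Fin.sum_univ_three, h2] at h1
  simp only [walkTest, QProg.expect]
  rw [Fin.sum_univ_three, h2, Real.cos_two_mul]
  simp only [Fin.isValue, Fin.reduceEq, decide_false, decide_true]
  linear_combination φ false * h1

end Circuit

section Prepares

variable {d : ℕ} {ν : Measure (EuclideanSpace ℝ (Fin d))}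

/-- The phase `f + i √(1 - f²)` with real part `f`. -/
noncomputable def phaseOf (f : EuclideanSpace ℝ (Fin d) → ℝ) (r : EuclideanSpace ℝ (Fin d)) : ℂ :=
  ⟨f r, √(1 - f r ^ 2)⟩

theorem measurable_phaseOf {f : EuclideanSpace ℝ (Fin d) → ℝ} (hf : Measurable f) :
    Measurable (phaseOf f) := by
  have : phaseOf f = fun r => (f r : ℂ) + (√(1 - f r ^ 2) : ℝ) * Complex.I := by
    funext r
    apply Complex.ext <;> simp [phaseOf]
  rw [this]
  fun_prop

theorem norm_phaseOf {f : EuclideanSpace ℝ (Fin d) → ℝ} (hf : ∀ r, |f r| ≤ 1)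
    (r : EuclideanSpace ℝ (Fin d)) : ‖phaseOf f r‖ = 1 := by
  have h : 0 ≤ 1 - f r ^ 2 := by
    have := (sq_le_one_iff_abs_le_one (f r)).2 (hf r)
    linarith
  rw [Complex.norm_def, Complex.normSq_apply]
  simp only [phaseOf]
  rw [Real.mul_self_sqrt h, Real.sqrt_eq_one]
  ring

/-- A real mean as the real part of an overlap: `f` is encoded as the real part of a phase, and the
squared amplitudes of `U e₀` are the density of `μ`. -/
theorem inner_phaseMul_eq_integral [SigmaFinite ν] {μ : Measure (EuclideanSpace ℝ (Fin d))}
    [IsProbabilityMeasure μ] {U : Register ν ≃ₗᵢ[ℂ] Register ν} {e₀ : Register ν}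
    (hU : Prepares U e₀ μ) {f : EuclideanSpace ℝ (Fin d) → ℝ} (hf : Measurable f)
    (hf1 : ∀ r, |f r| ≤ 1) :
    (inner ℂ (U e₀) (phaseMul (phaseOf f) (measurable_phaseOf hf) (norm_phaseOf hf1) (U e₀))).re
      = ∫ r, f r ∂μ := by
  have h1 : inner ℂ (U e₀)
      (phaseMul (phaseOf f) (measurable_phaseOf hf) (norm_phaseOf hf1) (U e₀))
      = ∫ r, (μ.rnDeriv ν r).toReal • phaseOf f r ∂ν := by
    rw [L2.inner_def]
    refine integral_congr_ae ?_
    filter_upwards [hU.2, coeFn_phaseMul (measurable_phaseOf hf) (norm_phaseOf hf1) (U e₀)]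
      with r hr1 hr2
    rw [hr2, hr1, RCLike.inner_apply, Complex.conj_ofReal, mul_assoc, ← Complex.ofReal_mul,
      Real.mul_self_sqrt ENNReal.toReal_nonneg, Complex.real_smul, mul_comm]
  rw [h1, integral_rnDeriv_smul hU.1]
  have hint : Integrable (phaseOf f) μ :=
    Integrable.of_bound (measurable_phaseOf hf).aestronglyMeasurable 1
      (Filter.Eventually.of_forall fun r => (norm_phaseOf hf1 r).le)
  exact (Complex.reCLM.integral_comp_comm hint).symm

end Prepares

/-! ### Amplitude estimation by interval search -/

section IntervalSearch

/-- The index of the zero of `cos` that is used to bisect `[lo, lo + w]`. -/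
noncomputable def zeroIndex (lo w : ℝ) : ℕ := ⌊(lo + w / 2) / w⌋₊

/-- The multiple of the angle whose cosine is tested: it moves the midpoint of `[lo, lo + w]` close
to the zero `(m + 1/2) π` of the cosine, where `m` is `zeroIndex lo w`. -/
noncomputable def angleMultiple (lo w : ℝ) : ℕ :=
  ⌊((zeroIndex lo w : ℝ) + 1 / 2) * Real.pi / (lo + w / 2)⌋₊

theorem one_fifth_le_sin {x : ℝ} (h1 : 1 / 4 ≤ x) (h2 : x ≤ Real.pi - 1 / 4) :
    1 / 5 ≤ Real.sin x := by
  have hpi := Real.pi_gt_three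
  have h0 : 1 / 5 ≤ Real.sin (1 / 4) := by
    have := Real.sin_gt_sub_cube (x := 1 / 4) (by norm_num)
    norm_num at this ⊢
    linarith
  refine h0.trans ?_
  rcases le_total x (Real.pi / 2) with h | h
  · exact Real.sin_le_sin_of_le_of_le_pi_div_two (by linarith) h h1
  · rw [← Real.sin_pi_sub x]
    exact Real.sin_le_sin_of_le_of_le_pi_div_two (by linarith) (by linarith) (by linarith)

/-- The cosine of the chosen multiple has different signs, and is bounded away from zero, at the two
ends of the interval, where an end is a sixth of its length. -/
theorem angleMultiple_spec {lo w : ℝ} (hlo : 0 ≤ lo) (hw : 0 < w) (hlw : lo + w ≤ 1 / 5) :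
    (angleMultiple lo w : ℝ) ≤ 5 / w ∧ ∀ θ ∈ Set.Icc lo (lo + w),
      (θ ≤ lo + w / 6 → 1 / 5 ≤ (-1) ^ zeroIndex lo w * Real.cos (angleMultiple lo w * θ)) ∧
      (lo + 5 * w / 6 ≤ θ →
        (-1) ^ zeroIndex lo w * Real.cos (angleMultiple lo w * θ) ≤ -(1 / 5)) := by
  have hpi := Real.pi_gt_three
  have hpi2 := Real.pi_lt_d2
  have hpi3 := Real.pi_gt_d2
  set mid := lo + w / 2 with hmid
  have hmid0 : 0 < mid := by positivity
  set m := zeroIndex lo w with hm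
  set k := angleMultiple lo w with hk
  have hm1 : (m : ℝ) ≤ mid / w := Nat.floor_le (by positivity)
  have hm2 : mid / w < m + 1 := Nat.lt_floor_add_one _
  rw [le_div_iff₀ hw] at hm1
  rw [div_lt_iff₀ hw] at hm2
  have hk1 : (k : ℝ) ≤ (m + 1 / 2) * Real.pi / mid := Nat.floor_le (by positivity)
  have hk2 : (m + 1 / 2) * Real.pi / mid < k + 1 := Nat.lt_floor_add_one _
  rw [le_div_iff₀ hmid0] at hk1
  rw [div_lt_iff₀ hmid0] at hk2
  -- the spread of the tested angles
  have hup : ((m : ℝ) + 1 / 2) * w ≤ 3 / 2 * mid := by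
    rcases Nat.eq_zero_or_pos m with h0 | h0
    · rw [h0]; push_cast; linarith
    · have : (1 : ℝ) ≤ m := by exact_mod_cast h0
      nlinarith
  have hlow : mid / 2 ≤ ((m : ℝ) + 1 / 2) * w := by nlinarith [(Nat.cast_nonneg m : (0 : ℝ) ≤ m)]
  have hkw1 : k * w ≤ 3 / 2 * Real.pi := by
    have h1 : k * mid * w ≤ (m + 1 / 2) * Real.pi * w := by gcongr
    have h2 : ((m : ℝ) + 1 / 2) * w * Real.pi ≤ 3 / 2 * mid * Real.pi := by gcongr
    have h3 : mid * (k * w) ≤ mid * (3 / 2 * Real.pi) := by linarith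
    exact le_of_mul_le_mul_left h3 hmid0
  have hkw2 : Real.pi / 2 - w ≤ k * w := by
    have h1 : (m + 1 / 2) * Real.pi * w ≤ (k + 1) * mid * w := by gcongr
    have h2 : mid / 2 * Real.pi ≤ ((m : ℝ) + 1 / 2) * w * Real.pi := by gcongr
    have h3 : mid * (Real.pi / 2 - w) ≤ mid * (k * w) := by linarith
    exact le_of_mul_le_mul_left h3 hmid0
  refine ⟨by rw [le_div_iff₀ hw]; linarith, fun θ hθ => ?_⟩
  set x := k * θ - (m + 1 / 2) * Real.pi with hx
  have hcos : (-1) ^ m * Real.cos (k * θ) = -Real.sin x := by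
    have : k * θ = x + Real.pi / 2 + m * Real.pi := by rw [hx]; ring
    rw [this, Real.cos_add_nat_mul_pi, Real.cos_add_pi_div_two, ← mul_assoc, ← mul_pow]
    norm_num
  rw [hcos]
  have hk0 : (0 : ℝ) ≤ k := Nat.cast_nonneg _
  have hxe : x = (k * mid - (m + 1 / 2) * Real.pi) + k * (θ - mid) := by rw [hx]; ring
  obtain ⟨hθ1, hθ2⟩ := hθ
  constructor
  · intro h
    have h1 : k * (θ - mid) ≤ k * (-(w / 3)) := by gcongr; linarith
    have h2 : k * (-(w / 2)) ≤ k * (θ - mid) := by gcongr; linarith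
    have := one_fifth_le_sin (x := -x) (by linarith) (by linarith)
    rwa [Real.sin_neg] at this
  · intro h
    have h1 : k * (w / 3) ≤ k * (θ - mid) := by gcongr; linarith
    have h2 : k * (θ - mid) ≤ k * (w / 2) := by gcongr; linarith
    have := one_fifth_le_sin (x := x) (by linarith) (by linarith)
    linarith

variable {K : Type} [NormedAddCommGroup K] [InnerProductSpace ℂ K]

/-- Starting from an interval `[lo, lo + w]` known to contain an angle, remove a sixth of the
interval in each of `J` rounds, at the end where a majority vote over `n` tests of the sign of a
cosine locates the angle. The output is the left end of the last interval. -/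
noncomputable def angleSearch (test : ℕ → QProg K Bool) (n : ℕ) : ℕ → ℝ → ℝ → QProg K ℝ
  | 0, lo, _ => .ret lo
  | J + 1, lo, w => (QProg.majority (test (angleMultiple lo w)) n).bind fun b =>
      angleSearch test n J (if b = decide (Even (zeroIndex lo w)) then lo else lo + w / 6)
        (5 * w / 6)

theorem queries_angleSearch_le {test : ℕ → QProg K Bool} (htest : ∀ k, (test k).queries = 2 * k + 1)
    (n J : ℕ) {lo w : ℝ} (hlo : 0 ≤ lo) (hw : 0 < w) (hlw : lo + w ≤ 1 / 5) :
    ((angleSearch test n J lo w).queries : ℝ) ≤ 55 * n * ((6 / 5) ^ J - 1) / w := by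
  induction J generalizing lo w with
  | zero => simp [angleSearch, QProg.queries]
  | succ J ih =>
    have hk := (angleMultiple_spec hlo hw hlw).1
    set q := ⌊55 * n * ((6 / 5 : ℝ) ^ J - 1) / (5 * w / 6)⌋₊
    have hpow : (1 : ℝ) ≤ (6 / 5) ^ J := one_le_pow₀ (by norm_num)
    have hnn : 0 ≤ 55 * n * ((6 / 5 : ℝ) ^ J - 1) / (5 * w / 6) := by
      have : 0 ≤ (6 / 5 : ℝ) ^ J - 1 := by linarith
      positivity
    have h1 := QProg.queries_bind_le (q := q) (QProg.majority (test (angleMultiple lo w)) n)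
      (k := fun b => angleSearch test n J
        (if b = decide (Even (zeroIndex lo w)) then lo else lo + w / 6) (5 * w / 6)) fun b => by
        refine Nat.le_floor (ih ?_ (by positivity) ?_) <;> split_ifs <;> linarith
    have h2 := QProg.queries_majority_le (test (angleMultiple lo w)) n
    rw [htest] at h2
    have h3 : ((angleSearch test n (J + 1) lo w).queries : ℝ)
        ≤ n * (2 * angleMultiple lo w + 1) + q := by exact_mod_cast h1.trans (by gcongr)
    have h4 : (q : ℝ) ≤ _ := Nat.floor_le hnn
    have h5 : (n : ℝ) * (2 * angleMultiple lo w + 1) ≤ n * (11 / w) := by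
      gcongr
      have : 1 ≤ 1 / w := by rw [le_div_iff₀ hw]; linarith
      have e : 11 / w = 2 * (5 / w) + 1 / w := by ring
      rw [e]
      linarith
    refine h3.trans ((add_le_add h5 h4).trans (le_of_eq ?_))
    field_simp
    ring

/-- When the angle lies in neither end of the interval, the vote is undecided, but both answers keep
the angle: a round fails only if the angle lies in one end and the vote names the other. -/
theorem failure_angleSearch_le (U : K ≃ₗᵢ[ℂ] K) {test : ℕ → QProg K Bool} {θ : ℝ}
    (htest : ∀ k φ, (test k).expect U φ =
      (1 + Real.cos (k * θ)) / 2 * φ true + (1 - Real.cos (k * θ)) / 2 * φ false)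
    (n J : ℕ) {lo w : ℝ} (hlo : 0 ≤ lo) (hw : 0 < w) (hlw : lo + w ≤ 1 / 5)
    (hθ : θ ∈ Set.Icc lo (lo + w)) :
    (angleSearch test n J lo w).failure U (fun a => 0 ≤ a ∧ a ≤ θ ∧ θ ≤ a + (5 / 6) ^ J * w)
      ≤ J * (49 / 50) ^ n := by
  induction J generalizing lo w with
  | zero =>
    rw [angleSearch, QProg.failure_ret U ⟨hlo, hθ.1, by simpa using hθ.2⟩]
    simp
  | succ J ih =>
    have hmaj := QProg.failure_majority_le U (test (angleMultiple lo w)) (c := 1 / 5)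
      (by norm_num) (by norm_num) (htest _) n
    have hspec := (angleMultiple_spec hlo hw hlw).2 θ hθ
    have e : ((J + 1 : ℕ) : ℝ) * (49 / 50) ^ n = (1 - (1 / 5) ^ 2 / 2) ^ n + J * (49 / 50) ^ n := by
      push_cast; norm_num; ring
    rw [e]
    refine QProg.failure_bind_le U hmaj (by positivity) fun b hb => ?_
    have hpow : (5 / 6 : ℝ) ^ (J + 1) * w = (5 / 6) ^ J * (5 * w / 6) := by ring
    rw [hpow]
    refine ih ?_ (by positivity) ?_ ?_
    · split_ifs <;> linarith
    · split_ifs <;> linarith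
    · obtain ⟨h1, h2⟩ := hθ
      by_cases hpar : Even (zeroIndex lo w)
      · rw [hpar.neg_one_pow, one_mul] at hspec
        split_ifs with hbs
        · refine ⟨h1, ?_⟩
          by_contra! hcon
          have := hb.2 (hspec.2 (by linarith))
          simp [this, hpar] at hbs
        · refine ⟨?_, by linarith⟩
          by_contra! hcon
          have := hb.1 (hspec.1 hcon.le)
          simp [this, hpar] at hbs
      · rw [(Nat.not_even_iff_odd.1 hpar).neg_one_pow] at hspec
        split_ifs with hbs
        · refine ⟨h1, ?_⟩
          by_contra! hcon
          have := hb.1 (by linarith [hspec.2 (by linarith)])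
          simp [this, hpar] at hbs
        · refine ⟨?_, by linarith⟩
          by_contra! hcon
          have := hb.2 (by linarith [hspec.1 hcon.le])
          simp [this, hpar] at hbs

end IntervalSearch

section AmplitudeEstimation

variable {d : ℕ} {ν : Measure (EuclideanSpace ℝ (Fin d))}

/-- The damped function `1 - h / 500`. The damping keeps the angle whose cosine is its mean below
`1 / 10`, so that its integer multiples are dense enough for the interval search. -/
noncomputable def damped (h : EuclideanSpace ℝ (Fin d) → ℝ) (r : EuclideanSpace ℝ (Fin d)) : ℝ :=
  1 - h r / 500

theorem abs_damped_le {h : EuclideanSpace ℝ (Fin d) → ℝ} (h0 : ∀ r, 0 ≤ h r) (h1 : ∀ r, h r ≤ 1)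
    (r : EuclideanSpace ℝ (Fin d)) : |damped h r| ≤ 1 := by
  have := h0 r
  have := h1 r
  rw [abs_le, damped]
  constructor <;> linarith

/-- The program that estimates the mean of a function with values in `[0, 1]`. -/
noncomputable def meanEstimate (e₀ : Register ν) (he₀ : ‖e₀‖ = 1)
    (h : EuclideanSpace ℝ (Fin d) → ℝ) (hm : Measurable h) (h0 : ∀ r, 0 ≤ h r) (h1 : ∀ r, h r ≤ 1)
    (n J : ℕ) : QProg (Register ν) ℝ :=
  (angleSearch (walkTest e₀ he₀ (phaseMul (phaseOf (damped h))
    (measurable_phaseOf (measurable_const.sub (hm.div_const 500)))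
    (norm_phaseOf (abs_damped_le h0 h1)))) n J 0 (1 / 5)).bind
    fun a => .ret (500 * (1 - Real.cos (a / 2)))

theorem queries_meanEstimate_le (e₀ : Register ν) (he₀ : ‖e₀‖ = 1)
    (h : EuclideanSpace ℝ (Fin d) → ℝ) (hm : Measurable h) (h0 : ∀ r, 0 ≤ h r) (h1 : ∀ r, h r ≤ 1)
    (n J : ℕ) :
    ((meanEstimate e₀ he₀ h hm h0 h1 n J).queries : ℝ) ≤ 275 * n * (6 / 5) ^ J := by
  have hs := queries_angleSearch_le (queries_walkTest e₀ he₀ (phaseMul (phaseOf (damped h))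
    (measurable_phaseOf (measurable_const.sub (hm.div_const 500)))
    (norm_phaseOf (abs_damped_le h0 h1)))) n J le_rfl (by norm_num : (0 : ℝ) < 1 / 5) (by norm_num)
  refine (Nat.cast_le.2 (QProg.queries_bind_ret_le _ _)).trans (hs.trans ?_)
  have : (0 : ℝ) ≤ n := Nat.cast_nonneg n
  rw [div_le_iff₀ (by norm_num)]
  nlinarith

/-- The error is proportional to the square root of the mean: the angle is known up to
`(5 / 6) ^ J / 10` from below, and the mean is quadratic in the angle. -/
theorem failure_meanEstimate_le [SigmaFinite ν] {μ : Measure (EuclideanSpace ℝ (Fin d))}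
    [IsProbabilityMeasure μ] {U : Register ν ≃ₗᵢ[ℂ] Register ν} {e₀ : Register ν}
    (he₀ : ‖e₀‖ = 1) (hU : Prepares U e₀ μ)
    {h : EuclideanSpace ℝ (Fin d) → ℝ} (hm : Measurable h) (h0 : ∀ r, 0 ≤ h r) (h1 : ∀ r, h r ≤ 1)
    (n J : ℕ) :
    (meanEstimate e₀ he₀ h hm h0 h1 n J).failure U
      (fun y => |y - ∫ r, h r ∂μ| ≤ 5 * (5 / 6) ^ J * √(∫ r, h r ∂μ)) ≤ J * (49 / 50) ^ n := by
  set p := ∫ r, h r ∂μ with hp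
  have hint : Integrable h μ := Integrable.of_bound hm.aestronglyMeasurable 1
    (Filter.Eventually.of_forall fun r => by rw [Real.norm_of_nonneg (h0 r)]; exact h1 r)
  have hp0 : 0 ≤ p := integral_nonneg h0
  have hp1 : p ≤ 1 := by
    refine (integral_mono hint (integrable_const 1) h1).trans_eq (by simp)
  set θ := Real.arccos (1 - p / 500) with hθ
  have hcos : Real.cos θ = 1 - p / 500 := Real.cos_arccos (by linarith) (by linarith)
  have hθ0 : 0 ≤ θ := Real.arccos_nonneg _
  have hsq : θ ^ 2 ≤ p / 100 := by
    have hq := Real.cos_le_one_sub_mul_cos_sq (x := θ)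
      (by rw [abs_of_nonneg hθ0]; exact Real.arccos_le_pi _)
    rw [hcos] at hq
    have hpi : 1 / 5 ≤ 2 / Real.pi ^ 2 := by
      rw [div_le_div_iff₀ (by norm_num) (by positivity)]
      nlinarith [Real.pi_lt_d2, Real.pi_pos]
    nlinarith [mul_le_mul_of_nonneg_right hpi (sq_nonneg θ)]
  have hθ1 : θ ≤ 1 / 10 := by nlinarith
  have hθp : θ ≤ √p / 10 := by
    rw [le_div_iff₀ (by norm_num)]
    refine Real.le_sqrt_of_sq_le ?_
    nlinarith
  have hmean : ∫ r, damped h r ∂μ = Real.cos θ := by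
    rw [hcos]
    unfold damped
    rw [integral_sub (integrable_const _) (hint.div_const _), integral_div]
    simp [hp]
  have hinner := inner_phaseMul_eq_integral hU (f := damped h)
    (measurable_const.sub (hm.div_const 500)) (abs_damped_le h0 h1)
  rw [hmean] at hinner
  rw [meanEstimate, QProg.failure_bind_ret]
  refine (QProg.failure_mono U (fun a ha => ?_) _).trans
    (failure_angleSearch_le U (θ := 2 * θ) (fun k φ => ?_) n J le_rfl
      (by norm_num : (0 : ℝ) < 1 / 5) (by norm_num) ⟨by linarith, by linarith⟩)
  · obtain ⟨ha0, ha1, ha2⟩ := ha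
    have e : 500 * (1 - Real.cos (a / 2)) - p = 500 * (Real.cos θ - Real.cos (a / 2)) := by
      rw [hcos]; ring
    rw [e, Real.cos_sub_cos, abs_mul, abs_mul, abs_mul]
    have s1 : |Real.sin ((θ + a / 2) / 2)| ≤ √p / 10 := by
      refine Real.abs_sin_le_abs.trans ?_
      rw [abs_of_nonneg (by linarith)]
      linarith
    have s2 : |Real.sin ((θ - a / 2) / 2)| ≤ (5 / 6) ^ J / 20 := by
      refine Real.abs_sin_le_abs.trans ?_
      rw [abs_of_nonneg (by linarith)]
      linarith
    have : (0 : ℝ) ≤ (5 / 6) ^ J := by positivity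
    have hmul := mul_le_mul s1 s2 (abs_nonneg _) (by positivity)
    rw [abs_of_pos (by norm_num : (0 : ℝ) < 500), abs_neg, abs_of_pos (by norm_num : (0 : ℝ) < 2)]
    have : (√p / 10) * ((5 / 6) ^ J / 20) * 1000 = 5 * (5 / 6) ^ J * √p := by ring
    linarith
  · rw [expect_walkTest he₀ _ U hinner, show 2 * ((k : ℝ) * θ) = k * (2 * θ) by ring]

end AmplitudeEstimation

/-! ### Dyadic decomposition of a bounded function -/

section Dyadic

/-- The part of `b` at the dyadic scale `l`, rescaled to `[0, 1]`. -/
noncomputable def dyadicLevel (l : ℕ) (b : ℝ) : ℝ :=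
  if (1 / 2) ^ (l + 1) < b ∧ b ≤ (1 / 2) ^ l then b * 2 ^ l else 0

theorem dyadicLevel_nonneg (l : ℕ) (b : ℝ) : 0 ≤ dyadicLevel l b := by
  unfold dyadicLevel
  split_ifs with h
  · have : (0 : ℝ) < (1 / 2) ^ (l + 1) := by positivity
    have : 0 < b := this.trans h.1
    positivity
  · exact le_rfl

theorem dyadicLevel_le_one (l : ℕ) (b : ℝ) : dyadicLevel l b ≤ 1 := by
  unfold dyadicLevel
  split_ifs with h
  · calc b * 2 ^ l ≤ (1 / 2) ^ l * 2 ^ l := by gcongr; exact h.2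
      _ = 1 := by rw [← mul_pow]; norm_num
  · exact zero_le_one

theorem measurable_dyadicLevel (l : ℕ) : Measurable (dyadicLevel l) :=
  Measurable.ite measurableSet_Ioc (by fun_prop) measurable_const

theorem pow_mul_dyadicLevel (l : ℕ) (b : ℝ) : (1 / 2) ^ l * dyadicLevel l b
    = if (1 / 2) ^ (l + 1) < b ∧ b ≤ (1 / 2) ^ l then b else 0 := by
  unfold dyadicLevel
  split_ifs with h
  · have : (1 / 2 : ℝ) ^ l * 2 ^ l = 1 := by rw [← mul_pow]; norm_num
    linear_combination b * this
  · simp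

theorem sum_dyadicLevel (L : ℕ) {b : ℝ} (hb : b ≤ 1) :
    ∑ l ∈ Finset.range L, (1 / 2) ^ l * dyadicLevel l b = if (1 / 2) ^ L < b then b else 0 := by
  induction L with
  | zero => simp [not_lt.2 hb]
  | succ L ih =>
    rw [Finset.sum_range_succ, ih, pow_mul_dyadicLevel]
    have : (1 / 2 : ℝ) ^ (L + 1) ≤ (1 / 2) ^ L :=
      pow_le_pow_of_le_one (by norm_num) (by norm_num) (Nat.le_succ L)
    split_ifs <;> grind

theorem sq_pow_mul_dyadicLevel_le (l : ℕ) (b : ℝ) :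
    ((1 / 2) ^ l) ^ 2 * dyadicLevel l b ≤ 2 * b ^ 2 := by
  have h := pow_mul_dyadicLevel l b
  rw [sq, mul_assoc, h]
  split_ifs with hb
  · rw [pow_succ] at hb
    have : (0 : ℝ) < (1 / 2) ^ l := by positivity
    nlinarith
  · nlinarith [sq_nonneg b]

/-- The sign encoded by a Boolean. -/
def boolSign (s : Bool) : ℝ := if s then 1 else -1

/-- Reassemble a number from its (estimated) dyadic parts. -/
noncomputable def dyadicSum {L : ℕ} (F : Bool × Fin L → ℝ) : ℝ :=
  ∑ q : Bool × Fin L, boolSign q.1 * (1 / 2) ^ (q.2 : ℕ) * F q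

/-- The dyadic parts of the positive and the negative part down to the scale `2⁻ᴸ` miss only values
of modulus at most `2⁻ᴸ`. -/
theorem abs_dyadicSum_sub_le (L : ℕ) {b : ℝ} (hb : |b| ≤ 1) :
    |dyadicSum (fun q : Bool × Fin L => dyadicLevel q.2 (boolSign q.1 * b)) - b| ≤ (1 / 2) ^ L := by
  obtain ⟨h1, h2⟩ := abs_le.1 hb
  have hL : (0 : ℝ) < (1 / 2) ^ L := by positivity
  have e : dyadicSum (fun q : Bool × Fin L => dyadicLevel q.2 (boolSign q.1 * b))
      = (if (1 / 2) ^ L < b then b else 0) - (if (1 / 2) ^ L < -b then -b else 0) := by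
    rw [← sum_dyadicLevel L h2, ← sum_dyadicLevel L (b := -b) (by linarith), dyadicSum,
      Fintype.sum_prod_type, Fintype.sum_bool]
    simp only [boolSign, if_true, Bool.false_eq_true, if_false, one_mul, neg_mul]
    rw [Finset.sum_neg_distrib, ← sub_eq_add_neg,
      Fin.sum_univ_eq_sum_range (fun l => (1 / 2) ^ l * dyadicLevel l b),
      Fin.sum_univ_eq_sum_range (fun l => (1 / 2) ^ l * dyadicLevel l (-b))]
  rw [e, abs_le]
  split_ifs <;> constructor <;> linarith

/-- Mean estimation at all dyadic scales, each with an error proportional to the square root of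
the mean at that scale, gives an error proportional to the root mean square of `b`: at scale `l` the
square of `b` is comparable to `2⁻ˡ` times its absolute value. -/
theorem abs_dyadicSum_sub_integral_le {X : Type*} [MeasurableSpace X] {μ : Measure X}
    [IsProbabilityMeasure μ] {b : X → ℝ} (hb : Measurable b) (hb1 : ∀ᵐ x ∂μ, |b x| ≤ 1) {L : ℕ}
    {t : ℝ} (ht : 0 ≤ t) {F : Bool × Fin L → ℝ}
    (hF : ∀ q : Bool × Fin L, |F q - ∫ x, dyadicLevel q.2 (boolSign q.1 * b x) ∂μ|
      ≤ t * √(∫ x, dyadicLevel q.2 (boolSign q.1 * b x) ∂μ)) :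
    |dyadicSum F - ∫ x, b x ∂μ| ≤ (1 / 2) ^ L + 3 * L * t * √(∫ x, b x ^ 2 ∂μ) := by
  have hbint : Integrable b μ := Integrable.of_bound hb.aestronglyMeasurable 1 hb1
  have hb2int : Integrable (fun x => b x ^ 2) μ :=
    Integrable.of_bound (hb.pow_const 2).aestronglyMeasurable 1 (hb1.mono fun x hx => by
      rw [Real.norm_of_nonneg (sq_nonneg _)]
      exact (sq_le_one_iff_abs_le_one _).2 hx)
  have hlint : ∀ q : Bool × Fin L, Integrable (fun x => dyadicLevel q.2 (boolSign q.1 * b x)) μ :=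
    fun q => Integrable.of_bound
      ((measurable_dyadicLevel _).comp (hb.const_mul _)).aestronglyMeasurable 1
      (Filter.Eventually.of_forall fun x => by
        rw [Real.norm_of_nonneg (dyadicLevel_nonneg _ _)]
        exact dyadicLevel_le_one _ _)
  set p : Bool × Fin L → ℝ := fun q => ∫ x, dyadicLevel q.2 (boolSign q.1 * b x) ∂μ with hp
  have h1 : |dyadicSum p - ∫ x, b x ∂μ| ≤ (1 / 2) ^ L := by
    have hs : Integrable (fun x =>
        dyadicSum (fun q : Bool × Fin L => dyadicLevel q.2 (boolSign q.1 * b x))) μ :=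
      integrable_finsetSum _ fun q _ => (hlint q).const_mul _
    have e : dyadicSum p - ∫ x, b x ∂μ = ∫ x,
        (dyadicSum (fun q : Bool × Fin L => dyadicLevel q.2 (boolSign q.1 * b x)) - b x) ∂μ := by
      rw [integral_sub hs hbint]
      congr 1
      unfold dyadicSum
      rw [integral_finsetSum _ fun q _ => (hlint q).const_mul _]
      simp_rw [integral_const_mul]
      rfl
    rw [e, ← Real.norm_eq_abs]
    refine (norm_integral_le_of_norm_le_const (C := (1 / 2) ^ L)
      (hb1.mono fun x hx => abs_dyadicSum_sub_le L hx)).trans_eq (by simp)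
  have hterm : ∀ q : Bool × Fin L, |boolSign q.1 * (1 / 2) ^ (q.2 : ℕ) * (F q - p q)|
      ≤ t * √(2 * ∫ x, b x ^ 2 ∂μ) := by
    intro q
    have hsgn : |boolSign q.1| = 1 := by unfold boolSign; split_ifs <;> simp
    have hpow : (0 : ℝ) ≤ (1 / 2) ^ (q.2 : ℕ) := by positivity
    rw [abs_mul, abs_mul, hsgn, one_mul, abs_of_nonneg hpow]
    have h2 : ((1 / 2) ^ (q.2 : ℕ)) ^ 2 * p q ≤ 2 * ∫ x, b x ^ 2 ∂μ := by
      rw [hp, ← integral_const_mul, ← integral_const_mul]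
      refine integral_mono ((hlint q).const_mul _) (hb2int.const_mul 2) fun x => ?_
      refine (sq_pow_mul_dyadicLevel_le _ _).trans_eq ?_
      rw [mul_pow, ← sq_abs (boolSign q.1), hsgn, one_pow, one_mul]
    calc (1 / 2) ^ (q.2 : ℕ) * |F q - p q| ≤ (1 / 2) ^ (q.2 : ℕ) * (t * √(p q)) := by
          gcongr; exact hF q
      _ = t * √(((1 / 2) ^ (q.2 : ℕ)) ^ 2 * p q) := by
          rw [Real.sqrt_mul (by positivity), Real.sqrt_sq hpow]; ring
      _ ≤ t * √(2 * ∫ x, b x ^ 2 ∂μ) := by gcongr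
  have h2 : |dyadicSum F - dyadicSum p| ≤ 3 * L * t * √(∫ x, b x ^ 2 ∂μ) := by
    have e : dyadicSum F - dyadicSum p
        = ∑ q : Bool × Fin L, boolSign q.1 * (1 / 2) ^ (q.2 : ℕ) * (F q - p q) := by
      unfold dyadicSum
      rw [← Finset.sum_sub_distrib]
      exact Finset.sum_congr rfl fun q _ => by ring
    rw [e]
    refine (Finset.abs_sum_le_sum_abs _ _).trans ?_
    refine (Finset.sum_le_card_nsmul _ _ _ fun q _ => hterm q).trans ?_
    rw [Finset.card_univ, Fintype.card_prod, Fintype.card_bool, Fintype.card_fin, nsmul_eq_mul,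
      Real.sqrt_mul (by norm_num)]
    have : √2 ≤ 3 / 2 := by
      rw [Real.sqrt_le_left (by norm_num)]; norm_num
    push_cast
    calc 2 * (L : ℝ) * (t * (√2 * √(∫ x, b x ^ 2 ∂μ)))
        ≤ 2 * (L : ℝ) * (t * (3 / 2 * √(∫ x, b x ^ 2 ∂μ))) := by gcongr
      _ = _ := by ring
  have := abs_sub_le (dyadicSum F) (dyadicSum p) (∫ x, b x ∂μ)
  linarith

end Dyadic

/-! ### The quantum subgradient oracle -/

section Quantile

variable {d : ℕ} {ν : Measure (EuclideanSpace ℝ (Fin d))}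

/-- The indicator function of the tail event `{L(w) ≥ z}`. -/
noncomputable def tailIndicator (w : EuclideanSpace ℝ (Fin d)) (z : ℝ) :
    EuclideanSpace ℝ (Fin d) → ℝ :=
  (tailEvent w z).indicator fun _ => 1

theorem measurable_tailIndicator (w : EuclideanSpace ℝ (Fin d)) (z : ℝ) :
    Measurable (tailIndicator w z) :=
  measurable_const.indicator (measurableSet_tailEvent w z)

theorem tailIndicator_nonneg (w : EuclideanSpace ℝ (Fin d)) (z : ℝ)
    (r : EuclideanSpace ℝ (Fin d)) : 0 ≤ tailIndicator w z r :=
  Set.indicator_nonneg (fun _ _ => zero_le_one) r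

theorem tailIndicator_le_one (w : EuclideanSpace ℝ (Fin d)) (z : ℝ)
    (r : EuclideanSpace ℝ (Fin d)) : tailIndicator w z r ≤ 1 :=
  Set.indicator_le_self' (fun _ _ => zero_le_one) r

theorem integral_tailIndicator (μ : Measure (EuclideanSpace ℝ (Fin d)))
    (w : EuclideanSpace ℝ (Fin d)) (z : ℝ) :
    ∫ r, tailIndicator w z r ∂μ = μ.real (tailEvent w z) :=
  integral_indicator_one (measurableSet_tailEvent w z)

/-- A bound for the number of queries of `meanEstimate`. -/
noncomputable def meanCost (n J : ℕ) : ℕ := ⌊275 * n * (6 / 5 : ℝ) ^ J⌋₊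

/-- Bisection of `[lo, lo + len]` for a point where the tail probability is `1 - α`, with estimated
tail probabilities. -/
noncomputable def quantileSearch (e₀ : Register ν) (he₀ : ‖e₀‖ = 1) (α : ℝ)
    (w : EuclideanSpace ℝ (Fin d)) (n J : ℕ) : ℕ → ℝ → ℝ → QProg (Register ν) ℝ
  | 0, lo, _ => .ret lo
  | j + 1, lo, len => (meanEstimate e₀ he₀ (tailIndicator w (lo + len / 2))
      (measurable_tailIndicator _ _) (tailIndicator_nonneg _ _) (tailIndicator_le_one _ _)
      n J).bind fun y =>
        quantileSearch e₀ he₀ α w n J j (if 1 - α ≤ y then lo + len / 2 else lo) (len / 2)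

theorem queries_quantileSearch_le (e₀ : Register ν) (he₀ : ‖e₀‖ = 1) (α : ℝ)
    (w : EuclideanSpace ℝ (Fin d)) (n J j : ℕ) (lo len : ℝ) :
    (quantileSearch e₀ he₀ α w n J j lo len).queries ≤ j * meanCost n J := by
  induction j generalizing lo len with
  | zero => simp [quantileSearch, QProg.queries]
  | succ j ih =>
    refine (QProg.queries_bind_le (q := j * meanCost n J) _ fun y => ih _ _).trans ?_
    have := Nat.le_floor (queries_meanEstimate_le e₀ he₀ (tailIndicator w (lo + len / 2))
      (measurable_tailIndicator _ _) (tailIndicator_nonneg _ _) (tailIndicator_le_one _ _) n J)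
    rw [add_mul, one_mul, add_comm]
    exact Nat.add_le_add_left this _

/-- The two bounds on the tail probabilities at the ends of the interval persist in every round in
which the estimate is accurate. -/
theorem failure_quantileSearch_le [SigmaFinite ν] {μ : Measure (EuclideanSpace ℝ (Fin d))}
    [IsProbabilityMeasure μ] {U : Register ν ≃ₗᵢ[ℂ] Register ν} {e₀ : Register ν}
    (he₀ : ‖e₀‖ = 1) (hU : Prepares U e₀ μ) (α : ℝ) (w : EuclideanSpace ℝ (Fin d)) (n J j : ℕ)
    {lo len : ℝ} (hlo : 1 - α - 5 * (5 / 6) ^ J ≤ μ.real (tailEvent w lo))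
    (hhi : μ.real (tailEvent w (lo + len)) ≤ 1 - α + 5 * (5 / 6) ^ J) :
    (quantileSearch e₀ he₀ α w n J j lo len).failure U
      (fun a => 1 - α - 5 * (5 / 6) ^ J ≤ μ.real (tailEvent w a) ∧
        μ.real (tailEvent w (a + len / 2 ^ j)) ≤ 1 - α + 5 * (5 / 6) ^ J)
      ≤ j * (J * (49 / 50) ^ n) := by
  induction j generalizing lo len with
  | zero =>
    rw [quantileSearch, QProg.failure_ret U ⟨hlo, by simpa using hhi⟩]
    simp
  | succ j ih =>
    have hmean := failure_meanEstimate_le he₀ hU (measurable_tailIndicator w (lo + len / 2))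
      (tailIndicator_nonneg _ _) (tailIndicator_le_one _ _) n J
    rw [integral_tailIndicator] at hmean
    have e : ((j + 1 : ℕ) : ℝ) * (J * (49 / 50) ^ n)
        = J * (49 / 50) ^ n + j * (J * (49 / 50) ^ n) := by push_cast; ring
    rw [e]
    refine QProg.failure_bind_le U hmean (by positivity) fun y hy => ?_
    have hp : √(μ.real (tailEvent w (lo + len / 2))) ≤ 1 :=
      Real.sqrt_le_one.2 measureReal_le_one
    have ht : (0 : ℝ) ≤ 5 * (5 / 6) ^ J := by positivity
    obtain ⟨hy1, hy2⟩ := abs_le.1 (hy.trans (mul_le_of_le_one_right ht hp))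
    have hlen : len / 2 ^ (j + 1) = len / 2 / 2 ^ j := by rw [pow_succ']; field_simp
    rw [hlen]
    split_ifs with h
    · refine ih (by linarith) ?_
      rwa [show lo + len / 2 + len / 2 = lo + len by ring]
    · exact ih hlo (by linarith)

end Quantile

section Gradient

variable {d : ℕ} {ν : Measure (EuclideanSpace ℝ (Fin d))}

/-- The `i`-th coordinate of `-r / G`, cut off outside of the tail event `{L(w) ≥ v}`. -/
noncomputable def tailCoord (G : ℝ) (w : EuclideanSpace ℝ (Fin d)) (v : ℝ) (i : Fin d) :
    EuclideanSpace ℝ (Fin d) → ℝ :=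
  (tailEvent w v).indicator fun r => -r i / G

theorem measurable_tailCoord (G : ℝ) (w : EuclideanSpace ℝ (Fin d)) (v : ℝ) (i : Fin d) :
    Measurable (tailCoord G w v i) :=
  Measurable.indicator (by fun_prop) (measurableSet_tailEvent w v)

theorem measurable_level (G : ℝ) (w : EuclideanSpace ℝ (Fin d)) (v : ℝ) (i : Fin d)
    (s : Bool) (l : ℕ) : Measurable fun r => dyadicLevel l (boolSign s * tailCoord G w v i r) :=
  (measurable_dyadicLevel l).comp ((measurable_tailCoord G w v i).const_mul _)

/-- The program that estimates the mean of `-r` over the tail event `{L(w) ≥ v}`: the coordinates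
are split into their dyadic parts, whose means are estimated one by one. -/
noncomputable def tailMeanEstimate (e₀ : Register ν) (he₀ : ‖e₀‖ = 1) (G : ℝ)
    (w : EuclideanSpace ℝ (Fin d)) (n J L : ℕ) (v : ℝ) :
    QProg (Register ν) (EuclideanSpace ℝ (Fin d)) :=
  (QProg.traverse (fun q : Fin d × Bool × Fin L => meanEstimate e₀ he₀ _
    (measurable_level G w v q.1 q.2.1 q.2.2) (fun _ => dyadicLevel_nonneg _ _)
    (fun _ => dyadicLevel_le_one _ _) n J) Finset.univ.toList).bind
    fun F => .ret (WithLp.toLp 2 fun i => G * dyadicSum fun q => F (i, q))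

theorem queries_tailMeanEstimate_le (e₀ : Register ν) (he₀ : ‖e₀‖ = 1) (G : ℝ)
    (w : EuclideanSpace ℝ (Fin d)) (n J L : ℕ) (v : ℝ) :
    (tailMeanEstimate e₀ he₀ G w n J L v).queries ≤ d * (2 * L) * meanCost n J := by
  refine (QProg.queries_bind_ret_le _ _).trans ((QProg.queries_traverse_le (q := meanCost n J)
    (fun q => Nat.le_floor (queries_meanEstimate_le e₀ he₀ _ _ _ _ n J)) _).trans_eq ?_)
  simp

/-- Coordinatewise errors proportional to `σ i` combine to a Euclidean error that is free of the
dimension, as `∑ i, σ i ^ 2` is bounded. -/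
theorem norm_toLp_sub_le {m : EuclideanSpace ℝ (Fin d)} {y σ : Fin d → ℝ} {A B G : ℝ}
    (hA : 0 ≤ A) (hB : 0 ≤ B) (hG : 0 ≤ G) (h : ∀ i, |y i - m i| ≤ A + B * σ i)
    (hσ : ∑ i, σ i ^ 2 ≤ G ^ 2) : ‖WithLp.toLp 2 y - m‖ ≤ 2 * (√d * A + B * G) := by
  have hd : √(d : ℝ) ^ 2 = d := Real.sq_sqrt (Nat.cast_nonneg d)
  refine (sq_le_sq₀ (norm_nonneg _) (by positivity)).1 ?_
  rw [EuclideanSpace.real_norm_sq_eq]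
  calc ∑ i, (WithLp.toLp 2 y - m) i ^ 2 ≤ ∑ i, (2 * A ^ 2 + 2 * B ^ 2 * σ i ^ 2) := by
        refine Finset.sum_le_sum fun i _ => ?_
        have h1 : (WithLp.toLp 2 y - m) i ^ 2 = |y i - m i| ^ 2 := by rw [sq_abs]; rfl
        rw [h1]
        have h2 := pow_le_pow_left₀ (abs_nonneg _) (h i) 2
        nlinarith [sq_nonneg (A - B * σ i)]
    _ = 2 * d * A ^ 2 + 2 * B ^ 2 * ∑ i, σ i ^ 2 := by
        rw [Finset.sum_add_distrib, Finset.mul_sum]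
        simp
        ring
    _ ≤ 2 * d * A ^ 2 + 2 * B ^ 2 * G ^ 2 := by gcongr
    _ ≤ (2 * (√d * A + B * G)) ^ 2 := by
        have : 0 ≤ √d * A * (B * G) := by positivity
        have e : (2 * (√(d : ℝ) * A + B * G)) ^ 2
          = 4 * √(d : ℝ) ^ 2 * A ^ 2 + 8 * (√d * A * (B * G)) + 4 * (B ^ 2 * G ^ 2) := by ring
        rw [e, hd]
        have : 0 ≤ (d : ℝ) * A ^ 2 := by positivity
        have : 0 ≤ B ^ 2 * G ^ 2 := by positivity
        nlinarith

/-- The accuracy of a coordinate is proportional to its root mean square, and the mean squares add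
up to at most `G ^ 2`. Hence a number of queries per coordinate that does not depend on `d`
suffices for a Euclidean error that is, up to `√d 2⁻ᴸ`, independent of `d`. -/
theorem failure_tailMeanEstimate_le [SigmaFinite ν] {μ : Measure (EuclideanSpace ℝ (Fin d))}
    [IsProbabilityMeasure μ] {U : Register ν ≃ₗᵢ[ℂ] Register ν} {e₀ : Register ν}
    (he₀ : ‖e₀‖ = 1) (hU : Prepares U e₀ μ) {G : ℝ} (hG : 0 < G) (hμ : ∀ᵐ r ∂μ, ‖r‖ ≤ G)
    (w : EuclideanSpace ℝ (Fin d)) (n J L : ℕ) (v : ℝ) :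
    (tailMeanEstimate e₀ he₀ G w n J L v).failure U
      (fun y => ‖y - ∫ r in tailEvent w v, -r ∂μ‖
        ≤ 2 * G * (√d * (1 / 2) ^ L + 15 * L * (5 / 6) ^ J))
      ≤ d * (2 * L) * (J * (49 / 50) ^ n) := by
  have htr := QProg.failure_traverse_le U (p := fun q : Fin d × Bool × Fin L =>
    meanEstimate e₀ he₀ _ (measurable_level G w v q.1 q.2.1 q.2.2)
      (fun _ => dyadicLevel_nonneg _ _) (fun _ => dyadicLevel_le_one _ _) n J)
    (by positivity : (0 : ℝ) ≤ J * (49 / 50) ^ n)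
    (fun q => failure_meanEstimate_le he₀ hU _ _ _ n J) Finset.univ.toList
  rw [tailMeanEstimate, QProg.failure_bind_ret]
  refine (QProg.failure_mono U (fun F hF => ?_) _).trans (htr.trans_eq (by simp))
  have hF' := fun q => hF q (Finset.mem_toList.2 (Finset.mem_univ q))
  set b := tailCoord G w v with hb
  have hbm : ∀ i, Measurable (b i) := measurable_tailCoord G w v
  have hb1 : ∀ i, ∀ᵐ r ∂μ, |b i r| ≤ 1 := fun i => by
    filter_upwards [hμ] with r hr
    by_cases hmem : r ∈ tailEvent w v
    · rw [hb, tailCoord, Set.indicator_of_mem hmem, abs_div, abs_neg, abs_of_pos hG,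
        div_le_one hG]
      exact (PiLp.norm_apply_le r i).trans hr
    · simp [hb, tailCoord, hmem]
  have hbint : ∀ i, Integrable (fun r => b i r ^ 2) μ := fun i =>
    Integrable.of_bound ((hbm i).pow_const 2).aestronglyMeasurable 1 ((hb1 i).mono fun x hx => by
      rw [Real.norm_of_nonneg (sq_nonneg _)]
      exact (sq_le_one_iff_abs_le_one _).2 hx)
  have hsum : ∑ i, √(∫ r, b i r ^ 2 ∂μ) ^ 2 ≤ 1 ^ 2 := by
    simp_rw [Real.sq_sqrt (integral_nonneg fun r => sq_nonneg (b _ r))]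
    rw [← integral_finsetSum _ fun i _ => hbint i]
    refine (integral_mono_ae (integrable_finsetSum _ fun i _ => hbint i)
      (integrable_const 1) ?_).trans_eq (by simp)
    filter_upwards [hμ] with r hr
    by_cases hmem : r ∈ tailEvent w v
    · simp only [hb, tailCoord, Set.indicator_of_mem hmem, div_pow, neg_sq]
      rw [← Finset.sum_div, ← EuclideanSpace.real_norm_sq_eq, div_le_one (by positivity)]
      gcongr
    · simp [hb, tailCoord, hmem]
  have hcoord : ∀ i, (∫ r in tailEvent w v, -r ∂μ) i = G * ∫ r, b i r ∂μ := by
    intro i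
    have h1 : (∫ r in tailEvent w v, -r ∂μ) i = ∫ r in tailEvent w v, -r i ∂μ :=
      ((EuclideanSpace.proj i : EuclideanSpace ℝ (Fin d) →L[ℝ] ℝ).integral_comp_comm
        (integrable_neg_of_bound μ hμ).integrableOn).symm
    rw [h1, ← integral_const_mul, hb]
    unfold tailCoord
    simp_rw [← Set.indicator_const_mul]
    rw [integral_indicator (measurableSet_tailEvent w v)]
    congr 1
    funext r
    field_simp
  have hdy := fun i => abs_dyadicSum_sub_integral_le (hbm i) (hb1 i)
    (by positivity : (0 : ℝ) ≤ 5 * (5 / 6) ^ J) (F := fun q : Bool × Fin L => F (i, q))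
    fun q => hF' (i, q)
  refine (norm_toLp_sub_le (A := G * (1 / 2) ^ L) (B := G * (15 * L * (5 / 6) ^ J)) (G := 1)
    (by positivity) (by positivity) zero_le_one (fun i => ?_) hsum).trans_eq (by ring)
  rw [hcoord, ← mul_sub, abs_mul, abs_of_pos hG]
  refine (mul_le_mul_of_nonneg_left (hdy i) hG.le).trans_eq ?_
  ring

end Gradient

section Oracle

variable {d : ℕ} {ν : Measure (EuclideanSpace ℝ (Fin d))}

/-- Tail events of one loss are nested, so that the distance of the integrals over two of them is
controlled by the difference of their probabilities. -/
theorem norm_setIntegral_tailEvent_sub_le {μ : Measure (EuclideanSpace ℝ (Fin d))}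
    [IsProbabilityMeasure μ] {G : ℝ} (hμ : ∀ᵐ r ∂μ, ‖r‖ ≤ G) (w : EuclideanSpace ℝ (Fin d))
    (u v : ℝ) : ‖(∫ r in tailEvent w u, -r ∂μ) - ∫ r in tailEvent w v, -r ∂μ‖
      ≤ G * |μ.real (tailEvent w u) - μ.real (tailEvent w v)| := by
  wlog huv : v ≤ u generalizing u v
  · rw [norm_sub_rev, abs_sub_comm]
    exact this v u (le_of_not_ge huv)
  have hsub : tailEvent w u ⊆ tailEvent w v := fun r hr => huv.trans hr
  have hint := (integrable_neg_of_bound μ hμ).integrableOn (s := tailEvent w v)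
  have h1 := setIntegral_sdiff (measurableSet_tailEvent w u) hint hsub
  have h2 : μ.real (tailEvent w v \ tailEvent w u)
      = μ.real (tailEvent w v) - μ.real (tailEvent w u) :=
    measureReal_sdiff hsub (measurableSet_tailEvent w u)
  rw [norm_sub_rev, ← h1, abs_sub_comm, ← h2, abs_of_nonneg measureReal_nonneg]
  refine norm_setIntegral_le_of_norm_le_const_ae (measure_lt_top μ _) ?_
  filter_upwards [ae_restrict_of_ae (s := tailEvent w v \ tailEvent w u) hμ] with r hr
  simpa using hr

open Classical in
/-- Replace vectors of norm larger than `B` by zero. -/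
noncomputable def truncate (B : ℝ) (g : EuclideanSpace ℝ (Fin d)) : EuclideanSpace ℝ (Fin d) :=
  if ‖g‖ ≤ B then g else 0

/-- The quantum subgradient oracle: find a quantile of the loss by bisection, estimate the mean of
`-r` over the corresponding tail event, and normalize. The truncation bounds the error of the
unlikely runs in which some estimate fails. -/
noncomputable def gradOracle (e₀ : Register ν) (he₀ : ‖e₀‖ = 1) (α G R : ℝ) (n J j L : ℕ)
    (w : EuclideanSpace ℝ (Fin d)) : QProg (Register ν) (EuclideanSpace ℝ (Fin d)) :=
  (quantileSearch e₀ he₀ α w n J j (-(R * G)) (2 * (R * G))).bind fun v =>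
    (tailMeanEstimate e₀ he₀ G w n J L v).bind fun y =>
      .ret (truncate (G + 1) ((1 - α)⁻¹ • y))

theorem queries_gradOracle_le (e₀ : Register ν) (he₀ : ‖e₀‖ = 1) (α G R : ℝ) (n J j L : ℕ)
    (w : EuclideanSpace ℝ (Fin d)) :
    ((gradOracle e₀ he₀ α G R n J j L w).queries : ℝ)
      ≤ (j + d * (2 * L)) * (275 * n * (6 / 5) ^ J) := by
  have h : (gradOracle e₀ he₀ α G R n J j L w).queries
      ≤ j * meanCost n J + d * (2 * L) * meanCost n J :=
    (QProg.queries_bind_le (q := d * (2 * L) * meanCost n J) _ fun v =>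
      (QProg.queries_bind_ret_le _ _).trans (queries_tailMeanEstimate_le e₀ he₀ G w n J L v)).trans
      (Nat.add_le_add_right (queries_quantileSearch_le e₀ he₀ α w n J j _ _) _)
  have hc : (meanCost n J : ℝ) ≤ 275 * n * (6 / 5) ^ J := Nat.floor_le (by positivity)
  calc ((gradOracle e₀ he₀ α G R n J j L w).queries : ℝ)
      ≤ (j + d * (2 * L)) * meanCost n J := by
        rw [add_mul]; exact_mod_cast h
    _ ≤ _ := by gcongr

/-- By the bound on the density, the tail probability at the approximate quantile is close to `1 -
α`; the error of the mean is then the sum of that of the estimate and that of the tail event. -/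
theorem expect_gradOracle_le [SigmaFinite ν] {μ : Measure (EuclideanSpace ℝ (Fin d))}
    [IsProbabilityMeasure μ] {U : Register ν ≃ₗᵢ[ℂ] Register ν} {e₀ : Register ν}
    (he₀ : ‖e₀‖ = 1) (hU : Prepares U e₀ μ) {W : Set (EuclideanSpace ℝ (Fin d))} {α G R M : ℝ}
    (hα : 0 < α) (hα1 : α < 1) (hG : 0 < G) (hR : 0 < R) (hM : 0 < M) (hW : IsFeasibleSet W R)
    (hμ : RegularReturns μ W G M) {n J j L : ℕ} {ε : ℝ} (hε : 0 < ε) (hε1 : ε < 1)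
    (hacc : (1 - α)⁻¹ * (2 * G * (√d * (1 / 2) ^ L + 15 * L * (5 / 6) ^ J)
      + G * (5 * (5 / 6) ^ J + M * (2 * (R * G) / 2 ^ j))) ≤ ε / 2)
    (hfail : (2 * G + 1) * ((j + d * (2 * L)) * (J * (49 / 50) ^ n)) ≤ ε / 2)
    {w : EuclideanSpace ℝ (Fin d)} (hw : w ∈ W) :
    (gradOracle e₀ he₀ α G R n J j L w).expect U (fun g => ‖g - cvarGrad α μ w‖) ≤ ε := by
  have hα' : 0 < 1 - α := by linarith
  have hgn := norm_cvarGrad_le μ (α := α) hG.le hμ.norm_le w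
  have ht : (0 : ℝ) ≤ 5 * (5 / 6) ^ J := by positivity
  have hwG : ∀ᵐ r ∂μ, |loss w r| ≤ R * G := by
    filter_upwards [hμ.norm_le] with r hr
    exact (abs_loss_le hr).trans (mul_le_mul_of_nonneg_right (hW.norm_le w hw) hG.le)
  have hlow : μ.real (tailEvent w (-(R * G))) = 1 := by
    have : μ (tailEvent w (-(R * G))) = 1 :=
      (mem_ae_iff_prob_eq_one (measurableSet_tailEvent w _)).1
        (hwG.mono fun r hr => (abs_le.1 hr).1)
    simp [measureReal_def, this]
  have hhigh : μ.real (tailEvent w (R * G)) = 0 := by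
    have : μ (tailEvent w (R * G)) = 0 := by
      refine measure_mono_null_ae ?_ (hμ.measure_loss_eq hw (R * G))
      filter_upwards [hwG] with r hr hr2
      exact le_antisymm (abs_le.1 hr).2 hr2
    simp [measureReal_def, this]
  have hq := failure_quantileSearch_le he₀ hU α w n J j (lo := -(R * G)) (len := 2 * (R * G))
    (by rw [hlow]; linarith)
    (by rw [show -(R * G) + 2 * (R * G) = R * G by ring, hhigh]; linarith)
  have hfb : (gradOracle e₀ he₀ α G R n J j L w).failure U
      (fun g => ‖g - cvarGrad α μ w‖ ≤ ε / 2)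
      ≤ j * (J * (49 / 50) ^ n) + d * (2 * L) * (J * (49 / 50) ^ n) := by
    refine QProg.failure_bind_le U hq (by positivity) fun v hv => ?_
    rw [QProg.failure_bind_ret]
    refine (QProg.failure_mono U (fun y hy => ?_) _).trans
      (failure_tailMeanEstimate_le he₀ hU hG hμ.norm_le w n J L v)
    have hvar := measureReal_tailEvent_VaR μ hα hα1 (fun z => hμ.measure_loss_eq hw z)
    have hp : |μ.real (tailEvent w v) - (1 - α)|
        ≤ 5 * (5 / 6) ^ J + M * (2 * (R * G) / 2 ^ j) := by
      have h1 := hμ.measureReal_Ico_le hM.le hw (a := v) (b := v + 2 * (R * G) / 2 ^ j)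
        (by have : 0 ≤ 2 * (R * G) / 2 ^ j := by positivity
            linarith)
      rw [add_sub_cancel_left] at h1
      have h2 : 0 ≤ M * (2 * (R * G) / 2 ^ j) := by positivity
      rw [abs_le]
      constructor
      · linarith [hv.1]
      · linarith [hv.2]
    have hm := norm_setIntegral_tailEvent_sub_le hμ.norm_le w v (VaR α μ w)
    rw [hvar] at hm
    have hdist : ‖(1 - α)⁻¹ • y - cvarGrad α μ w‖ ≤ ε / 2 := by
      rw [cvarGrad, integral_tailLaw, hvar, ← smul_sub, norm_smul,
        Real.norm_of_nonneg (inv_nonneg.2 hα'.le)]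
      refine le_trans (mul_le_mul_of_nonneg_left ?_ (inv_nonneg.2 hα'.le)) hacc
      refine (norm_sub_le_norm_sub_add_norm_sub _ (∫ r in tailEvent w v, -r ∂μ) _).trans ?_
      exact add_le_add hy (hm.trans (mul_le_mul_of_nonneg_left hp hG.le))
    have hyn : ‖(1 - α)⁻¹ • y‖ ≤ G + 1 := by
      have := norm_sub_norm_le ((1 - α)⁻¹ • y) (cvarGrad α μ w)
      linarith
    rw [truncate, if_pos hyn]
    exact hdist
  have hbound : (gradOracle e₀ he₀ α G R n J j L w).AllOutputs
      (fun g => ‖g - cvarGrad α μ w‖ ≤ 2 * G + 1) := by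
    refine QProg.AllOutputs.bind (QProg.AllOutputs.of_forall (Q := fun _ => True)
      (fun _ => trivial) _) fun v _ => ?_
    refine QProg.AllOutputs.bind (QProg.AllOutputs.of_forall (Q := fun _ => True)
      (fun _ => trivial) _) fun y _ => ?_
    change ‖truncate (G + 1) ((1 - α)⁻¹ • y) - cvarGrad α μ w‖ ≤ 2 * G + 1
    have htr : ‖truncate (G + 1) ((1 - α)⁻¹ • y)‖ ≤ G + 1 := by
      unfold truncate
      split_ifs with h
      · exact h
      · rw [norm_zero]; linarith
    linarith [norm_sub_le (truncate (G + 1) ((1 - α)⁻¹ • y)) (cvarGrad α μ w)]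
  rw [← add_mul] at hfb
  have := QProg.expect_le_of_failure U (by positivity : 0 ≤ ε / 2)
    (by positivity : 0 ≤ 2 * G + 1) (fun g hg => hg) hbound hfb
  linarith

end Oracle

/-! ### The parameters of the quantum oracle -/

section Parameters

/-- A logarithmic number of factors `b > 1` suffices to exceed a multiple of `X`. -/
theorem exists_pow_ge {b : ℝ} (hb : 1 < b) (A : ℝ) : ∃ C : ℝ, 0 < C ∧ ∀ X : ℝ, 1 ≤ X →
    ∃ N : ℕ, (N : ℝ) ≤ C * (1 + Real.log X) ∧ 1 ≤ N ∧ A * X ≤ b ^ N := by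
  have hlb : 0 < Real.log b := Real.log_pos hb
  set B := max A 1 with hB
  have hB1 : 1 ≤ B := le_max_right _ _
  have hlB : 0 ≤ Real.log B := Real.log_nonneg hB1
  refine ⟨(Real.log B + 1) / Real.log b + 2, by positivity, fun X hX => ?_⟩
  have hlX : 0 ≤ Real.log X := Real.log_nonneg hX
  refine ⟨⌈Real.log (B * X) / Real.log b⌉₊ + 1, ?_, by omega, ?_⟩
  · have h1 : 0 ≤ Real.log (B * X) / Real.log b :=
      div_nonneg (Real.log_nonneg (by nlinarith)) hlb.le
    have h2 := Nat.ceil_lt_add_one h1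
    have h3 : Real.log (B * X) / Real.log b
        ≤ (Real.log B + 1) / Real.log b * (1 + Real.log X) := by
      rw [Real.log_mul (by positivity) (by positivity), div_mul_eq_mul_div]
      refine div_le_div_of_nonneg_right ?_ hlb.le
      nlinarith
    push_cast
    nlinarith
  · have h1 : Real.log (B * X) ≤ (⌈Real.log (B * X) / Real.log b⌉₊ + 1 : ℕ) * Real.log b := by
      rw [← div_le_iff₀ hlb]
      push_cast
      linarith [Nat.le_ceil (Real.log (B * X) / Real.log b)]
    rw [← Real.log_pow] at h1
    have h2 := (Real.log_le_log_iff (by positivity) (by positivity)).1 h1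
    exact (mul_le_mul_of_nonneg_right (le_max_left _ _) (by linarith)).trans h2

/-- The error of the oracle is at most `ε / 2` when each of its three parts is at most `c ε`. -/
theorem oracle_error_le {α G R M c ε D : ℝ} {J j L : ℕ} (hα1 : α < 1) (hG : 0 < G) (hε : 0 < ε)
    (hc : (1 - α)⁻¹ * G * (3 * c) ≤ 1 / 2) (hL1 : (1 : ℝ) ≤ L)
    (h₁ : 2 * (D * (1 / 2) ^ L) ≤ c * ε) (h₂ : 35 * L * (5 / 6 : ℝ) ^ J ≤ c * ε)
    (h₃ : M * (2 * (R * G) / 2 ^ j) ≤ c * ε) :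
    (1 - α)⁻¹ * (2 * G * (D * (1 / 2) ^ L + 15 * L * (5 / 6) ^ J)
      + G * (5 * (5 / 6) ^ J + M * (2 * (R * G) / 2 ^ j))) ≤ ε / 2 := by
  have hα' : 0 ≤ (1 - α)⁻¹ * G := mul_nonneg (inv_nonneg.2 (by linarith)) hG.le
  have h4 : 5 * (5 / 6 : ℝ) ^ J + 30 * L * (5 / 6) ^ J ≤ 35 * L * (5 / 6 : ℝ) ^ J := by
    have : (0 : ℝ) ≤ (5 / 6) ^ J := by positivity
    nlinarith
  calc (1 - α)⁻¹ * (2 * G * (D * (1 / 2) ^ L + 15 * L * (5 / 6) ^ J)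
        + G * (5 * (5 / 6) ^ J + M * (2 * (R * G) / 2 ^ j)))
      = (1 - α)⁻¹ * G * (2 * (D * (1 / 2) ^ L)
        + (5 * (5 / 6) ^ J + 30 * L * (5 / 6) ^ J) + M * (2 * (R * G) / 2 ^ j)) := by ring
    _ ≤ (1 - α)⁻¹ * G * (3 * c * ε) := mul_le_mul_of_nonneg_left (by linarith) hα'
    _ = (1 - α)⁻¹ * G * (3 * c) * ε := by ring
    _ ≤ 1 / 2 * ε := mul_le_mul_of_nonneg_right hc hε.le
    _ = ε / 2 := by ring

theorem sqrt_mul_half_pow_le {d c ε : ℝ} {L : ℕ} (hd : 1 ≤ d) (hc : 0 < c) (hε : 0 < ε)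
    (hL : 2 / c * (d / ε) ≤ 2 ^ L) : 2 * (√d * (1 / 2) ^ L) ≤ c * ε := by
  have hsd : √d ≤ d := Real.sqrt_le_iff.2 ⟨by linarith, by nlinarith⟩
  rw [one_div, inv_pow, ← div_eq_mul_inv, mul_div_assoc', div_le_iff₀ (by positivity)]
  calc 2 * √d ≤ 2 * d := by linarith
    _ = c * ε * (2 / c * (d / ε)) := by field_simp
    _ ≤ c * ε * 2 ^ L := mul_le_mul_of_nonneg_left hL (by positivity)

theorem mul_div_two_pow_le {B c ε X : ℝ} {j : ℕ} (hc : 0 < c) (hε : 0 < ε) (hX : 1 / ε ≤ X)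
    (hj : B / c * X ≤ 2 ^ j) : B / 2 ^ j ≤ c * ε := by
  rw [div_le_iff₀ (by positivity)]
  rcases le_or_gt B 0 with h | h
  · exact h.trans (by positivity)
  calc B = c * ε * (B / c * (1 / ε)) := by field_simp
    _ ≤ c * ε * (B / c * X) :=
      mul_le_mul_of_nonneg_left (mul_le_mul_of_nonneg_left hX (by positivity)) (by positivity)
    _ ≤ c * ε * 2 ^ j := mul_le_mul_of_nonneg_left hj (by positivity)

theorem nat_le_five_mul_pow (J : ℕ) : (J : ℝ) ≤ 5 * (6 / 5 : ℝ) ^ J := by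
  have h := one_add_mul_le_pow (by norm_num : (-2 : ℝ) ≤ 1 / 5) J
  norm_num at h ⊢
  linarith

/-- The parameters of the oracle for accuracy `ε`: all of them are logarithmic in `d / ε`, so that
`(6 / 5) ^ J`, which is of the order `L / ε`, determines the cost. -/
theorem exists_oracle_parameters {α G R M : ℝ} (hα1 : α < 1) (hG : 0 < G) :
    ∃ C : ℝ, 0 < C ∧ ∀ (d : ℕ) (ε : ℝ), 0 < d → 0 < ε → ε < 1 → ∃ n J j L : ℕ,
      (1 - α)⁻¹ * (2 * G * (√d * (1 / 2) ^ L + 15 * L * (5 / 6) ^ J)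
        + G * (5 * (5 / 6) ^ J + M * (2 * (R * G) / 2 ^ j))) ≤ ε / 2 ∧
      (2 * G + 1) * ((j + d * (2 * L)) * (J * (49 / 50) ^ n)) ≤ ε / 2 ∧
      (j + d * (2 * L)) * (275 * n * (6 / 5) ^ J) ≤
        C * (d / ε) * (1 + Real.log (d / ε)) ^ 3 := by
  have hα' : 0 < 1 - α := by linarith
  -- each of the three parts of the error will be at most `c ε`
  obtain ⟨c, hc0, hc1, hc2⟩ : ∃ c : ℝ, 0 < c ∧ c ≤ 1 ∧ (1 - α)⁻¹ * G * (3 * c) ≤ 1 / 2 := by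
    refine ⟨min 1 ((1 - α) / (6 * G)), lt_min one_pos (by positivity), min_le_left _ _, ?_⟩
    calc (1 - α)⁻¹ * G * (3 * min 1 ((1 - α) / (6 * G)))
        ≤ (1 - α)⁻¹ * G * (3 * ((1 - α) / (6 * G))) :=
          mul_le_mul_of_nonneg_left (mul_le_mul_of_nonneg_left (min_le_right _ _) (by norm_num))
            (by positivity)
      _ = 1 / 2 := by field_simp; norm_num
  obtain ⟨C₁, hC₁, h₁⟩ := exists_pow_ge (b := 2) (by norm_num) (2 / c)
  obtain ⟨C₂, hC₂, h₂⟩ := exists_pow_ge (b := 2) (by norm_num) (M * (2 * (R * G)) / c)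
  obtain ⟨C₄, hC₄⟩ : ∃ C₄, C₄ = C₂ + 2 * C₁ := ⟨_, rfl⟩
  obtain ⟨C₅, hC₅⟩ : ∃ C₅, C₅ = 35 * C₁ / c := ⟨_, rfl⟩
  have hC₄0 : 0 < C₄ := by rw [hC₄]; positivity
  have hC₅0 : 0 < C₅ := by rw [hC₅]; positivity
  obtain ⟨C₃, hC₃, h₃⟩ := exists_pow_ge (b := 50 / 49) (by norm_num)
    (2 * (2 * G + 1) * (C₄ * (6 * C₅)))
  refine ⟨C₄ * (275 * (5 * C₃) * (6 / 5 * C₅)), by positivity, fun d ε hd hε hε1 => ?_⟩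
  have hd1 : (1 : ℝ) ≤ d := by exact_mod_cast hd
  obtain ⟨X, hX⟩ : ∃ X, X = (d : ℝ) / ε := ⟨_, rfl⟩
  rw [← hX]
  have hXd : (d : ℝ) ≤ X := by
    rw [hX, le_div_iff₀ hε]; nlinarith
  have hX1 : 1 ≤ X := hd1.trans hXd
  have hXε : 1 / ε ≤ X := by rw [hX]; exact div_le_div_of_nonneg_right hd1 hε.le
  obtain ⟨l, hl⟩ : ∃ l, l = 1 + Real.log X := ⟨_, rfl⟩
  have hl1 : 1 ≤ l := by have := Real.log_nonneg hX1; linarith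
  have hlX : l ≤ X := by have := Real.log_le_sub_one_of_pos (by linarith : 0 < X); linarith
  have hl0 : 0 ≤ l := by linarith
  have hX0 : 0 ≤ X := by linarith
  have hlε : 0 ≤ l / ε := by positivity
  obtain ⟨L, hLl, hL1, hLX⟩ := h₁ X hX1
  obtain ⟨j, hjl, -, hjX⟩ := h₂ X hX1
  obtain ⟨n, hnl, -, hnX⟩ := h₃ (X ^ 5) (one_le_pow₀ hX1)
  have hnl' : (n : ℝ) ≤ 5 * C₃ * l := by
    rw [Real.log_pow] at hnl
    push_cast at hnl
    nlinarith
  rw [← hl] at hLl hjl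
  have hL1' : (1 : ℝ) ≤ L := by exact_mod_cast hL1
  obtain ⟨Y, hY⟩ : ∃ Y, Y = 35 * L / (c * ε) := ⟨_, rfl⟩
  have hY1 : 1 ≤ Y := by
    rw [hY, le_div_iff₀ (by positivity)]
    nlinarith
  have hYl : Y ≤ C₅ * (l / ε) := by
    calc Y = 35 / (c * ε) * L := by rw [hY]; ring
      _ ≤ 35 / (c * ε) * (C₁ * l) := mul_le_mul_of_nonneg_left hLl (by positivity)
      _ = _ := by rw [hC₅]; field_simp
  obtain ⟨J', hJ1, hJ2⟩ := exists_nat_pow_near hY1 (by norm_num : (1 : ℝ) < 6 / 5)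
  obtain ⟨J, hJ⟩ : ∃ J, J = J' + 1 := ⟨_, rfl⟩
  rw [← hJ] at hJ2
  have hJup : (6 / 5 : ℝ) ^ J ≤ 6 / 5 * (C₅ * (l / ε)) := by rw [hJ, pow_succ]; linarith
  have hjL : (j + d * (2 * L) : ℝ) ≤ C₄ * (d * l) := by
    have h1 : (j : ℝ) ≤ C₂ * (d * l) :=
      hjl.trans (mul_le_mul_of_nonneg_left (le_mul_of_one_le_left hl0 hd1) hC₂.le)
    have h2 : (d : ℝ) * (2 * L) ≤ d * (2 * (C₁ * l)) :=
      mul_le_mul_of_nonneg_left (by linarith) (by linarith)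
    rw [hC₄]
    linarith
  have hlεX : l / ε ≤ X * X := by
    rw [div_eq_mul_one_div]
    exact mul_le_mul hlX hXε (by positivity) hX0
  refine ⟨n, J, j, L, ?_, ?_, ?_⟩
  · refine oracle_error_le hα1 hG hε hc2 hL1' (sqrt_mul_half_pow_le hd1 hc0 hε (hX ▸ hLX)) ?_ ?_
    · rw [show (5 / 6 : ℝ) ^ J = ((6 / 5) ^ J)⁻¹ by rw [← inv_pow]; norm_num, ← div_eq_mul_inv,
        div_le_iff₀ (by positivity)]
      calc (35 : ℝ) * L = c * ε * Y := by rw [hY]; field_simp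
        _ ≤ c * ε * (6 / 5) ^ J := mul_le_mul_of_nonneg_left hJ2.le (by positivity)
    · rw [mul_div_assoc']
      exact mul_div_two_pow_le hc0 hε hXε hjX
  · have hJY : (J : ℝ) ≤ 6 * C₅ * (X * X) := by
      have h1 := nat_le_five_mul_pow J
      have h2 := mul_le_mul_of_nonneg_left hlεX hC₅0.le
      linarith
    have hjLX : (j + d * (2 * L) : ℝ) ≤ C₄ * (X * X) :=
      hjL.trans (mul_le_mul_of_nonneg_left (mul_le_mul hXd hlX hl0 hX0) hC₄0.le)
    rw [show (49 / 50 : ℝ) ^ n = ((50 / 49) ^ n)⁻¹ by rw [← inv_pow]; norm_num, ← mul_assoc,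
      ← mul_assoc, ← div_eq_mul_inv, div_le_iff₀ (by positivity)]
    calc (2 * G + 1) * (j + d * (2 * L)) * J
        = (2 * G + 1) * ((j + d * (2 * L)) * J) := by ring
      _ ≤ (2 * G + 1) * (C₄ * (X * X) * (6 * C₅ * (X * X))) :=
        mul_le_mul_of_nonneg_left (mul_le_mul hjLX hJY (by positivity) (by positivity))
          (by positivity)
      _ = ε / 2 * (2 * (2 * G + 1) * (C₄ * (6 * C₅)) * (X ^ 4 * (1 / ε))) := by field_simp
      _ ≤ ε / 2 * (2 * (2 * G + 1) * (C₄ * (6 * C₅)) * (X ^ 4 * X)) :=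
        mul_le_mul_of_nonneg_left (mul_le_mul_of_nonneg_left
          (mul_le_mul_of_nonneg_left hXε (by positivity)) (by positivity)) (by positivity)
      _ = ε / 2 * (2 * (2 * G + 1) * (C₄ * (6 * C₅)) * X ^ 5) := by ring
      _ ≤ ε / 2 * (50 / 49) ^ n := mul_le_mul_of_nonneg_left hnX (by positivity)
  · rw [← hl]
    have h1 : 275 * n * (6 / 5 : ℝ) ^ J ≤ 275 * (5 * C₃ * l) * (6 / 5 * (C₅ * (l / ε))) :=
      mul_le_mul (by linarith) hJup (by positivity) (by positivity)
    calc (j + d * (2 * L) : ℝ) * (275 * n * (6 / 5) ^ J)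
        ≤ (C₄ * (d * l)) * (275 * (5 * C₃ * l) * (6 / 5 * (C₅ * (l / ε)))) :=
          mul_le_mul hjL h1 (by positivity) (by positivity)
      _ = _ := by rw [hX]; ring

end Parameters

/-! ### Subgradient descent with quantum oracles -/

section QuantumSGD

variable {d : ℕ} {K : Type} [NormedAddCommGroup K] [InnerProductSpace ℂ K]
  {W : Set (EuclideanSpace ℝ (Fin d))} {R : ℝ} {η : ℕ → ℝ} {w₀ : EuclideanSpace ℝ (Fin d)}
  {oracle : EuclideanSpace ℝ (Fin d) → QProg K (EuclideanSpace ℝ (Fin d))}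

theorem queries_quantumSGD_le {q : ℕ} (h : ∀ w, (oracle w).queries ≤ q) (T : ℕ) :
    (quantumSGD W η w₀ oracle T).queries ≤ T * q := by
  induction T with
  | zero => simp [quantumSGD, QProg.queries]
  | succ T ih =>
    rw [quantumSGD, Nat.succ_mul]
    exact (QProg.queries_bind_le _ fun w => (QProg.queries_bind_ret_le _ _).trans (h w)).trans
      (Nat.add_le_add_right ih _)

theorem allOutputs_quantumSGD (hW : IsFeasibleSet W R) (hw₀ : w₀ ∈ W) (t : ℕ) :
    (quantumSGD W η w₀ oracle t).AllOutputs (· ∈ W) := by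
  cases t with
  | zero => exact hw₀
  | succ t =>
    exact .bind (.of_forall (Q := fun _ => True) (fun _ => trivial) _) fun w _ =>
      .bind (.of_forall (Q := fun _ => True) (fun _ => trivial) _) fun g _ =>
        sgdStep_mem hW (η t) w g

/-- Convergence of subgradient descent with a quantum oracle. The potential is the expected squared
distance from `wstar`; expectations are finite sums over the measurement outcomes. -/
theorem quantumSGD_rate {U : K ≃ₗᵢ[ℂ] K} {μ : Measure (EuclideanSpace ℝ (Fin d))}
    [IsProbabilityMeasure μ] {α G c₁ c₂ : ℝ} (hG : 0 < G) (hR : 0 < R) (hc₁ : 0 < c₁) (hα : 0 < α)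
    (hα1 : α < 1) (hW : IsFeasibleSet W R) (hμ : ∀ᵐ r ∂μ, ‖r‖ ≤ G)
    (hatom : ∀ w ∈ W, ∀ z : ℝ, μ {r | loss w r = z} = 0) (hw₀ : w₀ ∈ W)
    {wstar : EuclideanSpace ℝ (Fin d)} (hstar : wstar ∈ W) (hη : StepSize c₁ c₂ η)
    {T : ℕ} {ε : ℝ} (hT : 0 < T) (hε : 0 ≤ ε)
    (hacc : ∀ w ∈ W, (oracle w).expect U (fun g => ‖g - cvarGrad α μ w‖) ≤ ε) :
    ∃ t < T, (quantumSGD W η w₀ oracle t).expect U (fun w => CVaR α μ w - CVaR α μ wstar)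
      ≤ sgdConst G R c₁ c₂ * (1 / √(T : ℝ) + ε) := by
  have hall : ∀ t, (quantumSGD W η w₀ oracle t).AllOutputs (· ∈ W) :=
    allOutputs_quantumSGD hW hw₀
  refine exists_gap_le hR hc₁ hη hT hε
    (D := fun t => (quantumSGD W η w₀ oracle t).expect U fun w => ‖w - wstar‖ ^ 2)
    (N := fun t => η t * ε)
    (fun t => QProg.expect_nonneg U (fun w => sq_nonneg _) _) (fun t => ?_) (fun t _ => ?_)
    fun t _ => le_add_of_nonneg_right (by positivity)
  · rw [← QProg.expect_const U (4 * R ^ 2) (quantumSGD W η w₀ oracle t)]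
    refine QProg.expect_mono_of_allOutputs U ((hall t).mono fun w hw => ?_)
    have := norm_sub_le_of_mem hW hw hstar
    nlinarith [norm_nonneg (w - wstar)]
  · have hηt := (hη.pos hc₁ t).le
    have hpoint : (quantumSGD W η w₀ oracle t).AllOutputs fun w =>
        ((oracle w).bind fun g => .ret (sgdStep W (η t) w g)).expect U
          (fun v => ‖v - wstar‖ ^ 2) ≤
        ‖w - wstar‖ ^ 2 + (-(2 * η t) * (CVaR α μ w - CVaR α μ wstar)
          + (η t ^ 2 * G ^ 2 + 4 * R * (η t * ε))) := by
      refine (hall t).mono fun w hw => ?_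
      rw [QProg.expect_bind]
      have h1 : ∀ g, ‖sgdStep W (η t) w g - wstar‖ ^ 2 ≤
          (‖w - wstar‖ ^ 2 + (-(2 * η t) * (CVaR α μ w - CVaR α μ wstar) + η t ^ 2 * G ^ 2))
          + 4 * R * η t * ‖g - cvarGrad α μ w‖ := by
        intro g
        have h2 := norm_sgdStep_sub_sq_le hW hw hstar (gt := g)
          (norm_cvarGrad_le μ (α := α) hG.le hμ w) hηt
        have h3 := cvar_sub_le μ hα hα1 hμ (hatom wstar hstar) (hatom w hw)
        have h4 := mul_le_mul_of_nonneg_left h3 (by linarith : 0 ≤ 2 * η t)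
        have h5 := mul_le_mul_of_nonneg_left
          (min_le_left (η t * ‖g - cvarGrad α μ w‖) (2 * R)) (by linarith : 0 ≤ 4 * R)
        linarith
      have h6 := QProg.expect_mono U h1 (oracle w)
      rw [QProg.expect_add, QProg.expect_const, QProg.expect_const_mul] at h6
      have h7 := mul_le_mul_of_nonneg_left (hacc w hw) (by positivity : 0 ≤ 4 * R * η t)
      refine h6.trans ?_
      linarith
    have h := QProg.expect_mono_of_allOutputs U hpoint
    rw [QProg.expect_add, QProg.expect_add, QProg.expect_const_mul, QProg.expect_const] at h
    rw [quantumSGD, QProg.expect_bind]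
    linarith

end QuantumSGD

/-- Query complexity of the quantum algorithm. -/
theorem quantum_complexity {α G R M c₁ c₂ : ℝ} (hα : 0 < α) (hα1 : α < 1) (hG : 0 < G)
    (hR : 0 < R) (hM : 0 < M) (hc₁ : 0 < c₁) : ∃ C : ℝ, 0 < C ∧
    ∀ (d : ℕ) (W : Set (EuclideanSpace ℝ (Fin d))) (w₀ : EuclideanSpace ℝ (Fin d))
      (η : ℕ → ℝ) (ε : ℝ),
      0 < d → IsFeasibleSet W R → w₀ ∈ W → StepSize c₁ c₂ η → 0 < ε → ε < 1 →
      ∀ (ν : Measure (EuclideanSpace ℝ (Fin d))) [SigmaFinite ν] (e₀ : Register ν), ‖e₀‖ = 1 →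
        ∃ (T : ℕ) (oracle : EuclideanSpace ℝ (Fin d) →
            QProg (Register ν) (EuclideanSpace ℝ (Fin d))),
          ((quantumSGD W η w₀ oracle T).queries : ℝ) ≤
            C * (d / ε ^ 3) * (1 + Real.log (d / ε)) ^ 3 ∧
          ∀ (μ : Measure (EuclideanSpace ℝ (Fin d))) [IsProbabilityMeasure μ],
            RegularReturns μ W G M →
            ∀ U : Register ν ≃ₗᵢ[ℂ] Register ν, Prepares U e₀ μ →
              (∀ w ∈ W, (oracle w).expect U (fun g => ‖g - cvarGrad α μ w‖) ≤ ε) ∧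
              ∀ wstar ∈ W, ∃ t < T, (quantumSGD W η w₀ oracle t).expect U
                (fun w => CVaR α μ w - CVaR α μ wstar) ≤ ε := by
  obtain ⟨K, hK⟩ : ∃ K, K = sgdConst G R c₁ c₂ := ⟨_, rfl⟩
  have hK1 : 1 ≤ K := hK ▸ one_le_sgdConst hR hc₁
  obtain ⟨C, hC, hpar⟩ := exists_oracle_parameters (R := R) (M := M) hα1 hG
  have hlK : 0 ≤ Real.log (2 * K) := Real.log_nonneg (by linarith)
  refine ⟨((2 * K) ^ 2 + 1) * (C * (2 * K) * (1 + Real.log (2 * K)) ^ 3), by positivity,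
    fun d W w₀ η ε hd hW hw₀ hη hε hε1 ν _ e₀ he₀ => ?_⟩
  obtain ⟨T, hT, hTε, hTle⟩ := exists_steps (G := G) (R := R) (c₁ := c₁) (c₂ := c₂) hR hc₁ hε hε1
  rw [← hK] at hTε hTle
  have hε' : 0 < ε / (2 * K) := by positivity
  have hsmall : ε / (2 * K) ≤ ε := div_le_self hε.le (by linarith)
  obtain ⟨n, J, j, L, hacc, hfail, hcost⟩ := hpar d (ε / (2 * K)) hd hε' (by linarith)
  refine ⟨T, gradOracle e₀ he₀ α G R n J j L, ?_, ?_⟩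
  · have hd1 : (1 : ℝ) ≤ d := by exact_mod_cast hd
    have hX1 : 1 ≤ (d : ℝ) / ε := by
      rw [le_div_iff₀ hε]; linarith
    have hlX := Real.log_nonneg hX1
    have hXK : (d : ℝ) / (ε / (2 * K)) = 2 * K * (d / ε) := by field_simp
    have hlog : 1 + Real.log (d / (ε / (2 * K)))
        ≤ (1 + Real.log (2 * K)) * (1 + Real.log (d / ε)) := by
      rw [hXK, Real.log_mul (by positivity) (by positivity)]
      nlinarith
    have hlog0 : 0 ≤ 1 + Real.log (d / (ε / (2 * K))) := by
      rw [hXK, Real.log_mul (by positivity) (by positivity)]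
      linarith
    have hq : ∀ w, (gradOracle e₀ he₀ α G R n J j L w).queries
        ≤ ⌊C * (2 * K * (d / ε)) * ((1 + Real.log (2 * K)) * (1 + Real.log (d / ε))) ^ 3⌋₊ :=
      fun w => Nat.le_floor <| (queries_gradOracle_le e₀ he₀ α G R n J j L w).trans <|
        hcost.trans <| by
          rw [← hXK]
          exact mul_le_mul_of_nonneg_left (pow_le_pow_left₀ hlog0 hlog 3) (by positivity)
    have h1 := queries_quantumSGD_le (W := W) (η := η) (w₀ := w₀) hq T
    calc ((quantumSGD W η w₀ (gradOracle e₀ he₀ α G R n J j L) T).queries : ℝ)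
        ≤ T * ⌊C * (2 * K * (d / ε)) * ((1 + Real.log (2 * K)) * (1 + Real.log (d / ε))) ^ 3⌋₊ := by
          exact_mod_cast h1
      _ ≤ (((2 * K) ^ 2 + 1) / ε ^ 2)
          * (C * (2 * K * (d / ε)) * ((1 + Real.log (2 * K)) * (1 + Real.log (d / ε))) ^ 3) :=
        mul_le_mul hTle (Nat.floor_le (by positivity)) (by positivity) (by positivity)
      _ = _ := by field_simp
  · intro μ _ hμ U hU
    have hest := fun w (hw : w ∈ W) => expect_gradOracle_le he₀ hU hα hα1 hG hR hM hW hμ hε'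
      (by linarith) hacc hfail hw
    refine ⟨fun w hw => (hest w hw).trans hsmall, fun wstar hstar => ?_⟩
    obtain ⟨t, ht, h⟩ := quantumSGD_rate (c₂ := c₂) hG hR hc₁ hα hα1 hW hμ.norm_le
      (fun w hw z => hμ.measure_loss_eq hw z) hw₀ hstar hη hT hε'.le hest
    exact ⟨t, ht, h.trans (hK ▸ hTε)⟩

theorem proposition3 :
    -- convergence rate of projected stochastic subgradient descent with inexact oracles
    (∀ G R c₁ c₂ : ℝ, 0 < G → 0 < R → 0 < c₁ → 0 < c₂ → ∃ C : ℝ, 0 < C ∧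
      ∀ (d : ℕ) (α : ℝ), 0 < α → α < 1 →
      ∀ (μ : Measure (EuclideanSpace ℝ (Fin d))) [IsProbabilityMeasure μ]
        (W : Set (EuclideanSpace ℝ (Fin d))),
        IsFeasibleSet W R → (∀ᵐ r ∂μ, ‖r‖ ≤ G) →
        (∀ w ∈ W, ∀ z : ℝ, μ {r | loss w r = z} = 0) →
      ∀ wstar ∈ W, IsMinOn (CVaR α μ) W wstar →
      ∀ (η : ℕ → ℝ), StepSize c₁ c₂ η →
      ∀ (Ω : Type u) [MeasurableSpace Ω] (P : Measure Ω) [IsProbabilityMeasure P]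
        (w gt : ℕ → Ω → EuclideanSpace ℝ (Fin d)) (T : ℕ) (ε : ℝ),
        0 < T → 0 ≤ ε →
        Measurable (w 0) → (∀ ω, w 0 ω ∈ W) → (∀ t, Measurable (gt t)) →
        (∀ t ω, w (t + 1) ω = sgdStep W (η t) (w t ω) (gt t ω)) →
        -- the oracle is `ε`-accurate in mean, or with failure probability at most `1 / T`
        ((∀ t < T, Integrable (fun ω => ‖gt t ω - cvarGrad α μ (w t ω)‖) P ∧
            ∫ ω, ‖gt t ω - cvarGrad α μ (w t ω)‖ ∂P ≤ ε) ∨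
          (∀ t < T, P.real {ω | ε < ‖gt t ω - cvarGrad α μ (w t ω)‖} ≤ 1 / (T : ℝ))) →
        ∃ t < T, Integrable (fun ω => CVaR α μ (w t ω) - CVaR α μ wstar) P ∧
          ∫ ω, (CVaR α μ (w t ω) - CVaR α μ wstar) ∂P ≤ C * (1 / √(T : ℝ) + ε)) ∧
    -- number of queries that suffices for `ε`-optimality
    (∃ k : ℕ, ∀ α G R M c₁ c₂ : ℝ, 0 < α → α < 1 → 0 < G → 0 < R → 0 < M → 0 < c₁ → 0 < c₂ →
      ∃ C : ℝ, 0 < C ∧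
      ∀ (d : ℕ) (W : Set (EuclideanSpace ℝ (Fin d))) (w₀ : EuclideanSpace ℝ (Fin d))
        (η : ℕ → ℝ) (ε : ℝ),
        0 < d → IsFeasibleSet W R → w₀ ∈ W → StepSize c₁ c₂ η → 0 < ε → ε < 1 →
        -- quantum: `Õ(d / ε³)` queries to the state preparation unitary
        (∀ (ν : Measure (EuclideanSpace ℝ (Fin d))) [SigmaFinite ν] (e₀ : Register ν),
          ‖e₀‖ = 1 →
          ∃ (T : ℕ) (oracle : EuclideanSpace ℝ (Fin d) →
              QProg (Register ν) (EuclideanSpace ℝ (Fin d))),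
            ((quantumSGD W η w₀ oracle T).queries : ℝ) ≤
              C * (d / ε ^ 3) * (1 + Real.log (d / ε)) ^ k ∧
            ∀ (μ : Measure (EuclideanSpace ℝ (Fin d))) [IsProbabilityMeasure μ],
              RegularReturns μ W G M →
              ∀ U : Register ν ≃ₗᵢ[ℂ] Register ν, Prepares U e₀ μ →
                (∀ w ∈ W, (oracle w).expect U (fun g => ‖g - cvarGrad α μ w‖) ≤ ε) ∧
                ∀ wstar ∈ W, IsMinOn (CVaR α μ) W wstar →
                  ∃ t < T, (quantumSGD W η w₀ oracle t).expect U
                    (fun w => CVaR α μ w - CVaR α μ wstar) ≤ ε) ∧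
        -- classical: `Õ(d / ε⁴)` samples
        (∃ (T n : ℕ) (est : EuclideanSpace ℝ (Fin d) → (Fin n → EuclideanSpace ℝ (Fin d)) →
              EuclideanSpace ℝ (Fin d)),
            Measurable (Function.uncurry est) ∧
            (T : ℝ) * n ≤ C * (d / ε ^ 4) * (1 + Real.log (d / ε)) ^ k ∧
            ∀ (μ : Measure (EuclideanSpace ℝ (Fin d))) [IsProbabilityMeasure μ],
              RegularReturns μ W G M →
                (∀ w ∈ W,
                  Integrable (fun x => ‖est w x - cvarGrad α μ w‖)
                    (Measure.pi fun _ : Fin n => μ) ∧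
                  ∫ x, ‖est w x - cvarGrad α μ w‖ ∂(Measure.pi fun _ : Fin n => μ) ≤ ε) ∧
                ∀ wstar ∈ W, IsMinOn (CVaR α μ) W wstar →
                  ∃ t < T,
                    Integrable (fun x => CVaR α μ (classicalSGD W η w₀ est x t) -
                      CVaR α μ wstar) (sampleLaw n μ) ∧
                    ∫ x, (CVaR α μ (classicalSGD W η w₀ est x t) - CVaR α μ wstar)
                      ∂(sampleLaw n μ) ≤ ε)) := by
  refine ⟨fun G R c₁ c₂ hG hR hc₁ _ => ⟨sgdConst G R c₁ c₂,
    one_pos.trans_le (one_le_sgdConst hR hc₁), ?_⟩, 3,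
    fun α G R M c₁ c₂ hα hα1 hG hR hM hc₁ _ => ?_⟩
  · intro d α hα hα1 μ _ W hW hμ hatom wstar hstar _ η hη Ω _ P _ w gt T ε hT hε hw0 hw0W hgt hstep
      hacc
    exact stochastic_sgd_rate μ hG hR hc₁ hα hα1 hW hμ hatom hstar hη P hT hε hw0 hw0W hgt hstep
      fun t ht => hacc.imp (fun h => h t ht) (fun h => h t ht)
  obtain ⟨C₁, hC₁, hquantum⟩ := quantum_complexity (c₂ := c₂) hα hα1 hG hR hM hc₁
  obtain ⟨C₂, hC₂, hclassical⟩ := classical_complexity (c₂ := c₂) hα hα1 hG hR hc₁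
  refine ⟨C₁ + C₂, by positivity, fun d W w₀ η ε hd hW hw₀ hη hε hε1 => ?_⟩
  have hd1 : (1 : ℝ) ≤ d := by exact_mod_cast hd
  have hlX : 0 ≤ Real.log ((d : ℝ) / ε) :=
    Real.log_nonneg (by rw [le_div_iff₀ hε]; linarith)
  constructor
  · intro ν _ e₀ he₀
    obtain ⟨T, oracle, hq, h⟩ := hquantum d W w₀ η ε hd hW hw₀ hη hε hε1 ν e₀ he₀
    refine ⟨T, oracle, hq.trans ?_, fun μ _ hμ U hU =>
      ⟨(h μ hμ U hU).1, fun wstar hstar _ => (h μ hμ U hU).2 wstar hstar⟩⟩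
    gcongr
    linarith
  · obtain ⟨T, n, est, hm, hTn, h⟩ := hclassical d W w₀ η ε M hW hw₀ hη hε hε1
    refine ⟨T, n, est, hm, ?_, fun μ _ hμ =>
      ⟨(h μ hμ).1, fun wstar hstar _ => (h μ hμ).2 wstar hstar⟩⟩
    calc (T : ℝ) * n ≤ C₂ * (1 / ε ^ 4) * 1 := by rw [mul_one, mul_one_div]; exact hTn
      _ ≤ (C₁ + C₂) * (d / ε ^ 4) * (1 + Real.log (d / ε)) ^ 3 := by
        gcongr
        · linarith
        · exact one_le_pow₀ (by linarith)
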